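/- Let $B_1\subset\mathbb R^3$ be the open unit ball, $\kappa>0$, and for $u\in H^1(B_1)$ (complex-valued) put $\|u\|_{\mathcal B}^2=\|u\|_{L^2(B_1)}^2+\kappa^{-2}\|\nabla u\|_{L^2(B_1)^3}^2$. For integers $\ell\ge 0$, $|m|\le\ell$, let $\tilde b_\ell^m(\mathbf x)=j_\ell(\kappa|\mathbf x|)\,Y_\ell^m(\mathbf x/|\mathbf x|)$ be the spherical waves ($j_\ell$ the spherical Bessel functions, $Y_\ell^m$ the $L^2(\mathbb S^2)$-normalized spherical harmonics), $b_\ell^m=\tilde b_\ell^m/\|\tilde b_\ell^m\|_{\mathcal B}$, and let $\mathcal B$ be the closure in $H^1(B_1)$ of $\operatorname{span}\{b_\ell^m\}$ (the space of Helmholtz solutions in $B_1$). For each $P\in\mathbb N$ let $\Phi_P=\{\phi_p\}_{p=1}^{|\Phi_P|}$ be a finite family in $\mathcal B\cap C^0(\overline{B_1})$, and $T_P\boldsymbol\mu=\sum_p\mu_p\phi_p$ for $\boldsymbol\mu\in\mathbb C^{|\Phi_P|}$. Numbers $s_{\rm ds},C_{\rm ds}\ge 0$ are called *stability constants for the tolerance*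 $\eta>0$ if for every $u\in\mathcal B$ there are $P\in\mathbb N$ and $\boldsymbol\mu\in\mathbb C^{|\Phi_P|}$ with $\|u-T_P\boldsymbol\mu\|_{\mathcal B}\le\eta\|u\|_{\mathcal B}$ and $\|\boldsymbol\mu\|_{\ell^2}\le C_{\rm ds}|\Phi_P|^{s_{\rm ds}}\|u\|_{\mathcal B}$. The sequence $\{\Phi_P\}_P$ is a *stable discrete approximation* if stability constants exist for every $\eta>0$. For every $S\in\mathbb N$ let nodes $\mathbf x_1,\dots,\mathbf x_S\in\partial B_1$ and weights $w_1,\dots,w_S>0$ (both depending on $S$) be given such that $\sum_{s=1}^S w_s v(\mathbf x_s)\to\int_{\partial B_1}v$ as $S\to\infty$ for every $v\in C^0(\partial B_1)$. For $u\in\mathcal B\cap C^0(\overline{B_1})$ let $A_{s,p}=w_s^{1/2}\phi_p(\mathbf x_s)$, $\mathbf b_s=w_s^{1/2}u(\mathbf x_s)$, let $A=U\Sigma V^*$ be a singular value decomposition with singular values $\sigma_1\ge\sigma_2\ge\dots$, $\sigma_{\max}=\sigma_1$ (with $\sigma_{\max}=0$ if $A$ has no entries), and for $\epsilon\in(0,1]$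 let $\boldsymbol\xi_{S,\epsilon}=V\Sigma_\epsilon^\dagger U^*\mathbf b$, where $\Sigma_\epsilon$ is $\Sigma$ with all $\sigma_p<\epsilon\sigma_{\max}$ replaced by $0$ and $\dagger$ is the pseudo-inverse. **Corollary 4.3.** Assume that $\kappa^2$ is not an eigenvalue of the Dirichlet Laplacian in $B_1$. There is a constant $C_{\rm err}>0$, depending only on $\kappa$, such that the following holds for all $\{\Phi_P\}$, nodes and weights as above for which $\{\Phi_P\}_P$ is a stable discrete approximation, and for every $\delta>0$. (a) For every $u\in\mathcal B\cap C^0(\overline{B_1})$ there exist $P\in\mathbb N$, $S_0\in\mathbb N$ and $\epsilon_0\in(0,1]$ such that for all $S\ge S_0$ and $\epsilon\in(0,\epsilon_0]$ $$\|u-T_P\boldsymbol\xi_{S,\epsilon}\|_{L^2(B_1)}\le\delta\|u\|_{\mathcal B}.$$ (b) Let $s_{\rm ds},C_{\rm ds}$ be any stability constants for the tolerance $\eta=\delta/(2C_{\rm err})$. Then for every $u\in\mathcal B\cap C^0(\overline{B_1})$ there exist $P$ and $S_0$ such that the bound in (a) holds for all $S\ge S_0$ and all $\epsilon\in(0,1]$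 with $$\epsilon\le\delta\left(2\,C_{\rm err}\,C_{\rm ds}\,\sigma_{\max}\,|\Phi_P|^{s_{\rm ds}}\right)^{-1}$$ (where $\sigma_{\max}$ depends on $S$ and $P$, and the right-hand side is $+\infty$ if the quantity in parentheses is $0$). Moreover this right-hand side is bounded below, for all $S\ge S_0$, by some $\epsilon_0\in(0,1]$ independent of $S$. -/

import Mathlib

open MeasureTheory Filter Topology
open scoped ContDiff Matrix

noncomputable section

namespace HelmholtzBall

/-! ### The unit ball, weak gradients and `H¹` -/

/-- Three-dimensional Euclidean space. -/
abbrev E3 : Type := EuclideanSpace ℝ (Fin 3)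

/-- The open unit ball of `ℝ³`. -/
abbrev B1 : Set E3 := Metric.ball (0 : E3) 1

/-- Lebesgue measure on the unit ball. -/
abbrev muB : Measure E3 := volume.restrict B1

/-- Partial derivative in the `i`-th coordinate direction. -/
def partialDeriv (i : Fin 3) (φ : E3 → ℂ) (x : E3) : ℂ :=
  fderiv ℝ φ x (EuclideanSpace.single i 1)

/-- Complex-valued smooth functions with compact support in the open unit ball. -/
def IsTestFunction (φ : E3 → ℂ) : Prop :=
  ContDiff ℝ ∞ φ ∧ HasCompactSupport φ ∧ tsupport φ ⊆ B1

/-- `g` is a square-integrable weak gradient of `u` on the unit ball. -/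
def IsWeakGradient (u : E3 → ℂ) (g : E3 → EuclideanSpace ℂ (Fin 3)) : Prop :=
  MemLp g 2 muB ∧ ∀ φ : E3 → ℂ, IsTestFunction φ → ∀ i : Fin 3,
    ∫ x in B1, u x * partialDeriv i φ x = - ∫ x in B1, g x i * φ x

/-- Membership in `H¹(B₁)`.  Functions are defined on all of `ℝ³`, but only their values on the
unit ball, up to null sets, matter. -/
def MemH1 (u : E3 → ℂ) : Prop :=
  MemLp u 2 muB ∧ ∃ g, IsWeakGradient u g

open Classical in
/-- The weak gradient of a function in `H¹(B₁)`, see `weakGradient_ae_eq` for its uniqueness. -/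
def weakGradient (u : E3 → ℂ) : E3 → EuclideanSpace ℂ (Fin 3) :=
  if h : ∃ g, IsWeakGradient u g then h.choose else 0

/-- The weak gradient is unique up to null sets. -/
theorem weakGradient_ae_eq {u : E3 → ℂ} {g : E3 → EuclideanSpace ℂ (Fin 3)}
    (hg : IsWeakGradient u g) : weakGradient u =ᵐ[muB] g := by
  have hex : ∃ g, IsWeakGradient u g := ⟨g, hg⟩
  have hw : IsWeakGradient u (weakGradient u) := by
    simp only [weakGradient, hex, dif_pos]; exact hex.choose_spec
  have hfin : IsFiniteMeasure muB := ⟨by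
    rw [Measure.restrict_apply_univ]; exact measure_ball_lt_top⟩
  have hint : ∀ f : E3 → EuclideanSpace ℂ (Fin 3), MemLp f 2 muB → Integrable f muB :=
    fun f hf => hf.integrable (by norm_num)
  have hcomp : ∀ (f : E3 → EuclideanSpace ℂ (Fin 3)), MemLp f 2 muB → ∀ i,
      Integrable (fun x => f x i) muB := fun f hf i =>
    (EuclideanSpace.proj (𝕜 := ℂ) i).integrable_comp (hint f hf)
  have key : ∀ i : Fin 3, ∀ᵐ x ∂volume, x ∈ B1 → (weakGradient u x i - g x i) = 0 := by
    intro i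
    refine Metric.isOpen_ball.ae_eq_zero_of_integral_contDiff_smul_eq_zero ?_ ?_
    · exact IntegrableOn.locallyIntegrableOn ((hcomp _ hw.1 i).sub (hcomp _ hg.1 i))
    · intro φ hφ hc hs
      have htest : IsTestFunction (fun x => (φ x : ℂ)) := by
        have hts : tsupport (fun x => (φ x : ℂ)) ⊆ tsupport φ := by
          apply closure_mono
          intro x hx h
          apply hx
          simp [h]
        exact ⟨Complex.ofRealCLM.contDiff.comp hφ,
          hc.of_isClosed_subset (isClosed_tsupport _) hts, hts.trans hs⟩
      have h1 := hw.2 _ htest i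
      have h2 := hg.2 _ htest i
      have h3 : ∫ x in B1, weakGradient u x i * (φ x : ℂ) = ∫ x in B1, g x i * (φ x : ℂ) :=
        neg_injective (h1.symm.trans h2)
      obtain ⟨C, hC⟩ := hc.exists_bound_of_continuous hφ.continuous
      have hb : ∀ f : E3 → EuclideanSpace ℂ (Fin 3), MemLp f 2 muB →
          Integrable (fun x => f x i * (φ x : ℂ)) muB := fun f hf =>
        (hcomp f hf i).mul_bdd (c := C)
          (Complex.continuous_ofReal.comp hφ.continuous).aestronglyMeasurable
          (ae_of_all _ fun x => by simpa using hC x)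
      have hzero : ∫ x in B1, φ x • (weakGradient u x i - g x i) = 0 := by
        have : ∀ x, φ x • (weakGradient u x i - g x i)
            = weakGradient u x i * (φ x : ℂ) - g x i * (φ x : ℂ) := by
          intro x; rw [Complex.real_smul]; ring
        simp_rw [this]
        rw [integral_sub (hb _ hw.1) (hb _ hg.1), h3, sub_self]
      rw [← hzero, setIntegral_eq_integral_of_forall_compl_eq_zero]
      intro x hx
      have : φ x = 0 := by
        by_contra hne
        exact hx (hs (subset_tsupport _ hne))
      simp [this]
  have hall : ∀ᵐ x ∂volume, ∀ i : Fin 3, x ∈ B1 → (weakGradient u x i - g x i) = 0 :=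
    ae_all_iff.2 key
  rw [EventuallyEq, ae_restrict_iff' Metric.isOpen_ball.measurableSet]
  filter_upwards [hall] with x hx hxB
  ext i
  exact sub_eq_zero.1 (hx i hxB)

/-- The norm of `L²(B₁)`. -/
def l2Norm (u : E3 → ℂ) : ℝ :=
  √(∫ x in B1, ‖u x‖ ^ 2)

/-- The `κ`-dependent norm `‖u‖² = ‖u‖²_{L²(B₁)} + κ⁻² ‖∇u‖²_{L²(B₁)³}` on `H¹(B₁)`. -/
def bNorm (κ : ℝ) (u : E3 → ℂ) : ℝ :=
  √((∫ x in B1, ‖u x‖ ^ 2) + (κ ^ 2)⁻¹ * ∫ x in B1, ‖weakGradient u x‖ ^ 2)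

/-- Membership in `H¹₀(B₁)`, the closure of the test functions in `H¹(B₁)`. -/
def MemH10 (u : E3 → ℂ) : Prop :=
  MemH1 u ∧ ∀ ε : ℝ, 0 < ε → ∃ φ, IsTestFunction φ ∧ bNorm 1 (u - φ) < ε

/-- `lam` is an eigenvalue of the Dirichlet Laplacian on the unit ball: the problem
`-Δv = lam v`, `v ∈ H¹₀(B₁)`, has a nonzero weak solution. -/
def IsDirichletEigenvalue (lam : ℝ) : Prop :=
  ∃ v : E3 → ℂ, MemH10 v ∧ ¬ (v =ᵐ[muB] 0) ∧ ∀ φ, IsTestFunction φ →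
    ∫ x in B1, ∑ i, weakGradient v x i * partialDeriv i φ x = (lam : ℂ) * ∫ x in B1, v x * φ x

/-! ### Spherical waves and the space `𝓑` -/

/-- The Ferrers function `P_ℓ^m`, `|m| ≤ ℓ`, at `|x| ≤ 1`. -/
def ferrers (l : ℕ) (m : ℤ) (x : ℝ) : ℝ :=
  (-1) ^ m / (2 ^ l * (l.factorial : ℝ)) * (1 - x ^ 2) ^ ((m : ℝ) / 2) *
    (Polynomial.derivative^[((l : ℤ) + m).toNat]
      ((Polynomial.X ^ 2 - 1 : Polynomial ℝ) ^ l)).eval x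

/-- The normalization constant `γ_ℓ^m` of the spherical harmonics. -/
def gammaCoeff (l : ℕ) (m : ℤ) : ℝ :=
  √((2 * l + 1) / (4 * Real.pi) *
    ((((l : ℤ) - m).toNat.factorial : ℝ) / (((l : ℤ) + m).toNat.factorial : ℝ)))

/-- The spherical harmonic `Y_ℓ^m` in spherical coordinates. -/
def sphHarm (l : ℕ) (m : ℤ) (θ φ : ℝ) : ℂ :=
  gammaCoeff l m * Complex.exp (Complex.I * m * φ) * ferrers l m (Real.cos θ)

/-- The spherical harmonic as a function on the unit sphere: the spherical coordinates of
`x = (sin θ cos φ, sin θ sin φ, cos θ)` are `θ = arccos x₃` and `φ = arg (x₁ + i x₂)`. -/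
def sphHarmAt (l : ℕ) (m : ℤ) (x : E3) : ℂ :=
  sphHarm l m (Real.arccos (x 2)) (Complex.arg (⟨x 0, x 1⟩ : ℂ))

/-- The Bessel function `J_ν` at `r > 0`, by its power series. -/
def besselJ (ν r : ℝ) : ℝ :=
  ∑' k : ℕ, (-1) ^ k / ((k.factorial : ℝ) * Real.Gamma (k + ν + 1)) * (r / 2) ^ (2 * (k : ℝ) + ν)

/-- The spherical Bessel function `j_ℓ(r) = √(π / 2r) J_{ℓ+1/2}(r)`, `r > 0`, extended by
continuity to `r = 0`. -/
def sphBessel (l : ℕ) (r : ℝ) : ℝ :=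
  if r = 0 then (if l = 0 then 1 else 0)
  else √(Real.pi / (2 * r)) * besselJ (l + 1 / 2) r

/-- The unnormalized spherical wave `x ↦ j_ℓ(κ|x|) Y_ℓ^m(x/|x|)`. -/
def sphWaveTilde (κ : ℝ) (l : ℕ) (m : ℤ) (x : E3) : ℂ :=
  sphBessel l (κ * ‖x‖) * sphHarmAt l m (‖x‖⁻¹ • x)

/-- The normalized spherical wave `b_ℓ^m`. -/
def sphWave (κ : ℝ) (l : ℕ) (m : ℤ) (x : E3) : ℂ :=
  ((bNorm κ (sphWaveTilde κ l m))⁻¹ : ℝ) * sphWaveTilde κ l m x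

/-- The linear span of the spherical waves `b_ℓ^m`, `|m| ≤ ℓ`. -/
def sphWaveSpan (κ : ℝ) : Submodule ℂ (E3 → ℂ) :=
  Submodule.span ℂ {f | ∃ (l : ℕ) (m : ℤ), |m| ≤ l ∧ f = sphWave κ l m}

/-- Membership in `𝓑`, the closure in `H¹(B₁)` of the span of the spherical waves. -/
def MemB (κ : ℝ) (u : E3 → ℂ) : Prop :=
  MemH1 u ∧ ∀ ε : ℝ, 0 < ε → ∃ v ∈ sphWaveSpan κ, bNorm κ (u - v) < ε

/-- Membership in `𝓑 ∩ C⁰(closure of B₁)`. -/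
def MemBC0 (κ : ℝ) (u : E3 → ℂ) : Prop :=
  MemB κ u ∧ ContinuousOn u (Metric.closedBall (0 : E3) 1)

/-! ### Stable discrete approximation -/

/-- The synthesis operator `c ↦ ∑ₚ cₚ φₚ` of a finite family. -/
def synthesis {N : ℕ} (Φ : Fin N → E3 → ℂ) (c : Fin N → ℂ) (x : E3) : ℂ :=
  ∑ p, c p * Φ p x

/-- `s` and `C` are a stability exponent and a stability constant of the sequence of finite
approximation sets `Φ P = {φ₁, …, φ_{N P}}` for the tolerance `η`. -/
def StableAtTolerance (κ : ℝ) {N : ℕ → ℕ} (Φ : (P : ℕ) → Fin (N P) → E3 → ℂ)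
    (η s C : ℝ) : Prop :=
  0 ≤ s ∧ 0 ≤ C ∧ ∀ u, MemB κ u → ∃ (P : ℕ) (μ : EuclideanSpace ℂ (Fin (N P))),
    bNorm κ (u - synthesis (Φ P) μ) ≤ η * bNorm κ u ∧
    ‖μ‖ ≤ C * (N P : ℝ) ^ s * bNorm κ u

/-- The sequence of approximation sets is a stable discrete approximation for `𝓑`. -/
def IsStableDiscreteApprox (κ : ℝ) {N : ℕ → ℕ} (Φ : (P : ℕ) → Fin (N P) → E3 → ℂ) : Prop :=
  ∀ η : ℝ, 0 < η → ∃ s C : ℝ, StableAtTolerance κ Φ η s C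

/-! ### Boundary sampling and the regularized SVD -/

/-- The unit sphere of `ℝ³`. -/
abbrev S2 : Type := Metric.sphere (0 : E3) 1

/-- Convergence of the cubature rules with nodes `x S` and weights `w S` for all continuous
functions on the sphere; `volume.toSphere` is the surface measure (of total mass `4π`). -/
def CubatureConvergence (x : (S : ℕ) → Fin S → S2) (w : (S : ℕ) → Fin S → ℝ) : Prop :=
  ∀ v : S2 → ℂ, Continuous v →
    Tendsto (fun S => ∑ s, (w S s : ℂ) * v (x S s)) atTop
      (𝓝 (∫ y, v y ∂((volume : Measure E3).toSphere)))

/-- The sampling matrix `A_{s,p} = w_s^{1/2} φ_p(x_s)`. -/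
def samplingMatrix {S N : ℕ} (x : Fin S → S2) (w : Fin S → ℝ) (Φ : Fin N → E3 → ℂ) :
    Matrix (Fin S) (Fin N) ℂ :=
  fun s p => (√(w s) : ℂ) * Φ p (x s)

/-- The load vector `b_s = w_s^{1/2} u(x_s)`. -/
def loadVector {S : ℕ} (x : Fin S → S2) (w : Fin S → ℝ) (u : E3 → ℂ) : Fin S → ℂ :=
  fun s => (√(w s) : ℂ) * u (x s)

/-- The singular values of `A` in descending order, numbered from `0` and followed by zeros. -/
def singVal {S N : ℕ} (A : Matrix (Fin S) (Fin N) ℂ) (i : ℕ) : ℝ :=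
  (Matrix.toEuclideanLin A).singularValues i

/-- The largest singular value. -/
def sigmaMax {S N : ℕ} (A : Matrix (Fin S) (Fin N) ℂ) : ℝ :=
  singVal A 0

/-- The rectangular diagonal matrix of the singular values of `A`. -/
def sigmaMatrix {S N : ℕ} (A : Matrix (Fin S) (Fin N) ℂ) : Matrix (Fin S) (Fin N) ℂ :=
  fun s p => if (s : ℕ) = p then (singVal A p : ℂ) else 0

/-- `A = U Σ V*` is a singular value decomposition of `A`. -/
def IsSVD {S N : ℕ} (A : Matrix (Fin S) (Fin N) ℂ) (U : Matrix (Fin S) (Fin S) ℂ)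
    (V : Matrix (Fin N) (Fin N) ℂ) : Prop :=
  U ∈ Matrix.unitaryGroup (Fin S) ℂ ∧ V ∈ Matrix.unitaryGroup (Fin N) ℂ ∧
    A = U * sigmaMatrix A * Vᴴ

/-- The pseudo-inverse of the truncation of `Σ` in which all singular values below
`ε σ_max` are replaced by zero. -/
def truncatedPinv {S N : ℕ} (A : Matrix (Fin S) (Fin N) ℂ) (ε : ℝ) :
    Matrix (Fin N) (Fin S) ℂ :=
  fun p s => if (s : ℕ) = p ∧ ε * sigmaMax A ≤ singVal A p then ((singVal A p)⁻¹ : ℂ) else 0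

/-- The regularized solution `ξ = V Σ_ε† U* b` of `A ξ = b`, from a singular value decomposition
`A = U Σ V*`. -/
def regularizedSolution {S N : ℕ} (A : Matrix (Fin S) (Fin N) ℂ)
    (U : Matrix (Fin S) (Fin S) ℂ) (V : Matrix (Fin N) (Fin N) ℂ) (ε : ℝ) (b : Fin S → ℂ) :
    Fin N → ℂ :=
  (V * truncatedPinv A ε * Uᴴ) *ᵥ b

/-- Every matrix has a singular value decomposition. -/
theorem exists_isSVD {S N : ℕ} (A : Matrix (Fin S) (Fin N) ℂ) : ∃ U V, IsSVD A U V := by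
  classical
  set T := Matrix.toEuclideanLin A with hT
  have hN : Module.finrank ℂ (EuclideanSpace ℂ (Fin N)) = N := by simp
  let v := T.isSymmetric_adjoint_comp_self.eigenvectorBasis hN
  have hinner : ∀ i j, inner ℂ (T (v i)) (T (v j)) =
      ((T.singularValues i : ℂ) ^ 2) * (if i = j then 1 else 0) := by
    intro i j
    rw [← LinearMap.adjoint_inner_left]
    have h := T.isSymmetric_adjoint_comp_self.apply_eigenvectorBasis hN i
    rw [← T.sq_singularValues_fin hN] at h
    rw [LinearMap.comp_apply] at h
    rw [h, inner_smul_left, orthonormal_iff_ite.1 v.orthonormal i j]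
    simp
  have hzero : ∀ i : Fin N, T.singularValues i = 0 → T (v i) = 0 := by
    intro i hi
    have := hinner i i
    rw [hi] at this
    simpa using this
  have hr : Module.finrank ℂ T.range ≤ S := by
    simpa using T.range.finrank_le
  have hpos : ∀ i : ℕ, T.singularValues i ≠ 0 → i < S ∧ i < N := by
    intro i hi
    have h1 : i < Module.finrank ℂ T.range :=
      T.singularValues_pos_iff_lt_finrank_range.1 ((T.singularValues_pos_iff_ne_zero i).2 hi)
    refine ⟨h1.trans_le hr, ?_⟩
    by_contra h
    exact hi (T.singularValues_of_finrank_le (by rw [hN]; omega))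
  let w : Fin S → EuclideanSpace ℂ (Fin S) := fun s =>
    if h : (s : ℕ) < N then ((T.singularValues s : ℂ)⁻¹) • T (v ⟨s, h⟩) else 0
  let s₀ : Set (Fin S) := {s | T.singularValues s ≠ 0}
  have hw : Orthonormal ℂ (s₀.domRestrict w) := by
    rw [orthonormal_iff_ite]
    rintro ⟨i, hi⟩ ⟨j, hj⟩
    have hiN := (hpos i hi).2
    have hjN := (hpos j hj).2
    have hi' : (T.singularValues i : ℂ) ≠ 0 := by exact_mod_cast hi
    simp only [Set.domRestrict_apply, w, hiN, hjN, dif_pos, inner_smul_left, inner_smul_right,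
      hinner]
    by_cases hij : i = j
    · subst hij
      simp
      field_simp
    · have : ¬ (i : ℕ) = j := fun h => hij (Fin.ext h)
      simp [hij, this]
  obtain ⟨u, hu⟩ := hw.exists_orthonormalBasis_extension_of_card_eq (by simp)
  let U : Matrix (Fin S) (Fin S) ℂ := fun i s => u s i
  let V : Matrix (Fin N) (Fin N) ℂ := fun i p => v p i
  have hU : U ∈ Matrix.unitaryGroup (Fin S) ℂ :=
    (EuclideanSpace.basisFun (Fin S) ℂ).toMatrix_orthonormalBasis_mem_unitary u
  have hV : V ∈ Matrix.unitaryGroup (Fin N) ℂ :=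
    (EuclideanSpace.basisFun (Fin N) ℂ).toMatrix_orthonormalBasis_mem_unitary v
  refine ⟨U, V, hU, hV, ?_⟩
  have hAV : A * V = U * sigmaMatrix A := by
    ext i p
    have h1 : (A * V) i p = T (v p) i := rfl
    have h2 : (U * sigmaMatrix A) i p =
        ∑ s : Fin S, u s i * (if (s : ℕ) = p then (T.singularValues p : ℂ) else 0) := rfl
    rw [h1, h2]
    by_cases hp : T.singularValues p = 0
    · rw [hzero p hp]
      simp [hp]
    · have hpS := (hpos p hp).1
      have hp' : (T.singularValues p : ℂ) ≠ 0 := by exact_mod_cast hp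
      rw [Finset.sum_eq_single (⟨p, hpS⟩ : Fin S)]
      · rw [hu ⟨p, hpS⟩ hp]
        simp [w]
        field_simp
      · intro b _ hb
        have : ¬ (b : ℕ) = p := fun h => hb (Fin.ext h)
        simp [this]
      · simp
  rw [← hAV, Matrix.mul_assoc, ← Matrix.star_eq_conjTranspose,
    (Matrix.mem_unitaryGroup_iff).1 hV, Matrix.mul_one]

end HelmholtzBall

end

noncomputable section

namespace HelmholtzBall

/-! ### The regularized singular value decomposition -/

/-! The sampled boundary values see the whole error. For continuous elements of `𝓑` the `L²` norm on
the ball is controlled by the `L²` norm on the sphere (`exists_l2On_ball_le_l2On_sphere`), which in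
turn is controlled by the `𝓑` norm (`trace_inequality`). On the finite-dimensional span of `u` and
the `φ_p`, cubature sums are comparable to the boundary norm once `S` is large
(`eventually_abs_cubature_sub_le`), so `‖b - A μ‖` measures the boundary error of `u - T_P μ`.
Truncating the SVD leaves a residual of at most `‖b - A μ‖ + ε σ_max ‖μ‖` for every competitor `μ`
(`norm_sub_regularizedSolution_le`). Chaining these bounds gives `exists_l2Norm_sub_synthesis_le`.
If `μ` is the stable approximant for the tolerance `δ / (2 Cerr)`, each of the two terms costs at
most half of `δ ‖u‖`.

The lower bound is where the eigenvalue condition enters. By orthogonality of the spherical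
harmonics, the squared norm of a finite wave sum on the sphere of radius `r` is a combination of the
`j_l(κ r)²` with nonnegative coefficients. If no `j_l` vanishes at `κ`, then `j_l(κ r)² ≤ C j_l(κ
s)²` for `r ≤ s` and `s` near `1`, uniformly in `l`: for large `l` the power series is dominated by
its first term, and finitely many `l` are handled by continuity. Averaging over `s` in a thin shell
gives an inequality between `L²` norms that survives passage to the closure; shrinking the shell to
the sphere gives the claim. A zero `j_l(κ) = 0` would make `G_l(κ² |x|²) (x₁ + i x₂)^l` a Dirichlet
eigenfunction, where `G_l` is the even entire factor of `j_l`.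

Orthogonality is proved by hand: rotations about the third axis separate the orders, and a Wronskian
identity for Legendre derivatives, together with a moment recursion on the sphere, separates the
degrees. The trace inequality comes from testing the weak gradient with fields `ψ(|x|) |x|⁻³
f(x/|x|) x`, whose divergence contains only `ψ'`. -/

theorem norm_toLp_unitary_mulVec {n : ℕ} {U : Matrix (Fin n) (Fin n) ℂ}
    (hU : U ∈ Matrix.unitaryGroup (Fin n) ℂ) (v : Fin n → ℂ) :
    ‖WithLp.toLp 2 (U *ᵥ v)‖ = ‖WithLp.toLp 2 v‖ := by
  have h : ∀ w : Fin n → ℂ, ((‖WithLp.toLp 2 w‖ ^ 2 : ℝ) : ℂ) = star w ⬝ᵥ w := fun w => by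
    rw [EuclideanSpace.norm_sq_eq]
    simp [dotProduct, Complex.conj_mul']
  have h2 : ((‖WithLp.toLp 2 (U *ᵥ v)‖ ^ 2 : ℝ) : ℂ) = ((‖WithLp.toLp 2 v‖ ^ 2 : ℝ) : ℂ) := by
    rw [h, h, Matrix.star_mulVec, Matrix.dotProduct_mulVec, Matrix.vecMul_vecMul,
      ← Matrix.star_eq_conjTranspose, (Matrix.mem_unitaryGroup_iff').1 hU, Matrix.vecMul_one]
  have h3 := Complex.ofReal_injective h2
  exact (pow_left_inj₀ (norm_nonneg _) (norm_nonneg _) two_ne_zero).1 h3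

theorem norm_toLp_conjTranspose_mulVec {n : ℕ} {U : Matrix (Fin n) (Fin n) ℂ}
    (hU : U ∈ Matrix.unitaryGroup (Fin n) ℂ) (v : Fin n → ℂ) :
    ‖WithLp.toLp 2 (Uᴴ *ᵥ v)‖ = ‖WithLp.toLp 2 v‖ :=
  norm_toLp_unitary_mulVec (by
    rw [Matrix.mem_unitaryGroup_iff', Matrix.star_eq_conjTranspose, Matrix.conjTranspose_conjTranspose,
      ← Matrix.star_eq_conjTranspose]
    exact (Matrix.mem_unitaryGroup_iff).1 hU) v

theorem singVal_nonneg {S N : ℕ} (A : Matrix (Fin S) (Fin N) ℂ) (i : ℕ) : 0 ≤ singVal A i :=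
  LinearMap.singularValues_nonneg _ i

/-- The residual projection `1 - Σ Σ_ε†` is diagonal with entries `0` or `1`. -/
theorem sigma_mul_truncatedPinv {S N : ℕ} (A : Matrix (Fin S) (Fin N) ℂ) (ε : ℝ) :
    1 - sigmaMatrix A * truncatedPinv A ε = Matrix.diagonal fun s : Fin S =>
      if (s : ℕ) < N ∧ ε * sigmaMax A ≤ singVal A s ∧ singVal A s ≠ 0 then (0 : ℂ) else 1 := by
  ext s t
  rw [Matrix.sub_apply, Matrix.mul_apply, Matrix.one_apply, Matrix.diagonal_apply]
  by_cases hs : (s : ℕ) < N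
  · rw [Finset.sum_eq_single (⟨s, hs⟩ : Fin N)]
    · by_cases hst : s = t
      · subst hst
        by_cases h1 : ε * sigmaMax A ≤ singVal A s <;> by_cases h2 : singVal A s = 0 <;>
          simp [sigmaMatrix, truncatedPinv, hs, h1, h2]
      · have : ¬ (t : ℕ) = s := fun h => hst (Fin.ext h.symm)
        simp [sigmaMatrix, truncatedPinv, hst, this]
    · intro p _ hp
      have : ¬ (s : ℕ) = p := fun h => hp (Fin.ext h.symm)
      simp [sigmaMatrix, this]
    · simp
  · rw [Finset.sum_eq_zero]
    · by_cases hst : s = t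
      · subst hst; simp [hs]
      · simp [hst]
    · intro p _
      have : ¬ (s : ℕ) = p := fun h => hs (h ▸ p.2)
      simp [sigmaMatrix, this]

theorem norm_residual_mulVec_le {S N : ℕ} (A : Matrix (Fin S) (Fin N) ℂ) (ε : ℝ)
    (v : Fin S → ℂ) :
    ‖WithLp.toLp 2 ((1 - sigmaMatrix A * truncatedPinv A ε) *ᵥ v)‖ ≤ ‖WithLp.toLp 2 v‖ := by
  rw [sigma_mul_truncatedPinv, EuclideanSpace.norm_eq, EuclideanSpace.norm_eq]
  refine Real.sqrt_le_sqrt (Finset.sum_le_sum fun s _ => ?_)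
  simp only [Matrix.mulVec_diagonal]
  split_ifs <;> simp

/-- The residual projection keeps only those diagonal entries of `Σ` that are zero or lie below the
threshold, so each surviving singular value is at most `ε σ_max`. -/
theorem norm_residual_mul_sigma_mulVec_le {S N : ℕ} (A : Matrix (Fin S) (Fin N) ℂ) {ε : ℝ}
    (hε : 0 ≤ ε) (v : Fin N → ℂ) :
    ‖WithLp.toLp 2 ((1 - sigmaMatrix A * truncatedPinv A ε) *ᵥ (sigmaMatrix A *ᵥ v))‖
      ≤ ε * sigmaMax A * ‖WithLp.toLp 2 v‖ := by
  have h0 : 0 ≤ ε * sigmaMax A := mul_nonneg hε (singVal_nonneg A 0)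
  rw [sigma_mul_truncatedPinv]
  refine le_of_sq_le_sq ?_ (by positivity)
  rw [mul_pow, EuclideanSpace.norm_sq_eq, EuclideanSpace.norm_sq_eq]
  have hterm : ∀ s : Fin S, ‖(Matrix.diagonal (fun s : Fin S =>
      if (s : ℕ) < N ∧ ε * sigmaMax A ≤ singVal A s ∧ singVal A s ≠ 0 then (0 : ℂ) else 1) *ᵥ
      (sigmaMatrix A *ᵥ v)) s‖ ^ 2 ≤
      (ε * sigmaMax A) ^ 2 * if h : (s : ℕ) < N then ‖v ⟨s, h⟩‖ ^ 2 else 0 := by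
    intro s
    rw [Matrix.mulVec_diagonal]
    by_cases hs : (s : ℕ) < N
    · have hv : (sigmaMatrix A *ᵥ v) s = singVal A s * v ⟨s, hs⟩ := by
        simp only [Matrix.mulVec, dotProduct, sigmaMatrix]
        rw [Finset.sum_eq_single (⟨s, hs⟩ : Fin N)]
        · simp
        · intro p _ hp
          have : ¬ (s : ℕ) = p := fun h => hp (Fin.ext h.symm)
          simp [this]
        · simp
      rw [hv]
      simp only [hs, true_and, dif_pos]
      split_ifs with h
      · simp; positivity
      · rw [one_mul, norm_mul, mul_pow]
        refine mul_le_mul_of_nonneg_right ?_ (sq_nonneg _)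
        refine pow_le_pow_left₀ (norm_nonneg _) ?_ 2
        rw [Complex.norm_real, Real.norm_of_nonneg (singVal_nonneg A _)]
        by_contra! hlt
        exact h ⟨hlt.le, (h0.trans_lt hlt).ne'⟩
    · have hv : (sigmaMatrix A *ᵥ v) s = 0 := by
        simp only [Matrix.mulVec, dotProduct, sigmaMatrix]
        refine Finset.sum_eq_zero fun p _ => ?_
        have : ¬ (s : ℕ) = p := fun h => hs (h ▸ p.2)
        simp [this]
      rw [hv]
      simp [hs]
  refine (Finset.sum_le_sum fun s _ => hterm s).trans ?_
  rw [← Finset.mul_sum]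
  refine mul_le_mul_of_nonneg_left ?_ (sq_nonneg _)
  -- Extending `‖v p‖²` by zero to all naturals allows the comparison whichever of `S` and `N` is
  -- larger.
  let F : ℕ → ℝ := fun n => if h : n < N then ‖v ⟨n, h⟩‖ ^ 2 else 0
  have hF : ∀ n, 0 ≤ F n := fun n => by simp only [F]; split_ifs <;> positivity
  have e3 : ∑ p : Fin N, ‖v p‖ ^ 2 = ∑ n ∈ Finset.range N, F n := by
    rw [← Fin.sum_univ_eq_sum_range]
    exact Finset.sum_congr rfl fun p _ => by simp [F]
  have e4 : ∑ s : Fin S, F s = ∑ n ∈ Finset.range S, F n := Fin.sum_univ_eq_sum_range F S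
  change ∑ s : Fin S, F s ≤ ∑ p : Fin N, ‖v p‖ ^ 2
  rw [e3, e4]
  rcases le_total S N with h | h
  · exact Finset.sum_le_sum_of_subset_of_nonneg (by simpa using h) fun n _ _ => hF n
  · rw [Finset.sum_subset (Finset.range_subset_range.2 h)]
    intro n _ hn
    simp only [Finset.mem_range] at hn
    simp [F, hn]

/-- Quasi-optimality of the truncated singular value decomposition. -/
theorem norm_sub_regularizedSolution_le {S N : ℕ} {A : Matrix (Fin S) (Fin N) ℂ}
    {U : Matrix (Fin S) (Fin S) ℂ} {V : Matrix (Fin N) (Fin N) ℂ} (h : IsSVD A U V) {ε : ℝ}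
    (hε : 0 ≤ ε) (b : Fin S → ℂ) (c : Fin N → ℂ) :
    ‖WithLp.toLp 2 (b - A *ᵥ regularizedSolution A U V ε b)‖
      ≤ ‖WithLp.toLp 2 (b - A *ᵥ c)‖ + ε * sigmaMax A * ‖WithLp.toLp 2 c‖ := by
  obtain ⟨hU, hV, hA⟩ := h
  have hUU : U * Uᴴ = 1 := (Matrix.mem_unitaryGroup_iff).1 hU
  have hUU' : Uᴴ * U = 1 := (Matrix.mem_unitaryGroup_iff').1 hU
  have hVV : Vᴴ * V = 1 := (Matrix.mem_unitaryGroup_iff').1 hV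
  set R : Matrix (Fin S) (Fin S) ℂ := 1 - sigmaMatrix A * truncatedPinv A ε with hR
  -- In the singular bases the residual operator is the diagonal projection `R`, which does not
  -- depend on the competitor `c`.
  have key : b - A *ᵥ regularizedSolution A U V ε b = U *ᵥ (R *ᵥ (Uᴴ *ᵥ b)) := by
    have h1 : A * (V * truncatedPinv A ε * Uᴴ) = 1 - U * R * Uᴴ := by
      rw [hR]
      generalize truncatedPinv A ε = D
      generalize sigmaMatrix A = Sg at hA
      rw [hA, Matrix.mul_sub, Matrix.sub_mul, Matrix.mul_one, hUU, sub_sub_cancel]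
      simp only [Matrix.mul_assoc]
      rw [← Matrix.mul_assoc Vᴴ V, hVV, Matrix.one_mul]
    rw [regularizedSolution, Matrix.mulVec_mulVec, h1, Matrix.sub_mulVec, Matrix.one_mulVec,
      sub_sub_cancel, Matrix.mulVec_mulVec, Matrix.mulVec_mulVec, Matrix.mul_assoc]
  -- Write `b = (b - A c) + A c`: `R` is a contraction on the first part and acts on `Σ V* c` for
  -- the second.
  have hsplit : Uᴴ *ᵥ b = Uᴴ *ᵥ (b - A *ᵥ c) + sigmaMatrix A *ᵥ (Vᴴ *ᵥ c) := by
    rw [Matrix.mulVec_sub, Matrix.mulVec_mulVec, Matrix.mulVec_mulVec]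
    have : Uᴴ * A = sigmaMatrix A * Vᴴ := by
      conv_lhs => rw [hA]
      rw [← Matrix.mul_assoc, ← Matrix.mul_assoc, hUU', Matrix.one_mul]
    rw [this, sub_add_cancel]
  rw [key, norm_toLp_unitary_mulVec hU, hsplit, Matrix.mulVec_add, WithLp.toLp_add]
  refine (norm_add_le _ _).trans (add_le_add ?_ ?_)
  · exact (norm_residual_mulVec_le A ε _).trans_eq (norm_toLp_conjTranspose_mulVec hU _)
  · exact (norm_residual_mul_sigma_mulVec_le A hε _).trans_eq
      (by rw [norm_toLp_conjTranspose_mulVec hV])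

/-- The largest singular value is bounded by the Frobenius norm. -/
theorem sq_sigmaMax_le {S N : ℕ} (A : Matrix (Fin S) (Fin N) ℂ) :
    sigmaMax A ^ 2 ≤ ∑ p, ∑ s, ‖A s p‖ ^ 2 := by
  set T := Matrix.toEuclideanLin A with hT
  have hN : Module.finrank ℂ (EuclideanSpace ℂ (Fin N)) = N := by simp
  rcases Nat.eq_zero_or_pos N with h0 | h0
  · have : sigmaMax A = 0 := T.singularValues_of_finrank_le (by rw [hN, h0])
    rw [this]
    simp only [ne_eq, OfNat.ofNat_ne_zero, not_false_eq_true, zero_pow]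
    positivity
  let v := T.isSymmetric_adjoint_comp_self.eigenvectorBasis hN
  let i : Fin N := ⟨0, h0⟩
  have h1 : ((T.singularValues i : ℂ) ^ 2) = inner ℂ (T (v i)) (T (v i)) := by
    rw [← LinearMap.adjoint_inner_left]
    have h := T.isSymmetric_adjoint_comp_self.apply_eigenvectorBasis hN i
    rw [← T.sq_singularValues_fin hN] at h
    rw [LinearMap.comp_apply] at h
    rw [h, inner_smul_left, orthonormal_iff_ite.1 v.orthonormal i i]
    simp
  -- The largest singular value is attained at the unit eigenvector `v i` of `A* A`; Cauchy–Schwarz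
  -- in each row then gives the Frobenius bound.
  have h2 : sigmaMax A ^ 2 = ‖T (v i)‖ ^ 2 := by
    rw [inner_self_eq_norm_sq_to_K] at h1
    have : ((T.singularValues i ^ 2 : ℝ) : ℂ) = ((‖T (v i)‖ ^ 2 : ℝ) : ℂ) := by
      push_cast; exact h1
    exact Complex.ofReal_injective this
  have hvn : ‖v i‖ = 1 := v.orthonormal.1 i
  rw [h2, EuclideanSpace.norm_sq_eq, Finset.sum_comm]
  refine Finset.sum_le_sum fun s _ => ?_
  have h3 : T (v i) s = ∑ p, A s p * v i p := rfl
  rw [h3]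
  calc ‖∑ p, A s p * v i p‖ ^ 2 ≤ (∑ p, ‖A s p‖ * ‖v i p‖) ^ 2 := by
        gcongr
        refine (norm_sum_le _ _).trans_eq ?_
        simp
    _ ≤ (∑ p, ‖A s p‖ ^ 2) * ∑ p, ‖v i p‖ ^ 2 := Finset.sum_mul_sq_le_sq_mul_sq _ _ _
    _ = ∑ p, ‖A s p‖ ^ 2 := by rw [← EuclideanSpace.norm_sq_eq, hvn]; simp

/-! ### Polar coordinates -/

/-- The surface measure of the unit sphere. -/
abbrev sphMeasure : Measure S2 := (volume : Measure E3).toSphere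

theorem integrable_polar {F : Type*} [NormedAddCommGroup F] {f : E3 → F} (hf : Integrable f) :
    Integrable (fun p : S2 × Set.Ioi (0 : ℝ) => f ((p.2 : ℝ) • (p.1 : E3)))
      (sphMeasure.prod (Measure.volumeIoiPow 2)) := by
  have hmp := (volume : Measure E3).measurePreserving_homeomorphUnitSphereProd
  rw [show Module.finrank ℝ E3 - 1 = 2 by simp] at hmp
  rw [← hmp.integrable_comp_emb (Homeomorph.measurableEmbedding _)]
  have h1 : IntegrableOn f ({0}ᶜ : Set E3) := hf.integrableOn
  rw [integrableOn_iff_comap_subtypeVal (measurableSet_singleton _).compl] at h1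
  refine h1.congr (ae_of_all _ fun x => ?_)
  have hx : ‖(x : E3)‖ ≠ 0 := norm_ne_zero_iff.2 x.2
  simp [smul_smul, hx]

section Polar

variable {F : Type*} [NormedAddCommGroup F] [NormedSpace ℝ F]

/-- The homeomorphism of the punctured space with sphere times half-line is measure preserving for
the density `r²`, and the origin is a null set. -/
theorem integral_polar {f : E3 → F} (hf : Integrable f) :
    ∫ x, f x = ∫ r in Set.Ioi (0 : ℝ), r ^ 2 • ∫ y : S2, f (r • (y : E3)) ∂sphMeasure := by
  have hmp := (volume : Measure E3).measurePreserving_homeomorphUnitSphereProd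
  rw [show Module.finrank ℝ E3 - 1 = 2 by simp] at hmp
  have h1 : ∫ x, f x = ∫ p : S2 × Set.Ioi (0 : ℝ), f ((p.2 : ℝ) • (p.1 : E3))
      ∂(sphMeasure.prod (Measure.volumeIoiPow 2)) := by
    rw [← hmp.integral_comp (Homeomorph.measurableEmbedding _)
      (fun p : S2 × Set.Ioi (0 : ℝ) => f ((p.2 : ℝ) • (p.1 : E3)))]
    have h2 : ∫ x, f x = ∫ x in ({0}ᶜ : Set E3), f x := by
      rw [restrict_compl_singleton]
    rw [h2, ← integral_subtype_comap (measurableSet_singleton _).compl]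
    refine integral_congr_ae (ae_of_all _ fun x => ?_)
    have hx : ‖(x : E3)‖ ≠ 0 := norm_ne_zero_iff.2 x.2
    simp [smul_smul, hx]
  rw [h1, integral_prod_symm _ (integrable_polar hf)]
  simp only [Measure.volumeIoiPow, ENNReal.ofReal]
  rw [integral_withDensity_eq_integral_smul
      ((measurable_subtype_coe.pow_const _).real_toNNReal),
    integral_subtype_comap measurableSet_Ioi
      (fun r : ℝ => Real.toNNReal (r ^ 2) • ∫ y : S2, f (r • (y : E3)) ∂sphMeasure),
    setIntegral_congr_fun measurableSet_Ioi fun x hx ↦ ?_]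
  rw [NNReal.smul_def, Real.coe_toNNReal _ (pow_nonneg (le_of_lt hx) _)]

theorem setIntegral_polar {T : Set ℝ} (hT : MeasurableSet T) {f : E3 → F}
    (hf : IntegrableOn f {x | ‖x‖ ∈ T}) :
    ∫ x in {x | ‖x‖ ∈ T}, f x =
      ∫ r in Set.Ioi (0 : ℝ) ∩ T, r ^ 2 • ∫ y : S2, f (r • (y : E3)) ∂sphMeasure := by
  have hm : MeasurableSet {x : E3 | ‖x‖ ∈ T} := measurable_norm hT
  rw [← integral_indicator hm, integral_polar ((integrable_indicator_iff hm).2 hf),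
    ← setIntegral_indicator hT]
  refine setIntegral_congr_fun measurableSet_Ioi fun r hr => ?_
  have hr' : |r| = r := abs_of_pos hr
  by_cases h : r ∈ T <;> simp [Set.indicator, norm_smul, hr', h]

theorem continuous_sphere_integral {f : E3 → F} (hf : Continuous f) :
    Continuous fun r : ℝ => ∫ y : S2, f (r • (y : E3)) ∂sphMeasure := by
  have h := continuous_parametric_integral_of_continuous (μ := sphMeasure)
    (f := fun (r : ℝ) (y : S2) => f (r • (y : E3)))
    (by simp only [Function.uncurry_def]; fun_prop) (isCompact_univ : IsCompact (Set.univ : Set S2))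
  simpa using h

/-- The shell `a < |x| < 1`. -/
abbrev shell (a : ℝ) : Set E3 := {x | ‖x‖ ∈ Set.Ioo a 1}

theorem setIntegral_ball_polar {a : ℝ} (ha : 0 ≤ a) {f : E3 → F}
    (hf : IntegrableOn f (Metric.ball 0 a)) :
    ∫ x in Metric.ball 0 a, f x =
      ∫ r in (0 : ℝ)..a, r ^ 2 • ∫ y : S2, f (r • (y : E3)) ∂sphMeasure := by
  have h : Metric.ball (0 : E3) a = {x | ‖x‖ ∈ Set.Iio a} := by ext; simp
  rw [h] at hf ⊢
  rw [setIntegral_polar measurableSet_Iio hf, intervalIntegral.integral_of_le ha,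
    integral_Ioc_eq_integral_Ioo]
  rfl

theorem setIntegral_shell_polar {a : ℝ} (ha : 0 ≤ a) (ha1 : a ≤ 1) {f : E3 → F}
    (hf : IntegrableOn f (shell a)) :
    ∫ x in shell a, f x =
      ∫ r in a..1, r ^ 2 • ∫ y : S2, f (r • (y : E3)) ∂sphMeasure := by
  rw [setIntegral_polar measurableSet_Ioo hf, intervalIntegral.integral_of_le ha1,
    integral_Ioc_eq_integral_Ioo]
  congr 2
  ext r
  simp only [Set.mem_inter_iff, Set.mem_Ioi, Set.mem_Ioo]
  exact ⟨fun h => h.2, fun h => ⟨ha.trans_lt h.1, h⟩⟩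

/-- The surface integral as a volume integral. -/
theorem sphere_integral_eq [CompleteSpace F] {f : E3 → F} (hf : Continuous fun y : S2 => f y)
    (hm : StronglyMeasurable f) :
    ∫ y : S2, f y ∂sphMeasure = (3 : ℝ) • ∫ x in B1, f (‖x‖⁻¹ • x) := by
  obtain ⟨C, hC⟩ := (isCompact_univ : IsCompact (Set.univ : Set S2)).exists_bound_of_continuousOn
    hf.continuousOn
  have hint : IntegrableOn (fun x : E3 => f (‖x‖⁻¹ • x)) B1 := by
    refine Measure.integrableOn_of_bounded (M := max C ‖f 0‖) measure_ball_lt_top.ne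
      (hm.comp_measurable (by fun_prop)).aestronglyMeasurable (ae_of_all _ fun x => ?_)
    rcases eq_or_ne x 0 with rfl | hx
    · simp
    · exact (hC ⟨‖x‖⁻¹ • x, by simp [norm_smul, hx]⟩ trivial).trans (le_max_left _ _)
  rw [setIntegral_ball_polar zero_le_one hint]
  have : ∀ r ∈ Set.uIoc (0 : ℝ) 1, r ^ 2 • ∫ y : S2, f (‖r • (y : E3)‖⁻¹ • r • (y : E3)) ∂sphMeasure
      = r ^ 2 • ∫ y : S2, f y ∂sphMeasure := by
    intro r hr
    rw [Set.uIoc_of_le zero_le_one] at hr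
    have h1 : r ≠ 0 := hr.1.ne'
    simp [norm_smul, abs_of_pos hr.1, smul_smul, h1]
  -- The integrand is constant along rays, so the radial integral is `∫₀¹ r² dr = 1/3`, which
  -- explains the factor `3`.
  rw [intervalIntegral.integral_congr_ae (ae_of_all _ this),
    intervalIntegral.integral_smul_const, integral_pow, smul_smul]
  norm_num

/-- Written as a volume integral of a function constant along rays, the surface integral inherits
the invariance of Lebesgue measure. -/
theorem sphere_integral_comp_isometry [CompleteSpace F] {f : E3 → F} (hf : Continuous fun y : S2 => f y)
    (hm : StronglyMeasurable f) (R : E3 ≃ₗᵢ[ℝ] E3) :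
    ∫ y : S2, f (R y) ∂sphMeasure = ∫ y : S2, f y ∂sphMeasure := by
  have hf' : Continuous fun y : S2 => f (R y) := by
    have : Continuous fun y : S2 => (⟨R y, by simp⟩ : S2) := by fun_prop
    exact hf.comp this
  rw [sphere_integral_eq hf hm, sphere_integral_eq (f := fun x => f (R x)) hf' (hm.comp_measurable R.continuous.measurable)]
  congr 1
  have h := (R.measurePreserving).setIntegral_preimage_emb
    R.toHomeomorph.measurableEmbedding (fun x => f (‖x‖⁻¹ • x)) B1
  have hB : R ⁻¹' B1 = B1 := by ext; simp
  rw [hB] at h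
  rw [← h]
  simp

end Polar

/-- Radial retraction of the space onto the closed unit ball. -/
def retract (x : E3) : E3 := (max 1 ‖x‖)⁻¹ • x

theorem retract_of_mem {x : E3} (hx : x ∈ Metric.closedBall (0 : E3) 1) : retract x = x := by
  simp only [mem_closedBall_zero_iff] at hx
  simp [retract, hx]

theorem continuous_retract : Continuous retract := by
  unfold retract
  refine Continuous.smul (Continuous.inv₀ (continuous_const.max continuous_norm) fun x => ?_) continuous_id
  exact (zero_lt_one.trans_le (le_max_left _ _)).ne'

theorem retract_mem (x : E3) : retract x ∈ Metric.closedBall (0 : E3) 1 := by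
  have h : 0 < max 1 ‖x‖ := zero_lt_one.trans_le (le_max_left _ _)
  rw [mem_closedBall_zero_iff, retract, norm_smul, norm_inv, Real.norm_of_nonneg h.le,
    inv_mul_le_iff₀ h, mul_one]
  exact le_max_right _ _

/-- Turns continuity on the closed ball into global continuity without changing any value there. -/
theorem continuous_comp_retract {u : E3 → ℂ} (hu : ContinuousOn u (Metric.closedBall 0 1)) :
    Continuous (u ∘ retract) :=
  hu.comp_continuous continuous_retract retract_mem

/-! ### The `L²` seminorm as the square root of an integral -/

section L2

variable {α E F : Type*} [MeasurableSpace α] [NormedAddCommGroup E] [NormedAddCommGroup F]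

/-- The `L²` seminorm of a function with respect to a measure. -/
def l2On (μ : Measure α) (f : α → E) : ℝ := √(∫ x, ‖f x‖ ^ 2 ∂μ)

variable {μ : Measure α}

theorem l2On_nonneg (f : α → E) : 0 ≤ l2On μ f := Real.sqrt_nonneg _

theorem sq_l2On (f : α → E) : l2On μ f ^ 2 = ∫ x, ‖f x‖ ^ 2 ∂μ :=
  Real.sq_sqrt (integral_nonneg fun _ => by positivity)

theorem l2On_eq_toReal_eLpNorm {f : α → E} (hf : MemLp f 2 μ) :
    l2On μ f = (eLpNorm f 2 μ).toReal := by
  rw [hf.eLpNorm_eq_integral_rpow_norm two_ne_zero ENNReal.ofNat_ne_top,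
    ENNReal.toReal_ofReal (by positivity), l2On, Real.sqrt_eq_rpow]
  norm_num

theorem l2On_add_le {f g : α → E} (hf : MemLp f 2 μ) (hg : MemLp g 2 μ) :
    l2On μ (f + g) ≤ l2On μ f + l2On μ g := by
  rw [l2On_eq_toReal_eLpNorm hf, l2On_eq_toReal_eLpNorm hg, l2On_eq_toReal_eLpNorm (hf.add hg),
    ← ENNReal.toReal_add hf.eLpNorm_ne_top hg.eLpNorm_ne_top]
  exact ENNReal.toReal_mono (ENNReal.add_ne_top.2 ⟨hf.eLpNorm_ne_top, hg.eLpNorm_ne_top⟩)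
    (eLpNorm_add_le hf.1 hg.1 one_le_two)

theorem l2On_smul (c : ℂ) (f : α → ℂ) : l2On μ (c • f) = ‖c‖ * l2On μ f := by
  simp only [l2On, Pi.smul_apply, norm_smul, mul_pow]
  rw [integral_const_mul, Real.sqrt_mul (sq_nonneg _), Real.sqrt_sq (norm_nonneg _)]

theorem l2On_neg (f : α → E) : l2On μ (-f) = l2On μ f := by simp [l2On]

theorem integral_norm_mul_norm_le {f : α → E} {g : α → F} (hf : MemLp f 2 μ) (hg : MemLp g 2 μ) :
    ∫ x, ‖f x‖ * ‖g x‖ ∂μ ≤ l2On μ f * l2On μ g := by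
  have h := integral_mul_le_Lp_mul_Lq_of_nonneg (μ := μ) (f := fun x => ‖f x‖)
    (g := fun x => ‖g x‖) Real.HolderConjugate.two_two
    (ae_of_all _ fun x => norm_nonneg _) (ae_of_all _ fun x => norm_nonneg _)
    (by simpa using hf.norm) (by simpa using hg.norm)
  simpa [l2On, Real.sqrt_eq_rpow] using h

theorem integrable_norm_mul_norm {f : α → E} {g : α → F} (hf : MemLp f 2 μ) (hg : MemLp g 2 μ) :
    Integrable (fun x => ‖f x‖ * ‖g x‖) μ :=
  MemLp.integrable_mul (p := 2) (q := 2) hf.norm hg.norm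

/-- Cauchy–Schwarz in the form needed for all the pairings of the trace argument. -/
theorem norm_integral_le_of_le_mul {G : Type*} [NormedAddCommGroup G] [NormedSpace ℝ G]
    {f : α → E} {g : α → F} {k : α → G} {C : ℝ} (hf : MemLp f 2 μ) (hg : MemLp g 2 μ)
    (hC : 0 ≤ C) (hk : ∀ x, ‖k x‖ ≤ C * (‖f x‖ * ‖g x‖)) :
    ‖∫ x, k x ∂μ‖ ≤ C * (l2On μ f * l2On μ g) := by
  refine (norm_integral_le_of_norm_le ((integrable_norm_mul_norm hf hg).const_mul C)
    (ae_of_all _ hk)).trans ?_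
  rw [integral_const_mul]
  exact mul_le_mul_of_nonneg_left (integral_norm_mul_norm_le hf hg) hC

end L2

instance isFiniteMeasure_muB : IsFiniteMeasure muB :=
  ⟨by rw [Measure.restrict_apply_univ]; exact measure_ball_lt_top⟩

/-! ### Linearity of the weak gradient -/

theorem IsTestFunction.continuous_partialDeriv {φ : E3 → ℂ} (hφ : IsTestFunction φ) (i : Fin 3) :
    Continuous (partialDeriv i φ) := by
  have h := hφ.1.continuous_fderiv (by simp)
  unfold partialDeriv
  fun_prop

theorem IsTestFunction.exists_bound_partialDeriv {φ : E3 → ℂ} (hφ : IsTestFunction φ) (i : Fin 3) :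
    ∃ C, ∀ x, ‖partialDeriv i φ x‖ ≤ C := by
  refine HasCompactSupport.exists_bound_of_continuous ?_ (hφ.continuous_partialDeriv i)
  exact (hφ.2.1.fderiv (𝕜 := ℝ)).comp_left
    (g := fun L : E3 →L[ℝ] ℂ => L (EuclideanSpace.single i 1)) (by simp)

theorem integrable_mul_of_bounded {u h : E3 → ℂ} (hu : MemLp u 2 muB) (hh : Continuous h)
    (hb : ∃ C, ∀ x, ‖h x‖ ≤ C) : Integrable (fun x => u x * h x) muB := by
  obtain ⟨C, hC⟩ := hb
  exact (hu.integrable (by norm_num)).mul_bdd (c := C) hh.aestronglyMeasurable (ae_of_all _ hC)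

theorem memLp_component {g : E3 → EuclideanSpace ℂ (Fin 3)} (hg : MemLp g 2 muB) (i : Fin 3) :
    MemLp (fun x => g x i) 2 muB :=
  (EuclideanSpace.proj (𝕜 := ℂ) i).comp_memLp' hg

theorem IsWeakGradient.add {u v : E3 → ℂ} {g h : E3 → EuclideanSpace ℂ (Fin 3)}
    (hu : MemLp u 2 muB) (hv : MemLp v 2 muB) (hg : IsWeakGradient u g) (hh : IsWeakGradient v h) :
    IsWeakGradient (u + v) (g + h) := by
  refine ⟨hg.1.add hh.1, fun φ hφ i => ?_⟩
  have hb := hφ.2.1.exists_bound_of_continuous hφ.1.continuous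
  have e1 := integral_add (integrable_mul_of_bounded hu (hφ.continuous_partialDeriv i)
    (hφ.exists_bound_partialDeriv i)) (integrable_mul_of_bounded hv (hφ.continuous_partialDeriv i)
    (hφ.exists_bound_partialDeriv i))
  have e2 := integral_add (integrable_mul_of_bounded (memLp_component hg.1 i) hφ.1.continuous hb)
    (integrable_mul_of_bounded (memLp_component hh.1 i) hφ.1.continuous hb)
  simp only [Pi.add_apply, PiLp.add_apply, add_mul]
  rw [e1, e2, hg.2 φ hφ i, hh.2 φ hφ i, neg_add]

theorem IsWeakGradient.smul {u : E3 → ℂ} {g : E3 → EuclideanSpace ℂ (Fin 3)} (c : ℂ)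
    (hg : IsWeakGradient u g) : IsWeakGradient (c • u) (c • g) := by
  refine ⟨hg.1.const_smul c, fun φ hφ i => ?_⟩
  simp only [Pi.smul_apply, PiLp.smul_apply, smul_eq_mul, mul_assoc]
  rw [integral_const_mul, integral_const_mul, hg.2 φ hφ i, mul_neg]

/-- `H¹(B₁)` as a subspace of the functions on `ℝ³`. -/
def h1Space : Submodule ℂ (E3 → ℂ) where
  carrier := {u | MemH1 u}
  add_mem' := by
    rintro u v ⟨hu, g, hg⟩ ⟨hv, h, hh⟩
    exact ⟨hu.add hv, g + h, hg.add hu hv hh⟩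
  zero_mem' := by
    refine ⟨MemLp.zero, 0, MemLp.zero, fun φ _ i => ?_⟩
    simp
  smul_mem' := by
    rintro c u ⟨hu, g, hg⟩
    exact ⟨hu.const_smul c, c • g, hg.smul c⟩

theorem isWeakGradient_weakGradient {u : E3 → ℂ} (hu : MemH1 u) :
    IsWeakGradient u (weakGradient u) := by
  have hex : ∃ g, IsWeakGradient u g := hu.2
  simp only [weakGradient, hex, dif_pos]
  exact hex.choose_spec

theorem synthesis_eq_sum {N : ℕ} (Φ : Fin N → E3 → ℂ) (c : Fin N → ℂ) :
    synthesis Φ c = ∑ p, c p • Φ p := by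
  ext x
  simp [synthesis]

theorem bNorm_nonneg (κ : ℝ) (u : E3 → ℂ) : 0 ≤ bNorm κ u := Real.sqrt_nonneg _

theorem l2On_le_bNorm (κ : ℝ) (u : E3 → ℂ) : l2On muB u ≤ bNorm κ u := by
  refine Real.sqrt_le_sqrt (le_add_of_nonneg_right (mul_nonneg (by positivity) ?_))
  exact integral_nonneg fun _ => by positivity

theorem l2On_weakGradient_le_bNorm {κ : ℝ} (hκ : 0 < κ) (u : E3 → ℂ) :
    l2On muB (weakGradient u) ≤ κ * bNorm κ u := by
  rw [l2On, bNorm, ← Real.sqrt_sq hκ.le, ← Real.sqrt_mul (sq_nonneg _), Real.sqrt_sq hκ.le]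
  refine Real.sqrt_le_sqrt ?_
  rw [mul_add, ← mul_assoc, mul_inv_cancel₀ (by positivity), one_mul]
  refine le_add_of_nonneg_left (mul_nonneg (by positivity) ?_)
  exact integral_nonneg fun _ => by positivity

/-! ### The trace inequality -/

/-- The radial field `ψ(|x|) |x|⁻³ f(x/|x|) x` without the factor `x`. -/
def radialField (ψ : ℝ → ℝ) (f : E3 → ℂ) (x : E3) : ℂ :=
  ((ψ ‖x‖ * (‖x‖ ^ 3)⁻¹ : ℝ) : ℂ) * f (‖x‖⁻¹ • x)

variable {ψ : ℝ → ℝ} {f : E3 → ℂ}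

/-- The singularities of `‖x‖` and `x/‖x‖` sit at the origin only, and `ψ` kills a neighbourhood of
it. -/
theorem contDiff_radialField (hψ : ContDiff ℝ ∞ ψ) (hf : ContDiff ℝ ∞ f)
    (h0 : ∀ r ≤ 1 / 4, ψ r = 0) : ContDiff ℝ ∞ (radialField ψ f) := by
  rw [contDiff_iff_contDiffAt]
  intro x
  rcases eq_or_ne x 0 with rfl | hx
  · have : radialField ψ f =ᶠ[𝓝 0] fun _ => 0 := by
      filter_upwards [Metric.ball_mem_nhds (0 : E3) (by norm_num : (0 : ℝ) < 1 / 4)] with y hy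
      have hy' : ‖y‖ ≤ 1 / 4 := by simpa using (mem_ball_zero_iff.1 hy).le
      simp [radialField, h0 _ hy']
    exact contDiffAt_const.congr_of_eventuallyEq this
  · have hn : ContDiffAt ℝ ∞ (fun y : E3 => ‖y‖) x := contDiffAt_norm ℝ hx
    have hx' : ‖x‖ ≠ 0 := norm_ne_zero_iff.2 hx
    refine ContDiffAt.mul ?_ ?_
    · exact Complex.ofRealCLM.contDiff.contDiffAt.comp x
        ((hψ.contDiffAt.comp x hn).mul ((hn.pow 3).inv (pow_ne_zero 3 hx')))
    · exact hf.contDiffAt.comp x ((hn.inv hx').smul contDiffAt_id)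

/-- The left side is the divergence of `x Q` for `Q = radialField ψ f`. Since `|x|⁻³ x`, multiplied
by any function of `x/|x|`, is divergence free away from the origin, only the derivative of `ψ`
remains. It is computed by differentiating `t ↦ Q(t x)` at `t = 1`, where the angular factor is
constant. -/
theorem fderiv_radialField_self (hψ : ContDiff ℝ ∞ ψ) (hf : ContDiff ℝ ∞ f)
    (h0 : ∀ r ≤ 1 / 4, ψ r = 0) {x : E3} (hx : x ≠ 0) :
    3 * radialField ψ f x + fderiv ℝ (radialField ψ f) x x =
      ((deriv ψ ‖x‖ * (‖x‖ ^ 2)⁻¹ : ℝ) : ℂ) * f (‖x‖⁻¹ • x) := by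
  have hx' : ‖x‖ ≠ 0 := norm_ne_zero_iff.2 hx
  have h1 : HasDerivAt (fun t : ℝ => radialField ψ f (t • x))
      (fderiv ℝ (radialField ψ f) x x) 1 := by
    have hd : HasFDerivAt (radialField ψ f) (fderiv ℝ (radialField ψ f) x) ((1 : ℝ) • x) := by
      rw [one_smul]
      exact ((contDiff_radialField hψ hf h0).differentiable (by simp) x).hasFDerivAt
    have hl : HasDerivAt (fun t : ℝ => t • x) x 1 := by
      simpa using (hasDerivAt_id (1 : ℝ)).smul_const x
    exact hd.comp_hasDerivAt 1 hl
  have h2 : HasDerivAt (fun t : ℝ => ((ψ (t * ‖x‖) * ((t * ‖x‖) ^ 3)⁻¹ : ℝ) : ℂ) *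
      f (‖x‖⁻¹ • x))
      (((deriv ψ ‖x‖ * ‖x‖ * (‖x‖ ^ 3)⁻¹ + ψ ‖x‖ * (-(3 * ‖x‖ ^ 2 * ‖x‖) / (‖x‖ ^ 3) ^ 2) : ℝ) : ℂ)
        * f (‖x‖⁻¹ • x)) 1 := by
    refine HasDerivAt.mul_const ?_ _
    refine HasDerivAt.ofReal_comp ?_
    have hm : HasDerivAt (fun t : ℝ => t * ‖x‖) ‖x‖ 1 := by
      simpa using (hasDerivAt_id (1 : ℝ)).mul_const ‖x‖
    have ha : HasDerivAt (fun t : ℝ => ψ (t * ‖x‖)) (deriv ψ ‖x‖ * ‖x‖) 1 := by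
      have hp : HasDerivAt ψ (deriv ψ ‖x‖) (1 * ‖x‖) := by
        rw [one_mul]; exact (hψ.differentiable (by simp) _).hasDerivAt
      exact hp.comp 1 hm
    have hb := (hm.pow 3).inv (by simpa using hx')
    have hc := ha.mul hb
    refine hc.congr_deriv ?_
    simp
  have h3 : (fun t : ℝ => radialField ψ f (t • x)) =ᶠ[𝓝 1]
      fun t : ℝ => ((ψ (t * ‖x‖) * ((t * ‖x‖) ^ 3)⁻¹ : ℝ) : ℂ) * f (‖x‖⁻¹ • x) := by
    filter_upwards [lt_mem_nhds (zero_lt_one : (0 : ℝ) < 1)] with t ht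
    simp only [radialField, norm_smul, Real.norm_of_nonneg (le_of_lt ht)]
    congr 2
    rw [smul_smul]
    congr 1
    field_simp
  rw [h1.unique (h2.congr_of_eventuallyEq h3), radialField]
  push_cast
  have hx3 : (‖x‖ : ℂ) ≠ 0 := by exact_mod_cast hx'
  field_simp
  ring

/-- The components of the radial field are admissible in the weak gradient identity because `ψ` also
vanishes near the sphere. -/
theorem isTestFunction_coord_mul_radialField {ψ : ℝ → ℝ} {f : E3 → ℂ} (hψ : ContDiff ℝ ∞ ψ)
    (hf : ContDiff ℝ ∞ f) (h0 : ∀ r ≤ 1 / 4, ψ r = 0) {b : ℝ} (hb : b < 1)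
    (h1 : ∀ r, b ≤ r → ψ r = 0) (i : Fin 3) :
    IsTestFunction (fun x : E3 => (x i : ℂ) * radialField ψ f x) := by
  have hts : tsupport (fun x : E3 => (x i : ℂ) * radialField ψ f x) ⊆ Metric.closedBall 0 b := by
    refine closure_minimal (fun x hx => ?_) Metric.isClosed_closedBall
    by_contra hxb
    have : b ≤ ‖x‖ := by simpa using (not_le.1 (by simpa using hxb)).le
    exact hx (by simp [radialField, h1 _ this])
  refine ⟨?_, (isCompact_closedBall 0 b).of_isClosed_subset (isClosed_tsupport _) hts,
    hts.trans (Metric.closedBall_subset_ball hb)⟩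
  refine ContDiff.mul ?_ (contDiff_radialField hψ hf h0)
  exact Complex.ofRealCLM.contDiff.comp (EuclideanSpace.proj (𝕜 := ℝ) i).contDiff

theorem sum_partialDeriv_coord_mul {Q : E3 → ℂ} {x : E3} (hQ : DifferentiableAt ℝ Q x) :
    ∑ i : Fin 3, partialDeriv i (fun y : E3 => (y i : ℂ) * Q y) x
      = 3 * Q x + fderiv ℝ Q x x := by
  have h : ∀ i : Fin 3, partialDeriv i (fun y : E3 => (y i : ℂ) * Q y) x =
      Q x + (x i : ℂ) * fderiv ℝ Q x (EuclideanSpace.single i 1) := by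
    intro i
    have hc : HasFDerivAt (fun y : E3 => (y i : ℂ))
        (Complex.ofRealCLM.comp (EuclideanSpace.proj (𝕜 := ℝ) i)) x :=
      (Complex.ofRealCLM.comp (EuclideanSpace.proj (𝕜 := ℝ) i)).hasFDerivAt
    rw [partialDeriv, (show HasFDerivAt (fun y : E3 => (y i : ℂ) * Q y) _ x from
      hc.mul hQ.hasFDerivAt).fderiv]
    simp
    ring
  have hx : fderiv ℝ Q x x = ∑ i : Fin 3, (x i : ℂ) *
      fderiv ℝ Q x (EuclideanSpace.single i 1) := by
    have hx' : x = ∑ i : Fin 3, x i • EuclideanSpace.single i (1 : ℝ) := by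
      ext j
      fin_cases j <;> simp [Fin.sum_univ_three]
    conv_lhs => arg 2; rw [hx']
    rw [map_sum]
    exact Finset.sum_congr rfl fun i _ => by rw [map_smul, Complex.real_smul]
  simp only [h, hx, Fin.sum_univ_three]
  ring

theorem memLp_radial {f : E3 → ℂ} (hf : Continuous f) :
    MemLp (fun x : E3 => f (‖x‖⁻¹ • x)) 2 muB := by
  obtain ⟨C, hC⟩ := (isCompact_closedBall (0 : E3) 1).exists_bound_of_continuousOn hf.continuousOn
  refine MemLp.of_bound (hf.measurable.comp (by fun_prop)).aestronglyMeasurable C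
    (ae_of_all _ fun x => hC _ ?_)
  rw [mem_closedBall_zero_iff, norm_smul, norm_inv, norm_norm]
  exact inv_mul_le_one

theorem l2On_radial_le {f : E3 → ℂ} (hf : Continuous f) :
    l2On muB (fun x : E3 => f (‖x‖⁻¹ • x)) ≤ l2On sphMeasure (fun y : S2 => f y) := by
  refine Real.sqrt_le_sqrt ?_
  have h := sphere_integral_eq (f := fun x => ‖f x‖ ^ 2) (by fun_prop)
    (by exact (by fun_prop : Continuous fun x => ‖f x‖ ^ 2).stronglyMeasurable)
  rw [h, smul_eq_mul]
  have : 0 ≤ ∫ x in B1, ‖f (‖x‖⁻¹ • x)‖ ^ 2 := integral_nonneg fun _ => by positivity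
  linarith

/-- Only `r > 1/4` matters, and there `r⁻² ≤ 16`; this is the origin of every `16` in the trace
estimates. -/
theorem abs_mul_inv_sq_le {k : ℝ → ℝ} {K : ℝ} (hK : ∀ r, |k r| ≤ K) (h0 : ∀ r ≤ 1 / 4, k r = 0)
    (r : ℝ) : |k r * (r ^ 2)⁻¹| ≤ 16 * K := by
  have hK0 : 0 ≤ K := (abs_nonneg _).trans (hK 0)
  rcases le_or_gt r (1 / 4) with h | h
  · rw [h0 r h]; simpa
  · have h1 : (r ^ 2)⁻¹ ≤ 16 := by
      rw [inv_le_comm₀ (by positivity) (by norm_num)]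
      nlinarith
    rw [abs_mul, abs_of_nonneg (a := (r ^ 2)⁻¹) (by positivity), mul_comm]
    exact mul_le_mul h1 (hK r) (abs_nonneg _) (by norm_num)

section Trace

variable {w f : E3 → ℂ} {g : E3 → EuclideanSpace ℂ (Fin 3)}

/-- The moment of `w` against `f` on the sphere of radius `r`. -/
def sphMoment (w f : E3 → ℂ) (r : ℝ) : ℂ := ∫ y : S2, w (r • (y : E3)) * f y ∂sphMeasure

theorem continuous_sphMoment (hw : Continuous w) (hf : Continuous f) :
    Continuous (sphMoment w f) := by
  have h := continuous_parametric_integral_of_continuous (μ := sphMeasure)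
    (f := fun (r : ℝ) (y : S2) => w (r • (y : E3)) * f y)
    (by simp only [Function.uncurry_def]; fun_prop) (isCompact_univ : IsCompact (Set.univ : Set S2))
  simp only [Measure.restrict_univ] at h
  exact h

/-- The weight `|x|⁻²` cancels the Jacobian `r²` of polar coordinates, leaving a one-dimensional
integral of the moment. -/
theorem integral_radial_eq (hw : Continuous w) (hf : Continuous f) {k : ℝ → ℝ}
    (hk : Continuous k) {K : ℝ} (hK : ∀ r, |k r| ≤ K) (h0 : ∀ r ≤ 1 / 4, k r = 0) :
    ∫ x in B1, w x * (((k ‖x‖ * (‖x‖ ^ 2)⁻¹ : ℝ) : ℂ) * f (‖x‖⁻¹ • x)) =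
      ∫ r in (0 : ℝ)..1, k r • sphMoment w f r := by
  have hmeas : Measurable (fun x : E3 => ((k ‖x‖ * (‖x‖ ^ 2)⁻¹ : ℝ) : ℂ)) := by
    have := hk.measurable
    fun_prop
  have hint : IntegrableOn
      (fun x => w x * (((k ‖x‖ * (‖x‖ ^ 2)⁻¹ : ℝ) : ℂ) * f (‖x‖⁻¹ • x))) B1 := by
    obtain ⟨C, hC⟩ := (isCompact_closedBall (0 : E3) 1).exists_bound_of_continuousOn hw.continuousOn
    refine Integrable.bdd_mul (c := C) ?_ hw.aestronglyMeasurable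
      ((ae_restrict_mem Metric.isOpen_ball.measurableSet).mono fun x hx =>
        hC x (Metric.ball_subset_closedBall hx))
    refine Integrable.bdd_mul (c := 16 * K) ((memLp_radial hf).integrable (by norm_num))
      hmeas.aestronglyMeasurable (ae_of_all _ fun x => ?_)
    rw [Complex.norm_real]
    exact abs_mul_inv_sq_le hK h0 _
  rw [setIntegral_ball_polar zero_le_one hint]
  refine intervalIntegral.integral_congr_ae (ae_of_all _ fun r hr => ?_)
  rw [Set.uIoc_of_le zero_le_one] at hr
  have hr0 : r ≠ 0 := hr.1.ne'
  rw [sphMoment, ← integral_smul, ← integral_smul]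
  refine integral_congr_ae (ae_of_all _ fun y => ?_)
  have h2 : ‖r • (y : E3)‖ = r := by simp [norm_smul, abs_of_pos hr.1]
  have h3 : (r : ℂ) ≠ 0 := by exact_mod_cast hr0
  simp only [h2, smul_smul, inv_mul_cancel₀ hr0, one_smul, Complex.real_smul]
  push_cast
  field_simp

theorem norm_integral_smul_sphMoment_le (hw : Continuous w) (hw2 : MemLp w 2 muB)
    (hf : Continuous f) {k : ℝ → ℝ}
    (hk : Continuous k) {K : ℝ} (hK : ∀ r, |k r| ≤ K) (h0 : ∀ r ≤ 1 / 4, k r = 0) :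
    ‖∫ r in (0 : ℝ)..1, k r • sphMoment w f r‖ ≤
      16 * K * (l2On muB w * l2On sphMeasure (fun y : S2 => f y)) := by
  have hK0 : 0 ≤ K := (abs_nonneg _).trans (hK 0)
  rw [← integral_radial_eq hw hf hk hK h0]
  refine (norm_integral_le_of_le_mul (C := 16 * K) hw2 (memLp_radial hf) (by positivity)
    fun x => ?_).trans ?_
  · rw [norm_mul, norm_mul, Complex.norm_real, Real.norm_eq_abs, mul_left_comm]
    exact mul_le_mul_of_nonneg_right (abs_mul_inv_sq_le hK h0 _) (by positivity)
  · gcongr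
    · exact l2On_nonneg _
    · exact l2On_radial_le hf

/-- Moving the divergence of the radial field onto `w` trades `ψ'` for `ψ`, so the bound does not
see how steep `ψ` is. This is what allows cutoffs arbitrarily close to the sphere. -/
theorem norm_integral_deriv_smul_sphMoment_le (hw : Continuous w) (hw2 : MemLp w 2 muB)
    (hg : IsWeakGradient w g) (hf : ContDiff ℝ ∞ f) {ψ : ℝ → ℝ} (hψ : ContDiff ℝ ∞ ψ)
    (hψ1 : ∀ r, |ψ r| ≤ 1) (h0 : ∀ r ≤ 1 / 4, ψ r = 0) {b : ℝ} (hb : b < 1)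
    (h1 : ∀ r, b ≤ r → ψ r = 0) :
    ‖∫ r in (0 : ℝ)..1, deriv ψ r • sphMoment w f r‖ ≤
      16 * (l2On muB g * l2On sphMeasure (fun y : S2 => f y)) := by
  have hd : Continuous (deriv ψ) := hψ.continuous_deriv (by simp)
  have hd0 : ∀ r ≤ 1 / 4, deriv ψ r = 0 := by
    intro r hr
    have hmin : ∀ᶠ s in 𝓝[<] r, ψ s = 0 := by
      filter_upwards [self_mem_nhdsWithin] with s hs
      exact h0 s ((le_of_lt hs).trans hr)
    have h2 : HasDerivWithinAt ψ (deriv ψ r) (Set.Iio r) r :=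
      (hψ.differentiable (by simp) r).hasDerivAt.hasDerivWithinAt
    have h3 : HasDerivWithinAt ψ 0 (Set.Iio r) r :=
      (hasDerivWithinAt_const r _ (0 : ℝ)).congr_of_eventuallyEq hmin (h0 r hr)
    exact (uniqueDiffWithinAt_Iio r).eq_deriv _ h2 h3
  have hcs : HasCompactSupport ψ := by
    refine HasCompactSupport.intro (isCompact_Icc (a := 1 / 4) (b := b)) fun r hr => ?_
    simp only [Set.mem_Icc, not_and_or, not_le] at hr
    exact hr.elim (fun h => h0 r h.le) fun h => h1 r h.le
  obtain ⟨K, hK⟩ := hcs.deriv.exists_bound_of_continuous hd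
  rw [← integral_radial_eq hw hf.continuous hd hK hd0]
  set Q := radialField ψ f with hQ
  have htest := isTestFunction_coord_mul_radialField hψ hf h0 hb h1
  have hmain : ∫ x in B1, w x * (((deriv ψ ‖x‖ * (‖x‖ ^ 2)⁻¹ : ℝ) : ℂ) * f (‖x‖⁻¹ • x)) =
      - ∫ x in B1, ∑ i, g x i * ((x i : ℂ) * Q x) := by
    have e1 : ∫ x in B1, w x * (((deriv ψ ‖x‖ * (‖x‖ ^ 2)⁻¹ : ℝ) : ℂ) * f (‖x‖⁻¹ • x)) =
        ∫ x in B1, ∑ i, w x * partialDeriv i (fun y : E3 => (y i : ℂ) * Q y) x := by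
      refine integral_congr_ae (ae_restrict_of_ae ?_)
      have hne : ∀ᵐ x : E3, x ≠ 0 := by
        simp [ae_iff]
      filter_upwards [hne] with x hx
      rw [← Finset.mul_sum, sum_partialDeriv_coord_mul
        ((contDiff_radialField hψ hf h0).differentiable (by simp) x),
        fderiv_radialField_self hψ hf h0 hx]
    rw [e1, integral_finsetSum _ fun i _ => integrable_mul_of_bounded hw2
      ((htest i).continuous_partialDeriv i) ((htest i).exists_bound_partialDeriv i),
      integral_finsetSum _ fun i _ => integrable_mul_of_bounded (memLp_component hg.1 i)
        (htest i).1.continuous ((htest i).2.1.exists_bound_of_continuous (htest i).1.continuous),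
      ← Finset.sum_neg_distrib]
    exact Finset.sum_congr rfl fun i _ => hg.2 _ (htest i) i
  rw [hmain, norm_neg]
  refine (norm_integral_le_of_le_mul (C := 16) hg.1 (memLp_radial hf.continuous) (by norm_num)
    fun x => ?_).trans ?_
  · have e2 : ∑ i, g x i * ((x i : ℂ) * Q x) =
        (∑ i, g x i * (x i : ℂ)) * Q x := by
      rw [Finset.sum_mul]; exact Finset.sum_congr rfl fun i _ => by ring
    have e3 : ‖∑ i, g x i * (x i : ℂ)‖ ≤ ‖g x‖ * ‖x‖ := by
      refine (norm_sum_le _ _).trans ?_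
      simp only [norm_mul, Complex.norm_real]
      rw [EuclideanSpace.norm_eq, EuclideanSpace.norm_eq]
      exact Real.sum_mul_le_sqrt_mul_sqrt _ _ _
    rw [e2, norm_mul]
    refine (mul_le_mul_of_nonneg_right e3 (norm_nonneg _)).trans ?_
    have e4 : ‖x‖ * ‖Q x‖ ≤ 16 * ‖f (‖x‖⁻¹ • x)‖ := by
      rw [hQ, radialField, norm_mul, Complex.norm_real, ← mul_assoc, Real.norm_eq_abs]
      refine mul_le_mul_of_nonneg_right ?_ (norm_nonneg _)
      refine le_trans (le_of_eq ?_) ((abs_mul_inv_sq_le hψ1 h0 ‖x‖).trans_eq (mul_one 16))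
      rcases eq_or_ne x 0 with rfl | hx
      · simp
      · have hx' : ‖x‖ ≠ 0 := norm_ne_zero_iff.2 hx
        conv_lhs => rw [← abs_norm x, ← abs_mul]
        simp only [abs_norm]
        congr 1
        field_simp
    calc ‖g x‖ * ‖x‖ * ‖Q x‖ = ‖g x‖ * (‖x‖ * ‖Q x‖) := by ring
      _ ≤ ‖g x‖ * (16 * ‖f (‖x‖⁻¹ • x)‖) := by gcongr
      _ = _ := by ring
  · gcongr
    · exact l2On_nonneg _
    · exact l2On_radial_le hf.continuous

end Trace

/-! ### Smooth cutoffs and the trace on the unit sphere -/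

theorem deriv_smoothTransition_eq_zero {t : ℝ} (ht : t ≤ 0 ∨ 1 ≤ t) :
    deriv Real.smoothTransition t = 0 := by
  rcases ht with h | h
  · refine IsLocalMin.deriv_eq_zero (Eventually.of_forall fun s => ?_)
    rw [Real.smoothTransition.zero_of_nonpos h]
    exact Real.smoothTransition.nonneg s
  · refine IsLocalMax.deriv_eq_zero (Eventually.of_forall fun s => ?_)
    rw [Real.smoothTransition.one_of_one_le h]
    exact Real.smoothTransition.le_one s

theorem continuous_deriv_smoothTransition : Continuous (deriv Real.smoothTransition) :=
  (Real.smoothTransition.contDiff (n := ⊤)).continuous_deriv (by simp)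

theorem exists_bound_deriv_smoothTransition :
    ∃ D, ∀ t, |deriv Real.smoothTransition t| ≤ D := by
  refine HasCompactSupport.exists_bound_of_continuous ?_ continuous_deriv_smoothTransition
  refine HasCompactSupport.intro (isCompact_Icc (a := 0) (b := 1)) fun t ht => ?_
  simp only [Set.mem_Icc, not_and_or, not_le] at ht
  exact deriv_smoothTransition_eq_zero (ht.imp le_of_lt le_of_lt)

theorem hasDerivAt_smoothTransition_affine (a b r : ℝ) :
    HasDerivAt (fun s => Real.smoothTransition (a * s + b))
      (a * deriv Real.smoothTransition (a * r + b)) r := by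
  have h1 : HasDerivAt (fun s : ℝ => a * s + b) a r := by
    simpa using ((hasDerivAt_id r).const_mul a).add_const b
  have h2 : HasDerivAt Real.smoothTransition (deriv Real.smoothTransition (a * r + b))
      (a * r + b) :=
    ((Real.smoothTransition.contDiff (n := ⊤)).differentiable (by simp) _).hasDerivAt
  exact (h2.comp r h1).congr_deriv (mul_comm _ _)

/-- A fundamental theorem of calculus for the moment `h`, in weak form. With `ψ = A B`, where `A`
rises away from the origin and `B` falls just before `r = 1`, the integral of `B' h` approximates
`-h(1)`, while `ψ' h` is controlled by the gradient and `A' h` by the function itself. -/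
theorem sphMoment_one_bound : ∃ C, 0 ≤ C ∧ ∀ (w f : E3 → ℂ) (g : E3 → EuclideanSpace ℂ (Fin 3)),
    Continuous w → MemLp w 2 muB → IsWeakGradient w g → ContDiff ℝ ∞ f →
    ‖sphMoment w f 1‖ ≤ C * (l2On muB w + l2On muB g) * l2On sphMeasure (fun y : S2 => f y) := by
  obtain ⟨D, hD⟩ := exists_bound_deriv_smoothTransition
  have hD0 : 0 ≤ D := (abs_nonneg _).trans (hD 0)
  refine ⟨16 + 16 * (4 * D), by positivity, fun w f g hw hw2 hg hf => ?_⟩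
  have hh := continuous_sphMoment hw hf.continuous
  set h := sphMoment w f with hh_def
  set W := l2On muB w
  set G := l2On muB g
  set Fn := l2On sphMeasure (fun y : S2 => f y)
  have hW : 0 ≤ W := l2On_nonneg _
  have hG : 0 ≤ G := l2On_nonneg _
  have hF : 0 ≤ Fn := l2On_nonneg _
  suffices ∀ ε > 0, ‖h 1‖ ≤ 16 * (G * Fn) + 16 * (4 * D) * (W * Fn) + ε by
    refine (le_of_forall_pos_le_add this).trans ?_
    have : 0 ≤ 16 * (W * Fn) := by positivity
    have : 0 ≤ 16 * (4 * D) * (G * Fn) := by positivity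
    nlinarith
  intro ε hε
  obtain ⟨d, hd, hdh⟩ := Metric.continuous_iff.1 hh 1 ε hε
  -- `B` drops from `1` to `0` on `[1 - 2/n, 1 - 1/n]` and `A` rises on `[1/4, 1/2]`. The bound `n >
  -- 4` keeps these intervals apart, so that `(A B)' = A' + B'`; `n > 2/d` places the drop within
  -- `d` of `1`.
  obtain ⟨n, hn⟩ := exists_nat_gt (max 4 (2 / d))
  have hn4 : (4 : ℝ) < n := (le_max_left _ _).trans_lt hn
  have hnd : 2 / d < n := (le_max_right _ _).trans_lt hn
  let σ := Real.smoothTransition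
  let A : ℝ → ℝ := fun r => σ (4 * r + -1)
  let B : ℝ → ℝ := fun r => σ (-n * r + (n - 1))
  let A' : ℝ → ℝ := fun r => 4 * deriv σ (4 * r + -1)
  let B' : ℝ → ℝ := fun r => -n * deriv σ (-n * r + (n - 1))
  have hA : ∀ r, HasDerivAt A (A' r) r := fun r => hasDerivAt_smoothTransition_affine _ _ r
  have hB : ∀ r, HasDerivAt B (B' r) r := fun r => hasDerivAt_smoothTransition_affine _ _ r
  have hA'c : Continuous A' := continuous_const.mul
    (continuous_deriv_smoothTransition.comp (by fun_prop))
  have hB'c : Continuous B' := continuous_const.mul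
    (continuous_deriv_smoothTransition.comp (by fun_prop))
  let ψ : ℝ → ℝ := fun r => A r * B r
  have hψ : ContDiff ℝ ∞ ψ := ContDiff.mul
    (Real.smoothTransition.contDiff.comp (by fun_prop))
    (Real.smoothTransition.contDiff.comp (by fun_prop))
  have hψ' : ∀ r, deriv ψ r = A' r + B' r := by
    intro r
    rw [(show HasDerivAt ψ _ r from (hA r).mul (hB r)).deriv]
    rcases le_total r (1 / 2) with hr | hr
    · have h1 : 1 ≤ -n * r + (n - 1 : ℝ) := by nlinarith
      have hB1 : B r = 1 := Real.smoothTransition.one_of_one_le h1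
      have hB0 : B' r = 0 := by
        simp only [B', σ, deriv_smoothTransition_eq_zero (Or.inr h1), mul_zero]
      rw [hB1, hB0]; ring
    · have h1 : 1 ≤ 4 * r + -1 := by linarith
      have hA1 : A r = 1 := Real.smoothTransition.one_of_one_le h1
      have hA0 : A' r = 0 := by
        simp only [A', σ, deriv_smoothTransition_eq_zero (Or.inr h1), mul_zero]
      rw [hA1, hA0]; ring
  have b1 : ‖∫ r in (0 : ℝ)..1, deriv ψ r • h r‖ ≤ 16 * (G * Fn) := by
    refine norm_integral_deriv_smul_sphMoment_le hw hw2 hg hf hψ (fun r => ?_) (fun r hr => ?_)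
      (b := 1 - 1 / n) (sub_lt_self _ (one_div_pos.2 (by linarith))) (fun r hr => ?_)
    · rw [abs_mul, abs_of_nonneg (Real.smoothTransition.nonneg _),
        abs_of_nonneg (Real.smoothTransition.nonneg _)]
      exact mul_le_one₀ (Real.smoothTransition.le_one _) (Real.smoothTransition.nonneg _)
        (Real.smoothTransition.le_one _)
    · have : A r = 0 := Real.smoothTransition.zero_of_nonpos (by linarith)
      simp only [ψ, this, zero_mul]
    · have : B r = 0 := by
        refine Real.smoothTransition.zero_of_nonpos ?_
        have : (n : ℝ) * (1 - 1 / n) ≤ n * r := by gcongr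
        rw [mul_sub, mul_one_div_cancel (by positivity)] at this
        linarith
      simp only [ψ, this, mul_zero]
  have b2 : ‖∫ r in (0 : ℝ)..1, A' r • h r‖ ≤ 16 * (4 * D) * (W * Fn) := by
    refine norm_integral_smul_sphMoment_le hw hw2 hf.continuous hA'c (fun r => ?_) (fun r hr => ?_)
    · simp only [A', abs_mul]
      rw [abs_of_nonneg (by norm_num : (0 : ℝ) ≤ 4)]
      exact mul_le_mul_of_nonneg_left (hD _) (by norm_num)
    · simp only [A', σ]
      rw [deriv_smoothTransition_eq_zero (Or.inl (by linarith)), mul_zero]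
  have hB'int : ∫ r in (0 : ℝ)..1, B' r = -1 := by
    rw [intervalIntegral.integral_eq_sub_of_hasDerivAt (fun r _ => hB r)
      (hB'c.intervalIntegrable _ _)]
    have e1 : B 1 = 0 := Real.smoothTransition.zero_of_nonpos (by simp)
    have e0 : B 0 = 1 := Real.smoothTransition.one_of_one_le (by linarith)
    rw [e1, e0]; norm_num
  have b3 : ‖∫ r in (0 : ℝ)..1, B' r • (h r - h 1)‖ ≤ ε := by
    have hle : ∀ r ∈ Set.Ioc (0 : ℝ) 1, ‖B' r • (h r - h 1)‖ ≤ ε * -B' r := by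
      intro r hr
      have hpos : 0 ≤ deriv σ (-n * r + (n - 1)) := Real.smoothTransition.monotone.deriv_nonneg
      have hB'neg : B' r ≤ 0 := by
        simp only [B']
        exact mul_nonpos_of_nonpos_of_nonneg (by linarith) hpos
      rw [norm_smul, Real.norm_eq_abs, abs_of_nonpos hB'neg, mul_comm]
      rcases le_or_gt 1 (-n * r + (n - 1) : ℝ) with h1 | h1
      · have : B' r = 0 := by
          simp only [B', σ]
          rw [deriv_smoothTransition_eq_zero (Or.inr h1), mul_zero]
        rw [this]; simp
      · refine mul_le_mul_of_nonneg_right ?_ (by linarith)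
        rw [← dist_eq_norm]
        refine (hdh r ?_).le
        rw [Real.dist_eq, abs_sub_comm, abs_of_nonneg (by linarith [hr.2])]
        rw [div_lt_iff₀ hd] at hnd
        by_contra! hcon
        nlinarith
    refine (intervalIntegral.norm_integral_le_of_norm_le zero_le_one
      (ae_of_all _ hle) ((hB'c.neg.const_mul ε |>.intervalIntegrable _ _))).trans_eq ?_
    rw [intervalIntegral.integral_const_mul, intervalIntegral.integral_neg, hB'int]
    ring
  have hI : ∀ k : ℝ → ℝ, Continuous k → IntervalIntegrable (fun r => k r • h r) volume 0 1 :=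
    fun k hk => (hk.smul hh).intervalIntegrable _ _
  -- Since `B'` has integral `-1`, subtracting `h 1` inside the first integral contributes exactly
  -- `h 1`.
  have e : h 1 = (∫ r in (0 : ℝ)..1, B' r • (h r - h 1)) + (∫ r in (0 : ℝ)..1, A' r • h r)
      - ∫ r in (0 : ℝ)..1, deriv ψ r • h r := by
    simp only [hψ', add_smul, smul_sub]
    rw [intervalIntegral.integral_add (hI _ hA'c) (hI _ hB'c),
      intervalIntegral.integral_sub (g := fun r => B' r • h 1) (hI _ hB'c)
        ((hB'c.smul continuous_const).intervalIntegrable _ _),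
      intervalIntegral.integral_smul_const, hB'int, neg_one_smul]
    ring
  rw [e]
  refine (norm_sub_le _ _).trans ?_
  refine (add_le_add_left (norm_add_le _ _) _).trans ?_
  linarith

/-- The trace inequality for continuous functions in `H¹(B₁)`. -/
theorem trace_inequality {κ : ℝ} (hκ : 0 < κ) : ∃ C, 0 ≤ C ∧ ∀ u : E3 → ℂ, MemH1 u →
    ContinuousOn u (Metric.closedBall 0 1) →
    l2On sphMeasure (fun y : S2 => u y) ≤ C * bNorm κ u := by
  obtain ⟨C, hC, hbd⟩ := sphMoment_one_bound
  refine ⟨C * (1 + κ), by positivity, fun u hu huc => ?_⟩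
  set w := u ∘ retract with hw_def
  have hw : Continuous w := continuous_comp_retract huc
  have heq : ∀ x ∈ Metric.closedBall (0 : E3) 1, w x = u x := fun x hx => by
    simp [w, retract_of_mem hx]
  have hae : w =ᵐ[muB] u :=
    (ae_restrict_mem Metric.isOpen_ball.measurableSet).mono fun x hx =>
      heq x (Metric.ball_subset_closedBall hx)
  have hw2 : MemLp w 2 muB := (memLp_congr_ae hae).2 hu.1
  have hwg : IsWeakGradient w (weakGradient u) := by
    have h := isWeakGradient_weakGradient hu
    refine ⟨h.1, fun φ hφ i => ?_⟩
    rw [← h.2 φ hφ i]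
    refine integral_congr_ae (hae.mono fun x hx => ?_)
    simp only [hx]
  have hWl : l2On muB w = l2On muB u := by
    unfold l2On
    congr 1
    exact integral_congr_ae (hae.mono fun x hx => by simp only [hx])
  have hSl : l2On sphMeasure (fun y : S2 => u y) = l2On sphMeasure (fun y : S2 => w y) := by
    unfold l2On
    congr 2
    ext y
    simp only [heq y (Metric.sphere_subset_closedBall y.2)]
  rw [hSl]
  set W := l2On sphMeasure (fun y : S2 => w y) with hW
  set T := l2On muB w + l2On muB (weakGradient u) with hT
  have hT0 : 0 ≤ T := add_nonneg (l2On_nonneg _) (l2On_nonneg _)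
  have hW0 : 0 ≤ W := l2On_nonneg _
  have hTb : T ≤ (1 + κ) * bNorm κ u := by
    rw [hT, hWl, add_mul, one_mul]
    exact add_le_add (l2On_le_bNorm κ u) (l2On_weakGradient_le_bNorm hκ u)
  have hwS : Continuous fun y : S2 => w y := by fun_prop
  have hintS : ∀ k : S2 → ℂ, Continuous k → Integrable k sphMeasure := fun k hk =>
    hk.integrable_of_hasCompactSupport (HasCompactSupport.of_compactSpace k)
  have hmemS : ∀ k : S2 → ℂ, Continuous k → MemLp k 2 sphMeasure := fun k hk =>
    hk.memLp_of_hasCompactSupport (HasCompactSupport.of_compactSpace k)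
  set c1 := l2On sphMeasure (fun _ : S2 => (1 : ℂ)) with hc1
  have hc10 : 0 ≤ c1 := l2On_nonneg _
  -- Duality: a smooth `f` uniformly within `ε` of the conjugate of `w` makes the moment at radius
  -- `1` almost equal to `W²`. Letting `ε` tend to zero and cancelling one factor `W` yields the
  -- bound.
  have key : ∀ ε > 0, W ^ 2 ≤ C * T * (W + ε * c1) + ε * (W * c1) := by
    intro ε hε
    obtain ⟨f, hf, hfd, -⟩ := (Complex.continuous_conj.comp hw).exists_contDiff_approx ⊤
      (ε := fun _ => ε) continuous_const (fun _ => hε)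
    have hd : ∀ x, ‖f x - starRingEnd ℂ (w x)‖ ≤ ε := fun x => by
      rw [← dist_eq_norm]; exact (hfd x).le
    have hfS : Continuous fun y : S2 => f y := hf.continuous.comp continuous_subtype_val
    have hdS : Continuous fun y : S2 => f y - starRingEnd ℂ (w y) :=
      hfS.sub (Complex.continuous_conj.comp hwS)
    have h1 : l2On sphMeasure (fun y : S2 => f y) ≤ W + ε * c1 := by
      have e1 : (fun y : S2 => f y) = (fun y : S2 => starRingEnd ℂ (w y)) +
          fun y : S2 => f y - starRingEnd ℂ (w y) := by ext y; simp
      rw [e1]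
      refine (l2On_add_le (hmemS _ (Complex.continuous_conj.comp hwS)) (hmemS _ hdS)).trans ?_
      refine add_le_add (le_of_eq ?_) ?_
      · simp [hW, l2On]
      · have e2 : ε * c1 = l2On sphMeasure ((ε : ℂ) • fun _ : S2 => (1 : ℂ)) := by
          rw [l2On_smul, Complex.norm_real, Real.norm_of_nonneg hε.le]
        rw [e2]
        refine Real.sqrt_le_sqrt (integral_mono
          ((hmemS _ hdS).integrable_norm_pow two_ne_zero)
          ((hmemS _ (continuous_const)).integrable_norm_pow two_ne_zero) fun y => ?_)
        have := hd y
        simp only [Pi.smul_apply, smul_eq_mul, mul_one, Complex.norm_real,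
          Real.norm_of_nonneg hε.le]
        gcongr
    have h2 : ((W ^ 2 : ℝ) : ℂ) = sphMoment w f 1 -
        ∫ y : S2, w y * (f y - starRingEnd ℂ (w y)) ∂sphMeasure := by
      rw [sq_l2On, sphMoment]
      simp only [one_smul]
      rw [← integral_sub (f := fun y : S2 => w y * f y)
        (g := fun y : S2 => w y * (f y - starRingEnd ℂ (w y)))
        (hintS _ (hwS.mul hfS)) (hintS _ (hwS.mul hdS)), ← integral_complex_ofReal]
      refine integral_congr_ae (ae_of_all _ fun y => ?_)
      simp only
      rw [mul_sub, sub_sub_cancel, Complex.mul_conj']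
      push_cast
      rfl
    have h3 : ‖∫ y : S2, w y * (f y - starRingEnd ℂ (w y)) ∂sphMeasure‖ ≤ ε * (W * c1) := by
      refine norm_integral_le_of_le_mul (hmemS _ hwS) (hmemS _ continuous_const) hε.le
        fun y => ?_
      rw [norm_mul, norm_one, mul_one, mul_comm]
      exact mul_le_mul_of_nonneg_right (hd y) (norm_nonneg _)
    have h4 := hbd w f _ hw hw2 hwg hf
    calc W ^ 2 = ‖((W ^ 2 : ℝ) : ℂ)‖ := by
          rw [Complex.norm_real, Real.norm_of_nonneg (by positivity)]
      _ ≤ C * T * l2On sphMeasure (fun y : S2 => f y) + ε * (W * c1) := by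
          rw [h2]; exact (norm_sub_le _ _).trans (add_le_add h4 h3)
      _ ≤ _ := by gcongr
  have hlim : W ^ 2 ≤ C * T * W := by
    have ht : Tendsto (fun ε : ℝ => C * T * (W + ε * c1) + ε * (W * c1)) (𝓝[>] 0)
        (𝓝 (C * T * (W + 0 * c1) + 0 * (W * c1))) :=
      (Continuous.tendsto (by fun_prop) 0).mono_left nhdsWithin_le_nhds
    have := ge_of_tendsto ht (eventually_nhdsWithin_of_forall fun ε hε => key ε hε)
    simpa using this
  have hfin : W ≤ C * T := by
    rcases hW0.eq_or_lt with h | h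
    · rw [← h]; positivity
    · nlinarith
  calc W ≤ C * T := hfin
    _ ≤ C * ((1 + κ) * bNorm κ u) := by gcongr
    _ = _ := by ring

/-! ### Spherical Bessel functions -/

/-- The coefficients of the entire function `besselSeries l`. -/
def besselCoeff (l k : ℕ) : ℝ :=
  (-1) ^ k / ((k.factorial : ℝ) * Real.Gamma (k + l + 3 / 2) * 4 ^ k)

/-- The entire function `G` with `j_l(r) = √π / 2 * (r / 2) ^ l * G(r ^ 2)`. -/
def besselSeries (l : ℕ) (s : ℝ) : ℝ := ∑' k, besselCoeff l k * s ^ k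

theorem gamma_half_pos (l : ℕ) : 0 < Real.Gamma (l + 3 / 2) := Real.Gamma_pos_of_pos (by positivity)

/-- Each step of the Gamma recursion multiplies by at least `l + 3/2`, hence by more than `l + 1`.
-/
theorem gamma_shift_ge (l k : ℕ) :
    Real.Gamma (l + 3 / 2) * ((l : ℝ) + 1) ^ k ≤ Real.Gamma (k + l + 3 / 2) := by
  induction k with
  | zero => simp
  | succ k ih =>
    have h : Real.Gamma ((k + 1 : ℕ) + l + 3 / 2) =
        (k + l + 3 / 2) * Real.Gamma (k + l + 3 / 2) := by
      rw [← Real.Gamma_add_one (by positivity)]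
      congr 1
      push_cast; ring
    rw [h, pow_succ, ← mul_assoc, mul_comm]
    refine mul_le_mul ?_ ih (by have := gamma_half_pos l; positivity) (by positivity)
    have : (0 : ℝ) ≤ k := Nat.cast_nonneg k
    linarith

theorem abs_besselCoeff_le (l k : ℕ) :
    |besselCoeff l k| ≤ (Real.Gamma (l + 3 / 2))⁻¹ * ((4 * ((l : ℝ) + 1))⁻¹ ^ k / k.factorial) := by
  have h0 := gamma_half_pos l
  have h1 := gamma_shift_ge l k
  have h2 : 0 < Real.Gamma (k + l + 3 / 2) := Real.Gamma_pos_of_pos (by positivity)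
  rw [besselCoeff, abs_div, abs_pow, abs_neg, abs_one, one_pow,
    abs_of_pos (by positivity)]
  calc 1 / ((k.factorial : ℝ) * Real.Gamma (k + l + 3 / 2) * 4 ^ k)
      ≤ 1 / ((k.factorial : ℝ) * (Real.Gamma (l + 3 / 2) * ((l : ℝ) + 1) ^ k) * 4 ^ k) := by
        gcongr
    _ = _ := by
        rw [inv_pow, mul_pow]
        field_simp

theorem norm_besselTerm_le (l k : ℕ) (s : ℝ) :
    ‖besselCoeff l k * s ^ k‖ ≤
      (Real.Gamma (l + 3 / 2))⁻¹ * ((|s| / (4 * ((l : ℝ) + 1))) ^ k / k.factorial) := by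
  rw [norm_mul, norm_pow, Real.norm_eq_abs, Real.norm_eq_abs]
  refine (mul_le_mul_of_nonneg_right (abs_besselCoeff_le l k) (by positivity)).trans_eq ?_
  rw [div_pow, inv_pow]
  field_simp

theorem summable_besselTerm (l : ℕ) (s : ℝ) : Summable fun k => besselCoeff l k * s ^ k :=
  Summable.of_norm_bounded ((Real.summable_pow_div_factorial _).mul_left _) fun k =>
    norm_besselTerm_le l k s

theorem besselCoeff_zero (l : ℕ) : besselCoeff l 0 = (Real.Gamma (l + 3 / 2))⁻¹ := by
  simp [besselCoeff]

/-- Coefficient form of `G_l' = -G_{l+1} / 4`. -/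
theorem besselCoeff_succ (l k : ℕ) :
    ((k + 1 : ℕ) : ℝ) * besselCoeff l (k + 1) = -(1 / 4) * besselCoeff (l + 1) k := by
  have h2 : Real.Gamma ((k + 1 : ℕ) + l + 3 / 2) = Real.Gamma (k + (l + 1 : ℕ) + 3 / 2) := by
    congr 1; push_cast; ring
  have h3 : Real.Gamma (k + (l + 1 : ℕ) + 3 / 2) ≠ 0 :=
    (Real.Gamma_pos_of_pos (by positivity)).ne'
  rw [besselCoeff, besselCoeff, h2, Nat.factorial_succ]
  push_cast at h3 ⊢
  have h4 : ((k : ℝ) + 1) ≠ 0 := by positivity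
  field_simp
  ring

theorem besselCoeff_eq_mul (l k : ℕ) :
    besselCoeff l k = (k + l + 3 / 2) * besselCoeff (l + 1) k := by
  have h2 : Real.Gamma (k + (l + 1 : ℕ) + 3 / 2) =
      (k + l + 3 / 2) * Real.Gamma (k + l + 3 / 2) := by
    rw [← Real.Gamma_add_one (by positivity)]
    congr 1
    push_cast; ring
  have h3 : Real.Gamma (k + l + 3 / 2) ≠ 0 := (Real.Gamma_pos_of_pos (by positivity)).ne'
  have h4 : ((k : ℝ) + l + 3 / 2) ≠ 0 := by positivity
  rw [besselCoeff, besselCoeff, h2]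
  field_simp

/-- Comparison of the tail of the series with that of an exponential. The right side tends to zero
as `l` grows with `s` bounded, so for large degree the normalized series is uniformly close to `1`;
this supplies the uniformity in `l`. -/
theorem abs_besselSeries_sub_le (l : ℕ) (s : ℝ) :
    |Real.Gamma (l + 3 / 2) * besselSeries l s - 1| ≤
      Real.exp (|s| / (4 * ((l : ℝ) + 1))) - 1 := by
  have h0 := gamma_half_pos l
  set q := |s| / (4 * ((l : ℝ) + 1)) with hq
  have hs := summable_besselTerm l s
  have hexp : Summable fun k : ℕ => q ^ k / k.factorial := Real.summable_pow_div_factorial q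
  have e1 : Real.Gamma (l + 3 / 2) * besselSeries l s - 1 =
      Real.Gamma (l + 3 / 2) * ∑' k, besselCoeff l (k + 1) * s ^ (k + 1) := by
    rw [besselSeries, hs.tsum_eq_zero_add, besselCoeff_zero]
    field_simp
    ring
  have e2 : Real.exp q - 1 = ∑' k : ℕ, q ^ (k + 1) / (k + 1).factorial := by
    rw [Real.exp_eq_exp_ℝ, NormedSpace.exp_eq_tsum_div]
    beta_reduce
    rw [hexp.tsum_eq_zero_add]
    simp
  rw [e1, e2, abs_mul, abs_of_pos h0]
  have hsum : Summable fun k : ℕ => q ^ (k + 1) / ((k + 1).factorial : ℝ) :=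
    (summable_nat_add_iff 1).2 hexp
  have := tsum_of_norm_bounded (hsum.mul_left (Real.Gamma (l + 3 / 2))⁻¹).hasSum
    fun k => norm_besselTerm_le l (k + 1) s
  rw [tsum_mul_left] at this
  rw [Real.norm_eq_abs] at this
  calc _ ≤ Real.Gamma (l + 3 / 2) * ((Real.Gamma (l + 3 / 2))⁻¹ *
        ∑' k : ℕ, q ^ (k + 1) / ((k + 1).factorial : ℝ)) := by gcongr
    _ = _ := by field_simp

theorem hasDerivAt_besselSeries (l : ℕ) (s : ℝ) :
    HasDerivAt (besselSeries l) (-(1 / 4) * besselSeries (l + 1) s) s := by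
  set R := |s| + 1 with hR
  have hR0 : 0 < R := by positivity
  have hmem : s ∈ Metric.ball (0 : ℝ) R := by simp [hR]
  let u : ℕ → ℝ := fun k => |k * besselCoeff l k| * R ^ (k - 1)
  have hu : Summable u := by
    refine (summable_nat_add_iff 1).1 ?_
    have h1 : (fun k : ℕ => u (k + 1)) = fun k => (1 / 4) * ‖besselCoeff (l + 1) k * R ^ k‖ := by
      ext k
      simp only [u, Nat.add_sub_cancel]
      rw [besselCoeff_succ, abs_mul, norm_mul, norm_pow, Real.norm_eq_abs, Real.norm_eq_abs,
        abs_of_pos hR0, abs_neg, abs_of_pos (by norm_num : (0 : ℝ) < 1 / 4), mul_assoc]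
    rw [h1]
    exact (summable_besselTerm (l + 1) R).norm.mul_left _
  have hd := hasDerivAt_tsum_of_isPreconnected hu (t := Metric.ball (0 : ℝ) R) Metric.isOpen_ball
    (convex_ball _ _).isPreconnected (g := fun k s => besselCoeff l k * s ^ k)
    (g' := fun k s => besselCoeff l k * (k * s ^ (k - 1))) (y₀ := s) (y := s)
    (fun k y _ => (hasDerivAt_pow k y).const_mul _) (fun k y hy => ?_) hmem
    (summable_besselTerm l s) hmem
  · refine hd.congr_deriv ?_
    have hsum : Summable fun k : ℕ => besselCoeff l k * (k * s ^ (k - 1)) := by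
      refine Summable.of_norm_bounded hu fun k => ?_
      simp only [u]
      rw [← mul_assoc, norm_mul, norm_pow, mul_comm (besselCoeff l k)]
      refine mul_le_mul_of_nonneg_left (pow_le_pow_left₀ (norm_nonneg _) ?_ _) (norm_nonneg _)
      rw [Real.norm_eq_abs, hR]
      linarith
    rw [hsum.tsum_eq_zero_add, besselSeries, ← tsum_mul_left]
    simp only [Nat.cast_zero, zero_mul, mul_zero, zero_add, Nat.add_sub_cancel]
    refine tsum_congr fun k => ?_
    rw [← mul_assoc, ← mul_assoc, ← besselCoeff_succ, mul_comm (besselCoeff l (k + 1))]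
  · simp only [u]
    rw [← mul_assoc, norm_mul, norm_pow, mul_comm (besselCoeff l k)]
    have : ‖y‖ ≤ R := (mem_ball_zero_iff.1 hy).le
    gcongr
    rfl

theorem continuous_besselSeries (l : ℕ) : Continuous (besselSeries l) :=
  continuous_iff_continuousAt.2 fun s => (hasDerivAt_besselSeries l s).continuousAt

theorem deriv_besselSeries (l : ℕ) :
    deriv (besselSeries l) = fun s => -(1 / 4) * besselSeries (l + 1) s :=
  funext fun s => (hasDerivAt_besselSeries l s).deriv

/-- The derivative is a multiple of the series of the next degree, so the induction on the order of
smoothness must run over all degrees at once. -/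
theorem contDiff_besselSeries (l : ℕ) : ContDiff ℝ ∞ (besselSeries l) := by
  refine contDiff_infty.2 fun n => ?_
  induction n generalizing l with
  | zero => exact contDiff_zero.2 (continuous_besselSeries l)
  | succ n ih =>
    rw [show ((n + 1 : ℕ) : WithTop ℕ∞) = (n : WithTop ℕ∞) + 1 by norm_cast,
      contDiff_succ_iff_deriv]
    refine ⟨fun s => (hasDerivAt_besselSeries l s).differentiableAt, by simp, ?_⟩
    rw [deriv_besselSeries]
    exact contDiff_const.mul (ih (l + 1))

/-- The Bessel differential equation as a three-term recurrence. -/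
theorem besselSeries_recurrence (l : ℕ) (s : ℝ) :
    besselSeries l s = -(s / 4) * besselSeries (l + 2) s + (l + 3 / 2) * besselSeries (l + 1) s := by
  have h1 : Summable fun k : ℕ => k * besselCoeff (l + 1) k * s ^ k := by
    refine (summable_nat_add_iff 1).1 ?_
    refine ((summable_besselTerm (l + 2) s).mul_left (-(s / 4))).congr fun k => ?_
    rw [besselCoeff_succ, pow_succ]
    ring
  have h2 : ∑' k : ℕ, k * besselCoeff (l + 1) k * s ^ k = -(s / 4) * besselSeries (l + 2) s := by
    rw [h1.tsum_eq_zero_add, besselSeries, ← tsum_mul_left]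
    simp only [Nat.cast_zero, zero_mul, zero_add]
    refine tsum_congr fun k => ?_
    rw [besselCoeff_succ, pow_succ]
    ring
  rw [← h2, besselSeries, besselSeries, ← tsum_mul_left, ← h1.tsum_add
    ((summable_besselTerm (l + 1) s).mul_left _)]
  refine tsum_congr fun k => ?_
  rw [besselCoeff_eq_mul]
  ring

theorem besselSeries_zero_pos (l : ℕ) : 0 < besselSeries l 0 := by
  rw [besselSeries, tsum_eq_single 0 (by intro k hk; simp [hk]), besselCoeff_zero]
  have := gamma_half_pos l
  simpa

/-- The half-integer powers combine: `√(π / 2r) √(r/2) = √π / 2`, leaving an integer power of `r`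
times an even entire function. -/
theorem sphBessel_eq (l : ℕ) {r : ℝ} (hr : 0 < r) :
    sphBessel l r = √Real.pi / 2 * (r / 2) ^ l * besselSeries l (r ^ 2) := by
  have hterm : ∀ k : ℕ, (-1) ^ k / ((k.factorial : ℝ) * Real.Gamma (k + ((l : ℝ) + 1 / 2) + 1)) *
      (r / 2) ^ (2 * (k : ℝ) + ((l : ℝ) + 1 / 2)) =
      (r / 2) ^ l * √(r / 2) * (besselCoeff l k * (r ^ 2) ^ k) := by
    intro k
    have e1 : Real.Gamma (k + ((l : ℝ) + 1 / 2) + 1) = Real.Gamma (k + l + 3 / 2) := by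
      congr 1; ring
    have e2 : (r / 2) ^ (2 * (k : ℝ) + ((l : ℝ) + 1 / 2)) =
        (r / 2) ^ (2 * k) * ((r / 2) ^ l * √(r / 2)) := by
      rw [Real.rpow_add (by positivity), Real.rpow_add (by positivity), Real.sqrt_eq_rpow,
        Real.rpow_natCast, ← Real.rpow_natCast _ (2 * k)]
      push_cast; rfl
    have h3 : Real.Gamma (k + l + 3 / 2) ≠ 0 := (Real.Gamma_pos_of_pos (by positivity)).ne'
    rw [e1, e2, besselCoeff, pow_mul, div_pow r 2 2, div_pow (r ^ 2)]
    norm_num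
    field_simp
  rw [sphBessel, if_neg hr.ne', besselJ]
  rw [tsum_congr hterm, tsum_mul_left, ← besselSeries]
  have e : √(Real.pi / (2 * r)) * √(r / 2) = √Real.pi / 2 := by
    rw [← Real.sqrt_mul (by positivity)]
    have : Real.pi / (2 * r) * (r / 2) = Real.pi / 2 ^ 2 := by field_simp
    rw [this, Real.sqrt_div Real.pi_pos.le, Real.sqrt_sq (by norm_num)]
  rw [← e]
  ring

/-- Comparison of the radial functions at different radii, for one degree. -/
theorem exists_besselSeries_ratio {κ : ℝ} (l : ℕ) (h : besselSeries l (κ ^ 2) ≠ 0) :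
    ∃ C : ℝ, ∃ τ > 0, ∀ r s : ℝ, 0 ≤ r → r ≤ 1 → 1 - τ ≤ s → s ≤ 1 →
      besselSeries l ((κ * r) ^ 2) ^ 2 ≤ C * besselSeries l ((κ * s) ^ 2) ^ 2 := by
  have hc : Continuous fun r : ℝ => besselSeries l ((κ * r) ^ 2) ^ 2 :=
    ((continuous_besselSeries l).comp (by fun_prop)).pow 2
  obtain ⟨M, hM⟩ := (isCompact_Icc (a := (0 : ℝ)) (b := 1)).exists_bound_of_continuousOn
    hc.continuousOn
  have hM0 : 0 ≤ M := (norm_nonneg _).trans (hM 0 (by simp))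
  set m := besselSeries l (κ ^ 2) ^ 2 with hm_def
  have hm : 0 < m := by positivity
  -- Within distance `d` of radius `1` the squared series stays above half of its nonzero boundary
  -- value `m`, while `M` bounds it on the whole interval; the ratio is at most `2 M / m`.
  obtain ⟨d, hd, hd'⟩ := Metric.continuous_iff.1 hc 1 (m / 2) (by positivity)
  refine ⟨2 * M / m, d / 2, by positivity, fun r s h0 h1 h2 h3 => ?_⟩
  have h4 := hd' s (by rw [Real.dist_eq, abs_sub_lt_iff]; constructor <;> linarith)
  rw [Real.dist_eq, mul_one, ← hm_def] at h4
  have h5 : m / 2 ≤ besselSeries l ((κ * s) ^ 2) ^ 2 := by linarith [(abs_lt.1 h4).1]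
  have h6 := (le_abs_self _).trans (hM r ⟨h0, h1⟩)
  calc _ ≤ M := h6
    _ = 2 * M / m * (m / 2) := by field_simp
    _ ≤ _ := by gcongr

/-- Comparison of the radial functions at different radii, uniformly in the degree. -/
theorem exists_sphBessel_ratio {κ : ℝ} (hκ : 0 < κ) (h : ∀ l, besselSeries l (κ ^ 2) ≠ 0) :
    ∃ C ≥ 0, ∃ τ > 0, ∀ (l : ℕ) (r s : ℝ), 0 < r → r ≤ s → 1 - τ ≤ s → s ≤ 1 →
      sphBessel l (κ * r) ^ 2 ≤ C * sphBessel l (κ * s) ^ 2 := by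
  -- Degrees from `n` on are handled by closeness of the normalized series to `1`, the finitely many
  -- others by continuity.
  obtain ⟨n, hn⟩ : ∃ n : ℕ, ∀ l ≥ n, Real.exp (κ ^ 2 / (4 * ((l : ℝ) + 1))) - 1 ≤ 1 / 2 := by
    have ht : Tendsto (fun l : ℕ => Real.exp (κ ^ 2 / (4 * ((l : ℝ) + 1))) - 1) atTop
        (𝓝 (Real.exp 0 - 1)) := by
      refine ((Real.continuous_exp.tendsto 0).comp ?_).sub_const 1
      refine Tendsto.const_div_atTop ?_ _
      exact Tendsto.const_mul_atTop (by norm_num)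
        (tendsto_atTop_add_const_right _ _ tendsto_natCast_atTop_atTop)
    have := ht.eventually (ge_mem_nhds (show Real.exp 0 - 1 < 1 / 2 by simp))
    exact eventually_atTop.1 this
  have hsmall : ∀ N : ℕ, ∃ C ≥ 0, ∃ τ > 0, ∀ l < N, ∀ r s : ℝ, 0 ≤ r → r ≤ 1 → 1 - τ ≤ s → s ≤ 1 →
      besselSeries l ((κ * r) ^ 2) ^ 2 ≤ C * besselSeries l ((κ * s) ^ 2) ^ 2 := by
    intro N
    induction N with
    | zero => exact ⟨0, le_rfl, 1, one_pos, fun l hl => absurd hl (Nat.not_lt_zero l)⟩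
    | succ N ih =>
      obtain ⟨C, hC, τ, hτ, H⟩ := ih
      obtain ⟨C', τ', hτ', H'⟩ := exists_besselSeries_ratio N (h N)
      refine ⟨max C C', hC.le.trans (le_max_left _ _), min τ τ', lt_min hτ hτ',
        fun l hl r s h0 h1 h2 h3 => ?_⟩
      rcases Nat.lt_succ_iff_lt_or_eq.1 hl with hl' | rfl
      · refine (H l hl' r s h0 h1 (by linarith [min_le_left τ τ']) h3).trans ?_
        gcongr
        exact le_max_left _ _
      · refine (H' r s h0 h1 (by linarith [min_le_right τ τ']) h3).trans ?_
        gcongr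
        exact le_max_right _ _
  obtain ⟨C, hC, τ, hτ, H⟩ := hsmall n
  -- For large degree the normalized series lies in `[1/2, 3/2]`, so the ratio is at most `3` and
  -- its square at most `9`.
  refine ⟨max C 9, hC.le.trans (le_max_left _ _), τ, hτ, fun l r s hr hrs hs hs1 => ?_⟩
  have hs0 : 0 < s := hr.trans_le hrs
  have hcore : besselSeries l ((κ * r) ^ 2) ^ 2 ≤
      max C 9 * besselSeries l ((κ * s) ^ 2) ^ 2 := by
    rcases lt_or_ge l n with hl | hl
    · refine (H l hl r s hr.le (hrs.trans hs1) hs hs1).trans ?_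
      gcongr
      exact le_max_left _ _
    · have hb : ∀ t, 0 ≤ t → t ≤ 1 →
          |Real.Gamma (l + 3 / 2) * besselSeries l ((κ * t) ^ 2) - 1| ≤ 1 / 2 := by
        intro t h0 h1
        refine (abs_besselSeries_sub_le l _).trans (le_trans ?_ (hn l hl))
        have : |(κ * t) ^ 2| ≤ κ ^ 2 := by
          rw [abs_of_nonneg (by positivity), mul_pow]
          have : t ^ 2 ≤ 1 := pow_le_one₀ h0 h1
          nlinarith [sq_nonneg κ]
        gcongr
      have g := gamma_half_pos l
      have h1 := abs_le.1 (hb r hr.le (hrs.trans hs1))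
      have h2 := abs_le.1 (hb s hs0.le hs1)
      set γ := Real.Gamma (l + 3 / 2)
      set x := besselSeries l ((κ * r) ^ 2)
      set y := besselSeries l ((κ * s) ^ 2)
      have hx : 0 ≤ γ * x := by linarith
      have hxy : γ * x ≤ 3 * (γ * y) := by linarith
      have h3 : (γ * x) ^ 2 ≤ (3 * (γ * y)) ^ 2 := pow_le_pow_left₀ hx hxy 2
      have h4 : γ ^ 2 * x ^ 2 ≤ γ ^ 2 * (9 * y ^ 2) := by nlinarith
      refine (le_of_mul_le_mul_left h4 (by positivity)).trans ?_
      gcongr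
      exact le_max_right _ _
  rw [sphBessel_eq l (mul_pos hκ hr), sphBessel_eq l (mul_pos hκ hs0)]
  -- Here `r ≤ s` is essential: the power `(r/s)^l` would not be bounded uniformly in `l` for `r >
  -- s`.
  have hp : (√Real.pi / 2 * (κ * r / 2) ^ l) ^ 2 ≤ (√Real.pi / 2 * (κ * s / 2) ^ l) ^ 2 := by
    gcongr
  rw [mul_pow, mul_pow _ (besselSeries l ((κ * s) ^ 2))]
  calc _ ≤ (√Real.pi / 2 * (κ * s / 2) ^ l) ^ 2 *
        (max C 9 * besselSeries l ((κ * s) ^ 2) ^ 2) := by gcongr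
    _ = _ := by ring

/-! ### Classical gradients -/

theorem partialDeriv_mul {f g : E3 → ℂ} {x : E3} (hf : DifferentiableAt ℝ f x)
    (hg : DifferentiableAt ℝ g x) (i : Fin 3) :
    partialDeriv i (fun y => f y * g y) x = f x * partialDeriv i g x + partialDeriv i f x * g x := by
  have h : HasFDerivAt (fun y => f y * g y) _ x := hf.hasFDerivAt.mul hg.hasFDerivAt
  rw [partialDeriv, h.fderiv]
  simp [partialDeriv]
  ring

theorem continuous_partialDeriv {f : E3 → ℂ} (hf : ContDiff ℝ 1 f) (i : Fin 3) :
    Continuous (partialDeriv i f) := by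
  have h := hf.continuous_fderiv (by simp)
  unfold partialDeriv
  fun_prop

/-- The classical gradient. -/
def classGradient (f : E3 → ℂ) (x : E3) : EuclideanSpace ℂ (Fin 3) :=
  WithLp.toLp 2 fun i => partialDeriv i f x

theorem continuous_classGradient {f : E3 → ℂ} (hf : ContDiff ℝ 1 f) :
    Continuous (classGradient f) := by
  have h := fun i => continuous_partialDeriv hf i
  unfold classGradient
  fun_prop

theorem memLp_muB_of_continuous {F : Type*} [NormedAddCommGroup F] {f : E3 → F}
    (hf : Continuous f) : MemLp f 2 muB := by
  obtain ⟨C, hC⟩ := (isCompact_closedBall (0 : E3) 1).exists_bound_of_continuousOn hf.continuousOn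
  refine MemLp.of_bound hf.aestronglyMeasurable C
    ((ae_restrict_mem Metric.isOpen_ball.measurableSet).mono fun x hx =>
      hC x (Metric.ball_subset_closedBall hx))

theorem setIntegral_mul_partialDeriv {f φ : E3 → ℂ} (hf : ContDiff ℝ 1 f)
    (hφ : IsTestFunction φ) (i : Fin 3) :
    ∫ x in B1, f x * partialDeriv i φ x = - ∫ x in B1, partialDeriv i f x * φ x := by
  have hφ1 : ContDiff ℝ 1 φ := hφ.1.of_le (by simp)
  have hs : Function.support φ ⊆ B1 := (subset_tsupport _).trans hφ.2.2
  have hs' : Function.support (partialDeriv i φ) ⊆ B1 := by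
    refine Set.Subset.trans ?_ hφ.2.2
    intro x hx
    refine support_fderiv_subset ℝ (f := φ) fun h => hx ?_
    simp [partialDeriv, h]
  have hcs : HasCompactSupport (partialDeriv i φ) :=
    (hφ.2.1.fderiv (𝕜 := ℝ)).comp_left
      (g := fun L : E3 →L[ℝ] ℂ => L (EuclideanSpace.single i 1)) (by simp)
  rw [setIntegral_eq_integral_of_forall_compl_eq_zero
      (fun x hx => by rw [Function.notMem_support.1 fun h => hx (hs' h), mul_zero]),
    setIntegral_eq_integral_of_forall_compl_eq_zero
      (fun x hx => by rw [Function.notMem_support.1 fun h => hx (hs h), mul_zero])]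
  refine integral_mul_fderiv_eq_neg_fderiv_mul_of_integrable ?_ ?_ ?_
    (fun x _ => hf.differentiable (by simp) x) (fun x _ => hφ1.differentiable (by simp) x)
  · exact ((continuous_partialDeriv hf i).mul hφ.1.continuous).integrable_of_hasCompactSupport
      hφ.2.1.mul_left
  · exact (hf.continuous.mul (continuous_partialDeriv hφ1 i)).integrable_of_hasCompactSupport
      hcs.mul_left
  · exact (hf.continuous.mul hφ.1.continuous).integrable_of_hasCompactSupport hφ.2.1.mul_left

theorem isWeakGradient_classGradient {f : E3 → ℂ} (hf : ContDiff ℝ 1 f) :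
    IsWeakGradient f (classGradient f) :=
  ⟨memLp_muB_of_continuous (continuous_classGradient hf), fun _ hφ i =>
    setIntegral_mul_partialDeriv hf hφ i⟩

theorem memH1_of_contDiff {f : E3 → ℂ} (hf : ContDiff ℝ 1 f) : MemH1 f :=
  ⟨memLp_muB_of_continuous hf.continuous, _, isWeakGradient_classGradient hf⟩

/-! ### Dirichlet eigenfunctions -/

/-- The complex coordinate `x₁ + i x₂`. -/
def planar (x : E3) : ℂ := (x 0 : ℂ) + Complex.I * (x 1 : ℂ)

/-- The gradient of the complex coordinate `x₁ + i x₂`. -/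
def planarGrad (i : Fin 3) : ℂ := ![1, Complex.I, 0] i

theorem contDiff_coord (i : Fin 3) : ContDiff ℝ ∞ fun x : E3 => (x i : ℂ) :=
  Complex.ofRealCLM.contDiff.comp (EuclideanSpace.proj (𝕜 := ℝ) i).contDiff

theorem partialDeriv_coord_self (i : Fin 3) (x : E3) :
    partialDeriv i (fun y : E3 => (y i : ℂ)) x = 1 := by
  have hc : HasFDerivAt (fun y : E3 => (y i : ℂ))
      (Complex.ofRealCLM.comp (EuclideanSpace.proj (𝕜 := ℝ) i)) x :=
    (Complex.ofRealCLM.comp (EuclideanSpace.proj (𝕜 := ℝ) i)).hasFDerivAt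
  rw [partialDeriv, hc.fderiv]
  simp

theorem contDiff_planar : ContDiff ℝ ∞ planar :=
  (contDiff_coord 0).add (contDiff_const.mul (contDiff_coord 1))

theorem partialDeriv_planar_pow (i : Fin 3) (n : ℕ) (x : E3) :
    partialDeriv i (fun y => planar y ^ n) x = n * planar x ^ (n - 1) * planarGrad i := by
  have hc : ∀ j : Fin 3, HasFDerivAt (fun y : E3 => (y j : ℂ))
      (Complex.ofRealCLM.comp (EuclideanSpace.proj (𝕜 := ℝ) j)) x := fun j =>
    (Complex.ofRealCLM.comp (EuclideanSpace.proj (𝕜 := ℝ) j)).hasFDerivAt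
  have hp : HasFDerivAt planar _ x := (hc 0).add ((hc 1).const_mul Complex.I)
  have h : HasFDerivAt (fun y => planar y ^ n) _ x := hp.pow n
  rw [partialDeriv, h.fderiv]
  fin_cases i <;> simp [planarGrad]

theorem norm_planar_le (x : E3) : ‖planar x‖ ≤ ‖x‖ := by
  have h : planar x = ⟨x 0, x 1⟩ := by
    apply Complex.ext <;> simp [planar]
  rw [h, Complex.norm_eq_sqrt_sq_add_sq, EuclideanSpace.norm_eq, Fin.sum_univ_three]
  refine Real.sqrt_le_sqrt ?_
  simp only [Real.norm_eq_abs, sq_abs]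
  linarith [sq_nonneg (x 2)]

/-- The radial factor `G_l(κ² |x|²)` as a complex function. -/
def besselRadial (κ : ℝ) (l : ℕ) (x : E3) : ℂ := (besselSeries l (κ ^ 2 * ‖x‖ ^ 2) : ℂ)

theorem contDiff_besselRadial (κ : ℝ) (l : ℕ) : ContDiff ℝ ∞ (besselRadial κ l) :=
  Complex.ofRealCLM.contDiff.comp
    ((contDiff_besselSeries l).comp (contDiff_const.mul (contDiff_norm_sq ℝ)))

theorem partialDeriv_besselRadial (κ : ℝ) (l : ℕ) (i : Fin 3) (x : E3) :
    partialDeriv i (besselRadial κ l) x = -(κ ^ 2 / 2) * ((x i : ℂ) * besselRadial κ (l + 1) x) := by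
  have h1 : HasFDerivAt (fun y : E3 => κ ^ 2 * ‖y‖ ^ 2) (κ ^ 2 • (2 • innerSL ℝ x)) x :=
    ((hasStrictFDerivAt_norm_sq x).hasFDerivAt).const_mul (κ ^ 2)
  have h2 := (hasDerivAt_besselSeries l (κ ^ 2 * ‖x‖ ^ 2)).comp_hasFDerivAt x h1
  have h3 : HasFDerivAt (besselRadial κ l) _ x := Complex.ofRealCLM.hasFDerivAt.comp x h2
  rw [partialDeriv, h3.fderiv]
  simp [besselRadial, EuclideanSpace.inner_single_right]
  ring

/-- The regular solution `G_l(κ² |x|²) (x₁ + i x₂) ^ l` of the Helmholtz equation. -/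
def sectorial (κ : ℝ) (l : ℕ) (x : E3) : ℂ := besselRadial κ l x * planar x ^ l

theorem contDiff_sectorial (κ : ℝ) (l : ℕ) : ContDiff ℝ ∞ (sectorial κ l) :=
  (contDiff_besselRadial κ l).mul (contDiff_planar.pow l)

theorem partialDeriv_sectorial (κ : ℝ) (l : ℕ) (i : Fin 3) :
    partialDeriv i (sectorial κ l) = fun x =>
      besselRadial κ l x * (l * planar x ^ (l - 1) * planarGrad i) +
      -(κ ^ 2 / 2) * ((x i : ℂ) * besselRadial κ (l + 1) x) * planar x ^ l := by
  ext x
  have h := partialDeriv_mul (x := x) ((contDiff_besselRadial κ l).differentiable (by simp) x)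
    ((contDiff_planar.pow l).differentiable (by simp) x) i
  rw [partialDeriv_planar_pow, partialDeriv_besselRadial] at h
  exact h

/-- The vector `(1, i, 0)` is isotropic, so `planar ^ l` is harmonic, and Euler's identity gives `x
· ∇(planar ^ l) = l planar ^ l`. What remains is `-κ² planar ^ l` times `(l + 3/2) G_{l+1} - (s/4)
G_{l+2}` with `s = κ² |x|²`, which equals `G_l` by the three-term recurrence. -/
theorem laplacian_sectorial (κ : ℝ) (l : ℕ) (x : E3) :
    ∑ i, partialDeriv i (partialDeriv i (sectorial κ l)) x = -(κ ^ 2 * sectorial κ l x) := by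
  have dB : ∀ l, Differentiable ℝ (besselRadial κ l) := fun l =>
    (contDiff_besselRadial κ l).differentiable (by simp)
  have dP : ∀ n, Differentiable ℝ fun y => planar y ^ n := fun n =>
    (contDiff_planar.pow n).differentiable (by simp)
  have dX : ∀ i : Fin 3, Differentiable ℝ fun y : E3 => (y i : ℂ) := fun i =>
    (contDiff_coord i).differentiable (by simp)
  have hterm : ∀ i, partialDeriv i (partialDeriv i (sectorial κ l)) x =
      besselRadial κ l x * (l * ((l - 1 : ℕ) * planar x ^ (l - 1 - 1) * planarGrad i) * planarGrad i)
      - κ ^ 2 * ((x i : ℂ) * planarGrad i) * besselRadial κ (l + 1) x * (l * planar x ^ (l - 1))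
      - (κ ^ 2 / 2) * besselRadial κ (l + 1) x * planar x ^ l
      + (κ ^ 2 / 2) ^ 2 * (x i : ℂ) ^ 2 * besselRadial κ (l + 2) x * planar x ^ l := by
    intro i
    have d1 : Differentiable ℝ fun y => (l * planarGrad i) * planar y ^ (l - 1) :=
      (differentiable_const _).mul (dP _)
    have d2 : Differentiable ℝ fun y : E3 => (y i : ℂ) * besselRadial κ (l + 1) y :=
      (dX i).mul (dB _)
    have d3 : Differentiable ℝ fun y : E3 =>
        -((κ : ℂ) ^ 2 / 2) * ((y i : ℂ) * besselRadial κ (l + 1) y) :=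
      (differentiable_const _).mul d2
    have hc : ∀ c : ℂ, partialDeriv i (fun _ => c) x = 0 := fun c => by simp [partialDeriv]
    have e0 : partialDeriv i (sectorial κ l) = fun y =>
        besselRadial κ l y * ((l * planarGrad i) * planar y ^ (l - 1)) +
        -((κ : ℂ) ^ 2 / 2) * ((y i : ℂ) * besselRadial κ (l + 1) y) * planar y ^ l := by
      rw [partialDeriv_sectorial]
      ext y; ring
    have hadd : partialDeriv i (partialDeriv i (sectorial κ l)) x =
        partialDeriv i (fun y => besselRadial κ l y * ((l * planarGrad i) * planar y ^ (l - 1))) x +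
        partialDeriv i (fun y =>
          -((κ : ℂ) ^ 2 / 2) * ((y i : ℂ) * besselRadial κ (l + 1) y) * planar y ^ l) x := by
      have h : HasFDerivAt (fun y => besselRadial κ l y * ((l * planarGrad i) * planar y ^ (l - 1)) +
        -((κ : ℂ) ^ 2 / 2) * ((y i : ℂ) * besselRadial κ (l + 1) y) * planar y ^ l) _ x :=
        (((dB l).mul d1) x).hasFDerivAt.add ((d3.mul (dP l)) x).hasFDerivAt
      rw [e0, partialDeriv, h.fderiv]
      rfl
    rw [hadd, partialDeriv_mul (dB l x) (d1 x),
      partialDeriv_mul (differentiable_const _ x) (dP _ x),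
      partialDeriv_mul (d3 x) (dP l x), partialDeriv_mul (differentiable_const _ x) (d2 x),
      partialDeriv_mul (dX i x) (dB _ x), partialDeriv_planar_pow, partialDeriv_planar_pow,
      partialDeriv_besselRadial, partialDeriv_besselRadial, partialDeriv_coord_self, hc, hc]
    ring
  have hrec : besselRadial κ l x = -((κ : ℂ) ^ 2 * ((x 0 : ℂ) ^ 2 + (x 1 : ℂ) ^ 2 + (x 2 : ℂ) ^ 2) / 4) *
      besselRadial κ (l + 2) x + (l + 3 / 2) * besselRadial κ (l + 1) x := by
    have h := besselSeries_recurrence l (κ ^ 2 * ‖x‖ ^ 2)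
    have hn : ‖x‖ ^ 2 = x 0 ^ 2 + x 1 ^ 2 + x 2 ^ 2 := by
      rw [EuclideanSpace.norm_sq_eq, Fin.sum_univ_three]
      simp
    have hn' : ((‖x‖ ^ 2 : ℝ) : ℂ) = (x 0 : ℂ) ^ 2 + (x 1 : ℂ) ^ 2 + (x 2 : ℂ) ^ 2 := by
      rw [hn]; push_cast; rfl
    have h' := congrArg (fun t : ℝ => (t : ℂ)) h
    simp only [besselRadial]
    rw [h', ← hn']
    push_cast
    ring
  have hpl : (l : ℂ) * planar x ^ (l - 1) * planar x = l * planar x ^ l := by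
    rcases l with _ | n
    · simp
    · simp [pow_succ, mul_assoc]
  have hpl' : (x 0 : ℂ) + (x 1 : ℂ) * Complex.I = planar x := by rw [planar]; ring
  have g0 : planarGrad 0 = 1 := rfl
  have g1 : planarGrad 1 = Complex.I := rfl
  have g2 : planarGrad 2 = 0 := rfl
  simp only [hterm, Fin.sum_univ_three, g0, g1, g2]
  rw [sectorial]
  have hI := Complex.I_sq
  linear_combination ((κ : ℂ) ^ 2 * planar x ^ l) * hrec
    + (-(κ : ℂ) ^ 2 * besselRadial κ (l + 1) x) * hpl
    + (-(κ : ℂ) ^ 2 * besselRadial κ (l + 1) x * l * planar x ^ (l - 1)) * hpl'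
    + (besselRadial κ l x * l * ((l - 1 : ℕ) : ℂ) * planar x ^ (l - 1 - 1)) * hI

/-- The cutoff function that vanishes for `n (1 - |x|²) ≤ 1` and equals one for
`n (1 - |x|²) ≥ 2`. -/
def ballCutoff (n : ℕ) (x : E3) : ℂ := (Real.smoothTransition (-n * ‖x‖ ^ 2 + (n - 1)) : ℝ)

theorem contDiff_ballCutoff (n : ℕ) : ContDiff ℝ ∞ (ballCutoff n) :=
  Complex.ofRealCLM.contDiff.comp (Real.smoothTransition.contDiff.comp
    ((contDiff_const.mul (contDiff_norm_sq ℝ)).add contDiff_const))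

theorem partialDeriv_ballCutoff (n : ℕ) (i : Fin 3) (x : E3) :
    partialDeriv i (ballCutoff n) x =
      ((-n * deriv Real.smoothTransition (-n * ‖x‖ ^ 2 + (n - 1)) * (2 * x i) : ℝ) : ℂ) := by
  have h1 : HasFDerivAt (fun y : E3 => ‖y‖ ^ 2) (2 • innerSL ℝ x) x :=
    (hasStrictFDerivAt_norm_sq x).hasFDerivAt
  have h2 := (hasDerivAt_smoothTransition_affine (-n) (n - 1) (‖x‖ ^ 2)).comp_hasFDerivAt x h1
  have h3 : HasFDerivAt (ballCutoff n) _ x := Complex.ofRealCLM.hasFDerivAt.comp x h2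
  rw [partialDeriv, h3.fderiv]
  simp [EuclideanSpace.inner_single_right]

theorem isTestFunction_ballCutoff_mul {v : E3 → ℂ} (hv : ContDiff ℝ ∞ v) {n : ℕ} (hn : 1 ≤ n) :
    IsTestFunction (fun x => ballCutoff n x * v x) := by
  have hn' : (1 : ℝ) ≤ n := by exact_mod_cast hn
  have hts : tsupport (fun x => ballCutoff n x * v x) ⊆ {x : E3 | n * ‖x‖ ^ 2 ≤ n - 1} := by
    refine closure_minimal (fun x hx => ?_) (isClosed_le (by fun_prop) continuous_const)
    by_contra hcon
    have hcon' : (n : ℝ) - 1 < n * ‖x‖ ^ 2 := not_le.1 hcon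
    refine hx ?_
    simp only [ballCutoff]
    rw [Real.smoothTransition.zero_of_nonpos (by linarith)]
    simp
  have hsub : {x : E3 | n * ‖x‖ ^ 2 ≤ n - 1} ⊆ B1 := by
    intro x hx
    rw [mem_ball_zero_iff]
    by_contra! hcon
    have h1 : (1 : ℝ) ≤ ‖x‖ ^ 2 := one_le_pow₀ hcon
    have h2 : n * ‖x‖ ^ 2 ≤ (n : ℝ) - 1 := hx
    nlinarith
  refine ⟨(contDiff_ballCutoff n).mul hv, ?_, hts.trans hsub⟩
  exact (isCompact_closedBall (0 : E3) 1).of_isClosed_subset (isClosed_tsupport _)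
    ((hts.trans hsub).trans Metric.ball_subset_closedBall)

/-- A smooth function that vanishes to first order at the unit sphere belongs to `H¹₀(B₁)`. -/
theorem memH10_of_bound {v : E3 → ℂ} (hv : ContDiff ℝ ∞ v) {K : ℝ}
    (hK : ∀ x ∈ B1, ‖v x‖ ≤ K * (1 - ‖x‖ ^ 2)) : MemH10 v := by
  have hv1 : ContDiff ℝ 1 v := hv.of_le (by simp)
  refine ⟨memH1_of_contDiff hv1, ?_⟩
  obtain ⟨D, hD⟩ := exists_bound_deriv_smoothTransition
  have hD0 : 0 ≤ D := (abs_nonneg _).trans (hD 0)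
  have hK0 : 0 ≤ K := by
    have h := (norm_nonneg _).trans (hK 0 (by simp))
    simpa using h
  let φ : ℕ → E3 → ℂ := fun n x => ballCutoff n x * v x
  have hφ : ∀ n, ContDiff ℝ 1 (v - φ n) := fun n =>
    hv1.sub (((contDiff_ballCutoff n).of_le (by simp)).mul hv1)
  have hval : ∀ n x, (v - φ n) x = (1 - ballCutoff n x) * v x := fun n x => by
    simp only [φ, Pi.sub_apply]; ring
  have hcut : ∀ n x, ‖1 - ballCutoff n x‖ ≤ 1 := fun n x => by
    have h0 := Real.smoothTransition.nonneg (-n * ‖x‖ ^ 2 + (n - 1))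
    have h1 := Real.smoothTransition.le_one (-n * ‖x‖ ^ 2 + (n - 1))
    rw [ballCutoff, ← Complex.ofReal_one, ← Complex.ofReal_sub, Complex.norm_real,
      Real.norm_of_nonneg (by linarith)]
    linarith
  have hgrad : ∀ n i x, partialDeriv i (v - φ n) x =
      (1 - ballCutoff n x) * partialDeriv i v x - partialDeriv i (ballCutoff n) x * v x := by
    intro n i x
    have h1 : v - φ n = fun y => (1 - ballCutoff n y) * v y := funext (hval n)
    have d1 : DifferentiableAt ℝ (ballCutoff n) x :=
      (contDiff_ballCutoff n).differentiable (by simp) x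
    have d2 : HasFDerivAt (fun y => 1 - ballCutoff n y) (-fderiv ℝ (ballCutoff n) x) x :=
      d1.hasFDerivAt.const_sub 1
    rw [h1, partialDeriv_mul d2.differentiableAt (hv1.differentiable (by simp) x)]
    have h3 : partialDeriv i (fun y => 1 - ballCutoff n y) x = -partialDeriv i (ballCutoff n) x := by
      rw [partialDeriv, d2.fderiv]; rfl
    rw [h3]; ring
  have hev : ∀ x ∈ B1, ∀ᶠ n : ℕ in atTop, (1 : ℝ) ≤ -n * ‖x‖ ^ 2 + (n - 1) := by
    intro x hx
    have hx1 : ‖x‖ < 1 := mem_ball_zero_iff.1 hx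
    have h1 : 0 < 1 - ‖x‖ ^ 2 := by nlinarith [norm_nonneg x]
    filter_upwards [tendsto_natCast_atTop_atTop.eventually_ge_atTop (2 / (1 - ‖x‖ ^ 2))] with n hn
    rw [div_le_iff₀ h1] at hn
    linarith
  -- The derivative of the cutoff has size `n` but is nonzero only where `n (1 - |x|²) < 2`; the
  -- decay of `v` at the sphere absorbs the factor `n`. This gives the integrable majorant for the
  -- gradients.
  have hcutd : ∀ n, ∀ x ∈ B1, ∀ i, ‖partialDeriv i (ballCutoff n) x * v x‖ ≤ 4 * D * K := by
    intro n x hx i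
    have hx1 : ‖x‖ < 1 := mem_ball_zero_iff.1 hx
    have h1 : 0 < 1 - ‖x‖ ^ 2 := by nlinarith [norm_nonneg x]
    rw [partialDeriv_ballCutoff, norm_mul, Complex.norm_real]
    rcases le_or_gt 1 (-n * ‖x‖ ^ 2 + (n - 1) : ℝ) with h | h
    · rw [deriv_smoothTransition_eq_zero (Or.inr h)]
      simp; positivity
    · have hxi : |x i| ≤ 1 := (PiLp.norm_apply_le x i).trans hx1.le
      have h2 : ‖(-n * deriv Real.smoothTransition (-n * ‖x‖ ^ 2 + (n - 1)) * (2 * x i) : ℝ)‖ ≤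
          n * D * (2 * 1) := by
        rw [Real.norm_eq_abs, abs_mul, abs_mul, abs_neg, abs_of_nonneg (Nat.cast_nonneg n), abs_mul,
          abs_of_pos (by norm_num : (0 : ℝ) < 2)]
        gcongr
        exact hD _
      calc _ ≤ n * D * (2 * 1) * (K * (1 - ‖x‖ ^ 2)) := by
            gcongr
            exact hK x hx
        _ = 2 * D * K * (n * (1 - ‖x‖ ^ 2)) := by ring
        _ ≤ 2 * D * K * 2 := by gcongr; linarith
        _ = _ := by ring
  have hbint : ∀ (b : E3 → ℝ), Continuous b → Integrable b muB := fun b hb =>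
    (memLp_muB_of_continuous hb).integrable (by norm_num)
  have hlim1 : Tendsto (fun n => ∫ x in B1, ‖(v - φ n) x‖ ^ 2) atTop (𝓝 0) := by
    have h := tendsto_integral_of_dominated_convergence (μ := muB) (F := fun n x => ‖(v - φ n) x‖ ^ 2)
      (f := fun _ => 0) (fun x => ‖v x‖ ^ 2)
      (fun n => (by have := (hφ n).continuous; fun_prop :
        Continuous fun x => ‖(v - φ n) x‖ ^ 2).aestronglyMeasurable)
      (hbint _ (by have := hv1.continuous; fun_prop))
      (fun n => ae_of_all _ fun x => ?_)
      ((ae_restrict_mem Metric.isOpen_ball.measurableSet).mono fun x hx => ?_)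
    · simpa using h
    · rw [Real.norm_of_nonneg (by positivity), hval, norm_mul]
      gcongr
      exact mul_le_of_le_one_left (norm_nonneg _) (hcut n x)
    · refine tendsto_const_nhds.congr' ?_
      filter_upwards [hev x hx] with n hn
      rw [hval, ballCutoff, Real.smoothTransition.one_of_one_le hn]
      simp
  have hlim2 : Tendsto (fun n => ∫ x in B1, ‖classGradient (v - φ n) x‖ ^ 2) atTop (𝓝 0) := by
    have h := tendsto_integral_of_dominated_convergence (μ := muB)
      (F := fun n x => ‖classGradient (v - φ n) x‖ ^ 2)
      (f := fun _ => 0) (fun x => ∑ i, (‖partialDeriv i v x‖ + 4 * D * K) ^ 2)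
      (fun n => (by have := continuous_classGradient (hφ n); fun_prop :
        Continuous fun x => ‖classGradient (v - φ n) x‖ ^ 2).aestronglyMeasurable)
      (hbint _ (by have := fun i => continuous_partialDeriv hv1 i; fun_prop))
      (fun n => (ae_restrict_mem Metric.isOpen_ball.measurableSet).mono fun x hx => ?_)
      ((ae_restrict_mem Metric.isOpen_ball.measurableSet).mono fun x hx => ?_)
    · simpa using h
    · rw [Real.norm_of_nonneg (by positivity), EuclideanSpace.norm_sq_eq]
      refine Finset.sum_le_sum fun i _ => ?_
      simp only [classGradient]
      rw [hgrad]
      gcongr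
      refine (norm_sub_le _ _).trans (add_le_add ?_ (hcutd n x hx i))
      rw [norm_mul]
      exact mul_le_of_le_one_left (norm_nonneg _) (hcut n x)
    · refine tendsto_const_nhds.congr' ?_
      filter_upwards [hev x hx] with n hn
      rw [EuclideanSpace.norm_sq_eq]
      refine (Finset.sum_eq_zero fun i _ => ?_).symm
      simp only [classGradient]
      rw [hgrad, partialDeriv_ballCutoff, deriv_smoothTransition_eq_zero (Or.inr hn), ballCutoff,
        Real.smoothTransition.one_of_one_le hn]
      simp
  have hb : ∀ n, bNorm 1 (v - φ n) = √((∫ x in B1, ‖(v - φ n) x‖ ^ 2) +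
      ∫ x in B1, ‖classGradient (v - φ n) x‖ ^ 2) := by
    intro n
    rw [bNorm, one_pow, inv_one, one_mul]
    congr 2
    exact integral_congr_ae ((weakGradient_ae_eq (isWeakGradient_classGradient (hφ n))).mono
      fun x hx => by simp only [hx])
  have hlim : Tendsto (fun n => bNorm 1 (v - φ n)) atTop (𝓝 0) := by
    simp only [hb]
    have h := (hlim1.add hlim2).sqrt
    simpa using h
  intro ε hε
  obtain ⟨n, hn, hn1⟩ := ((hlim.eventually_lt_const hε).and (eventually_ge_atTop 1)).exists
  exact ⟨φ n, isTestFunction_ballCutoff_mul hv hn1, hn⟩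

/-- The radial factor vanishes at `|x| = 1`, and the mean value inequality turns this into linear
decay in `1 - |x|²`. -/
theorem exists_bound_sectorial {κ : ℝ} {l : ℕ} (h : besselSeries l (κ ^ 2) = 0) :
    ∃ K, ∀ x ∈ B1, ‖sectorial κ l x‖ ≤ K * (1 - ‖x‖ ^ 2) := by
  have hc : Continuous fun s => -(1 / 4) * besselSeries (l + 1) s :=
    continuous_const.mul (continuous_besselSeries _)
  obtain ⟨L, hL⟩ := (isCompact_Icc (a := (0 : ℝ)) (b := κ ^ 2)).exists_bound_of_continuousOn
    hc.continuousOn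
  refine ⟨L * κ ^ 2, fun x hx => ?_⟩
  have hx1 : ‖x‖ < 1 := mem_ball_zero_iff.1 hx
  have h1 : ‖x‖ ^ 2 ≤ 1 := pow_le_one₀ (norm_nonneg _) hx1.le
  have hmem : κ ^ 2 * ‖x‖ ^ 2 ∈ Set.Icc 0 (κ ^ 2) :=
    ⟨by positivity, mul_le_of_le_one_right (sq_nonneg _) h1⟩
  have hmv := (convex_Icc (0 : ℝ) (κ ^ 2)).norm_image_sub_le_of_norm_hasDerivWithin_le
    (fun s _ => (hasDerivAt_besselSeries l s).hasDerivWithinAt) hL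
    (Set.right_mem_Icc.2 (sq_nonneg κ)) hmem
  rw [h, sub_zero, Real.norm_eq_abs, Real.norm_eq_abs, abs_sub_comm,
    abs_of_nonneg (a := κ ^ 2 - _) (by nlinarith [sq_nonneg κ])] at hmv
  rw [sectorial, norm_mul, norm_pow, besselRadial, Complex.norm_real, Real.norm_eq_abs]
  calc _ ≤ |besselSeries l (κ ^ 2 * ‖x‖ ^ 2)| * 1 := by
        gcongr
        exact pow_le_one₀ (norm_nonneg _) ((norm_planar_le x).trans hx1.le)
    _ ≤ L * (κ ^ 2 - κ ^ 2 * ‖x‖ ^ 2) := by rw [mul_one]; exact hmv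
    _ = _ := by ring

/-- By continuity it is enough to find one nonzero value, and near the origin on the first axis both
factors are nonzero. -/
theorem sectorial_not_ae_zero (κ : ℝ) (l : ℕ) : ¬ (sectorial κ l =ᵐ[muB] 0) := by
  intro h
  have h2 : Set.EqOn (sectorial κ l) 0 B1 :=
    Measure.eqOn_open_of_ae_eq h Metric.isOpen_ball
      (contDiff_sectorial κ l).continuous.continuousOn continuousOn_const
  have hc : Continuous fun t : ℝ => besselSeries l (κ ^ 2 * t ^ 2) :=
    (continuous_besselSeries l).comp (by fun_prop)
  have hpos : ∀ᶠ t in 𝓝[>] (0 : ℝ), 0 < besselSeries l (κ ^ 2 * t ^ 2) := by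
    refine (hc.tendsto 0).mono_left nhdsWithin_le_nhds |>.eventually (lt_mem_nhds ?_)
    simpa using besselSeries_zero_pos l
  have hlt : ∀ᶠ t in 𝓝[>] (0 : ℝ), t < 1 :=
    nhdsWithin_le_nhds (gt_mem_nhds one_pos)
  obtain ⟨t, ⟨h3, h4⟩, h5⟩ := ((hpos.and hlt).and self_mem_nhdsWithin).exists
  have ht : 0 < t := h5
  let x : E3 := EuclideanSpace.single 0 t
  have hnx : ‖x‖ = t := by simp [x, abs_of_pos ht]
  have hxB : x ∈ B1 := by rw [mem_ball_zero_iff, hnx]; exact h4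
  have h6 := h2 hxB
  have h7 : planar x = t := by simp [planar, x]
  simp only [sectorial, besselRadial, hnx, h7, Pi.zero_apply, mul_eq_zero,
    Complex.ofReal_eq_zero] at h6
  rcases h6 with h6 | h6
  · exact h3.ne' h6
  · exact pow_ne_zero l (Complex.ofReal_ne_zero.2 ht.ne') h6

/-- A zero of the spherical Bessel function at `κ` produces a Dirichlet eigenvalue. -/
theorem isDirichletEigenvalue_of_besselSeries_eq_zero {κ : ℝ} {l : ℕ}
    (h : besselSeries l (κ ^ 2) = 0) : IsDirichletEigenvalue (κ ^ 2) := by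
  obtain ⟨K, hK⟩ := exists_bound_sectorial h
  have hv := contDiff_sectorial κ l
  have hv1 : ContDiff ℝ 1 (sectorial κ l) := hv.of_le (by simp)
  refine ⟨sectorial κ l, memH10_of_bound hv hK, sectorial_not_ae_zero κ l, fun φ hφ => ?_⟩
  have hae := weakGradient_ae_eq (isWeakGradient_classGradient hv1)
  have hp : ∀ i, ContDiff ℝ 1 (partialDeriv i (sectorial κ l)) := by
    intro i
    have h2 : ContDiff ℝ 1 (fderiv ℝ (sectorial κ l)) := 
      (hv.of_le (m := 2) ENat.LEInfty.out).fderiv_right one_add_one_eq_two.le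
    exact h2.clm_apply contDiff_const
  have hφb := hφ.2.1.exists_bound_of_continuous hφ.1.continuous
  have e1 : ∫ x in B1, ∑ i, weakGradient (sectorial κ l) x i * partialDeriv i φ x =
      ∫ x in B1, ∑ i, partialDeriv i (sectorial κ l) x * partialDeriv i φ x := by
    refine integral_congr_ae (hae.mono fun x hx => ?_)
    simp only [hx, classGradient]
  have hI : ∀ i, Integrable (fun x => partialDeriv i (partialDeriv i (sectorial κ l)) x * φ x) muB :=
    fun i => integrable_mul_of_bounded
      (memLp_muB_of_continuous (continuous_partialDeriv (hp i) i)) hφ.1.continuous hφb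
  rw [e1, integral_finsetSum _ fun i _ => integrable_mul_of_bounded
    (memLp_muB_of_continuous (hp i).continuous) (hφ.continuous_partialDeriv i)
    (hφ.exists_bound_partialDeriv i)]
  simp only [setIntegral_mul_partialDeriv (hp _) hφ]
  rw [Finset.sum_neg_distrib, ← integral_finsetSum _ fun i _ => hI i, ← integral_neg,
    ← integral_const_mul]
  refine integral_congr_ae (ae_of_all _ fun x => ?_)
  simp only
  rw [← Finset.sum_mul, laplacian_sectorial]
  push_cast
  ring

/-! ### Associated Legendre functions -/

section Legendre

open Polynomial

/-- The `j`-th derivative of `(X² - 1) ^ l`. -/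
def legD (l j : ℕ) : ℝ[X] := derivative^[j] ((X ^ 2 - 1 : ℝ[X]) ^ l)

theorem derivative_legD (l j : ℕ) : derivative (legD l j) = legD l (j + 1) :=
  (Function.iterate_succ_apply' _ _ _).symm

/-- Repeated differentiation of `(X² - 1) p' = 2 l X p` for `p = (X² - 1)^l`. -/
theorem legD_ode (l j : ℕ) :
    (X ^ 2 - 1) * legD l (j + 2) + 2 * ((j : ℝ[X]) + 1 - (l : ℝ[X])) * X * legD l (j + 1)
      = (2 * (l : ℝ[X]) - (j : ℝ[X])) * ((j : ℝ[X]) + 1) * legD l j := by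
  have hD : ∀ n : ℕ, derivative (n : ℝ[X]) = 0 := fun _ => derivative_natCast
  have hC2 : (C (2 : ℝ) : ℝ[X]) = 2 := map_ofNat C 2
  induction j with
  | zero =>
    have h1 : (X ^ 2 - 1) * legD l 1 = 2 * (l : ℝ[X]) * X * legD l 0 := by
      rw [← derivative_legD, legD, Function.iterate_zero, id]
      rcases l with _ | n
      · simp
      · rw [derivative_pow_succ]
        simp only [derivative_sub, derivative_X_pow, derivative_one]
        simp [hC2]
        ring
    have h2 := congrArg derivative h1
    simp only [derivative_mul, derivative_sub, derivative_X_pow, derivative_one, derivative_X,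
      derivative_legD, hD, derivative_ofNat] at h2
    simp only [Nat.cast_zero] at h2 ⊢
    simp [hC2] at h2
    linear_combination h2
  | succ j ih =>
    have h2 := congrArg derivative ih
    simp only [derivative_mul, derivative_sub, derivative_add, derivative_X_pow, derivative_one,
      derivative_X, derivative_legD, hD, derivative_ofNat] at h2
    simp [hC2] at h2
    push_cast
    linear_combination h2

/-- The self-adjoint form of the associated Legendre equation; both the symmetry in the order and
the Wronskian identity rest on it. -/
theorem derivative_legD_weight (l n : ℕ) :
    derivative ((X ^ 2 - 1) ^ (n + 1) * legD l (l + n + 1)) =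
      ((l : ℝ[X]) - (n : ℝ[X])) * ((l : ℝ[X]) + (n : ℝ[X]) + 1) * ((X ^ 2 - 1) ^ n * legD l (l + n)) := by
  have h := legD_ode l (l + n)
  rw [derivative_mul, derivative_pow_succ, derivative_legD]
  simp only [derivative_sub, derivative_X_pow, derivative_one]
  have hC2 : (C (2 : ℝ) : ℝ[X]) = 2 := map_ofNat C 2
  push_cast at h
  simp [hC2]
  linear_combination (X ^ 2 - 1) ^ n * h

theorem eval_one_legD {l j : ℕ} (h : j < l) : (legD l j).eval 1 = 0 := by
  have h1 : (X ^ 2 - 1 : ℝ[X]) ∣ legD l j :=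
    (dvd_pow_self _ (Nat.sub_ne_zero_of_lt h)).trans (pow_sub_dvd_iterate_derivative_pow _ l j)
  obtain ⟨q, hq⟩ := h1
  rw [hq]
  simp

/-- The symmetry between the orders `n` and `-n`. -/
theorem exists_legD_symm {l n : ℕ} (hn : n ≤ l) :
    ∃ c : ℝ, c ≠ 0 ∧ (X ^ 2 - 1) ^ n * legD l (l + n) = C c * legD l (l - n) := by
  induction n with
  | zero => exact ⟨1, one_ne_zero, by simp⟩
  | succ n ih =>
    obtain ⟨c, hc, h⟩ := ih (by omega)
    have hln : ((l : ℝ) - n) * (l + n + 1) ≠ 0 := by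
      have : (n : ℝ) < l := by exact_mod_cast hn
      exact mul_ne_zero (sub_ne_zero.2 this.ne') (by positivity)
    refine ⟨(l - n) * (l + n + 1) * c, mul_ne_zero hln hc, ?_⟩
    -- The two sides have the same derivative, by the weighted equation and the induction
    -- hypothesis, and both vanish at `1`.
    set p := (X ^ 2 - 1) ^ (n + 1) * legD l (l + (n + 1)) -
      C (((l : ℝ) - n) * (l + n + 1) * c) * legD l (l - (n + 1)) with hp
    have hd : derivative p = 0 := by
      rw [hp, derivative_sub, ← add_assoc, derivative_legD_weight, derivative_C_mul,
        derivative_legD, show l - (n + 1) + 1 = l - n by omega, h]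
      simp
      ring
    have he : p.eval 1 = 0 := by
      rw [hp, eval_sub, eval_mul, eval_mul, eval_one_legD (l := l) (j := l - (n + 1)) (by omega)]
      simp
    have hC := eq_C_of_derivative_eq_zero hd
    rw [hC, eval_C] at he
    rw [he, C_0] at hC
    exact sub_eq_zero.1 hC

/-- Green's identity for two degrees with the same order. The eigenvalue difference does not involve
`n`, and the left side is an exact derivative carrying a factor `X² - 1`. -/
theorem legD_wronskian (l l' n : ℕ) :
    derivative ((X ^ 2 - 1) * ((X ^ 2 - 1) ^ n *
        (legD l (l + n + 1) * legD l' (l' + n) - legD l (l + n) * legD l' (l' + n + 1)))) =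
      C (((l : ℝ) - l') * (l + l' + 1)) * ((X ^ 2 - 1) ^ n * (legD l (l + n) * legD l' (l' + n))) := by
  have e : (X ^ 2 - 1) * ((X ^ 2 - 1) ^ n *
        (legD l (l + n + 1) * legD l' (l' + n) - legD l (l + n) * legD l' (l' + n + 1))) =
      ((X ^ 2 - 1) ^ (n + 1) * legD l (l + n + 1)) * legD l' (l' + n) -
        ((X ^ 2 - 1) ^ (n + 1) * legD l' (l' + n + 1)) * legD l (l + n) := by ring
  rw [e, derivative_sub, derivative_mul, derivative_mul (f := (X ^ 2 - 1) ^ (n + 1) * legD l' _),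
    derivative_legD_weight, derivative_legD_weight, derivative_legD, derivative_legD]
  simp
  ring

end Legendre

/-! ### Spherical harmonics as polynomials -/

/-- `ζ ^ m` for `m ≥ 0`, and the conjugate of `ζ ^ |m|` for `m < 0`. -/
def signedPow (m : ℤ) (ζ : ℂ) : ℂ :=
  if 0 ≤ m then ζ ^ m.natAbs else (starRingEnd ℂ ζ) ^ m.natAbs

/-- The unnormalized spherical harmonic as a polynomial function. -/
def harmonicPoly (l : ℕ) (m : ℤ) (x : E3) : ℂ :=
  signedPow m (planar x) * ((legD l (l + m.natAbs)).eval (x 2) : ℝ)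

theorem continuous_signedPow (m : ℤ) : Continuous (signedPow m) := by
  unfold signedPow
  split_ifs
  · fun_prop
  · exact Complex.continuous_conj.pow _

theorem continuous_harmonicPoly (l : ℕ) (m : ℤ) : Continuous (harmonicPoly l m) := by
  have h1 := contDiff_planar.continuous
  have h2 := continuous_signedPow m
  have h3 : Continuous fun x : E3 => (legD l (l + m.natAbs)).eval (x 2) :=
    (legD l (l + m.natAbs)).continuous.comp (by fun_prop)
  unfold harmonicPoly
  fun_prop

theorem sq_norm_planar_sphere (x : S2) : ‖planar x‖ ^ 2 = 1 - (x : E3) 2 ^ 2 := by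
  have h : planar x = ⟨(x : E3) 0, (x : E3) 1⟩ := by
    apply Complex.ext <;> simp [planar]
  have h1 : ‖(x : E3)‖ ^ 2 = 1 := by simp
  rw [EuclideanSpace.norm_sq_eq, Fin.sum_univ_three] at h1
  simp only [Real.norm_eq_abs, sq_abs] at h1
  rw [h, Complex.sq_norm, Complex.normSq_mk]
  linarith

theorem norm_pow_mul_exp_arg (ζ : ℂ) (m : ℤ) :
    (‖ζ‖ : ℂ) ^ m.natAbs * Complex.exp (Complex.I * m * Complex.arg ζ) = signedPow m ζ := by
  have hζ := Complex.norm_mul_exp_arg_mul_I ζ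
  rw [signedPow]
  split_ifs with h
  · obtain ⟨n, rfl⟩ := Int.eq_ofNat_of_zero_le h
    conv_rhs => rw [← hζ]
    rw [mul_pow, ← Complex.exp_nat_mul]
    congr 2
    simp only [Int.natAbs_natCast, Int.cast_natCast]
    ring
  · obtain ⟨n, rfl⟩ : ∃ n : ℕ, m = -n := ⟨m.natAbs, by omega⟩
    conv_rhs => rw [← hζ]
    rw [map_mul, Complex.conj_ofReal, ← Complex.exp_conj, mul_pow, ← Complex.exp_nat_mul]
    congr 2
    simp only [Int.natAbs_neg, Int.natAbs_natCast, Int.cast_neg, Int.cast_natCast, map_mul,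
      Complex.conj_I, Complex.conj_ofReal]
    ring

/-- Only proportionality matters, since constants are absorbed into coefficients. For negative
orders the symmetry of the Legendre derivatives replaces order `-n` by `n` and cancels the negative
power of `1 - z²`. -/
theorem exists_sphHarmAt_eq (l : ℕ) (m : ℤ) (hm : |m| ≤ l) :
    ∃ K : ℂ, ∀ x : S2, sphHarmAt l m x = K * harmonicPoly l m x := by
  obtain ⟨K, hK⟩ : ∃ K : ℝ, ∀ x : S2, ferrers l m ((x : E3) 2) =
      K * (‖planar x‖ ^ m.natAbs * (legD l (l + m.natAbs)).eval ((x : E3) 2)) := by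
    rcases le_or_gt 0 m with h | h
    · obtain ⟨n, rfl⟩ := Int.eq_ofNat_of_zero_le h
      refine ⟨(-1) ^ n / (2 ^ l * (l.factorial : ℝ)), fun x => ?_⟩
      have e1 : (‖planar x‖ ^ 2) ^ ((n : ℝ) / 2) = ‖planar x‖ ^ n := by
        rw [← Real.rpow_natCast _ 2, ← Real.rpow_mul (norm_nonneg _), ← Real.rpow_natCast]
        congr 1
        push_cast
        ring
      rw [ferrers, ← sq_norm_planar_sphere]
      simp only [Int.natAbs_natCast, Int.cast_natCast, zpow_natCast]
      rw [e1, show ((l : ℤ) + (n : ℤ)).toNat = l + n by omega, legD]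
      ring
    · obtain ⟨n, rfl⟩ : ∃ n : ℕ, m = -n := ⟨m.natAbs, by omega⟩
      have hn : n ≤ l := by rw [abs_neg, Nat.abs_cast] at hm; exact_mod_cast hm
      -- Needed at the poles, where the power identity below reads `0 = 0 ^ n`.
      have hn0 : 0 < n := by omega
      obtain ⟨c, hc, hsymm⟩ := exists_legD_symm hn
      refine ⟨(-1) ^ (-n : ℤ) / (2 ^ l * (l.factorial : ℝ)) * (c⁻¹ * (-1) ^ n), fun x => ?_⟩
      have h2 := congrArg (Polynomial.eval ((x : E3) 2)) hsymm
      have hw : (x : E3) 2 ^ 2 - 1 = -‖planar x‖ ^ 2 := by rw [sq_norm_planar_sphere]; ring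
      simp only [Polynomial.eval_mul, Polynomial.eval_pow, Polynomial.eval_sub, Polynomial.eval_X,
        Polynomial.eval_one, Polynomial.eval_C, hw] at h2
      have h3 : (legD l (l - n)).eval ((x : E3) 2) =
          c⁻¹ * ((-‖planar x‖ ^ 2) ^ n * (legD l (l + n)).eval ((x : E3) 2)) := by
        rw [h2, ← mul_assoc, inv_mul_cancel₀ hc, one_mul]
      rw [ferrers, ← sq_norm_planar_sphere]
      rw [show ((l : ℤ) + (-(n : ℤ))).toNat = l - n by omega, ← legD, h3, Int.natAbs_neg,
        Int.natAbs_natCast, neg_pow (‖planar x‖ ^ 2) n]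
      have e1 : (‖planar x‖ ^ 2) ^ (((-n : ℤ) : ℝ) / 2) * (‖planar x‖ ^ 2) ^ n = ‖planar x‖ ^ n := by
        rcases (norm_nonneg (planar x)).eq_or_lt with h0 | h0
        · rw [← h0]
          simp [hn0.ne']
        · rw [← Real.rpow_natCast _ 2, ← Real.rpow_mul (norm_nonneg _), ← Real.rpow_natCast,
            ← Real.rpow_natCast, ← Real.rpow_mul (norm_nonneg _), ← Real.rpow_add h0]
          congr 1
          push_cast
          ring
      rw [← e1]
      ring
  refine ⟨gammaCoeff l m * K, fun x => ?_⟩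
  have hz : |(x : E3) 2| ≤ 1 := (PiLp.norm_apply_le (x : E3) 2).trans (by simp)
  have harg : (⟨(x : E3) 0, (x : E3) 1⟩ : ℂ) = planar x := by
    apply Complex.ext <;> simp [planar]
  rw [sphHarmAt, sphHarm, Real.cos_arccos (abs_le.1 hz).1 (abs_le.1 hz).2, hK, harg,
    harmonicPoly, ← norm_pow_mul_exp_arg]
  push_cast
  ring

/-! ### Orthogonality of the spherical harmonics -/

theorem integrable_sphMeasure {F : Type*} [NormedAddCommGroup F] {k : S2 → F} (hk : Continuous k) :
    Integrable k sphMeasure :=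
  hk.integrable_of_hasCompactSupport (HasCompactSupport.of_compactSpace k)

/-- The rotation by the angle `α` about the third axis. -/
def rotation (α : ℝ) : E3 ≃ₗᵢ[ℝ] E3 :=
  LinearIsometry.toLinearIsometryEquiv
    { toFun := fun x => !₂[Real.cos α * x 0 - Real.sin α * x 1,
        Real.sin α * x 0 + Real.cos α * x 1, x 2]
      map_add' := fun x y => by
        ext i
        fin_cases i <;> simp <;> ring
      map_smul' := fun c x => by
        ext i
        fin_cases i <;> simp <;> ring
      norm_map' := fun x => by
        rw [EuclideanSpace.norm_eq, EuclideanSpace.norm_eq, Fin.sum_univ_three, Fin.sum_univ_three]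
        congr 1
        simp
        nlinarith [Real.sin_sq_add_cos_sq α] } rfl

theorem rotation_apply (α : ℝ) (x : E3) :
    rotation α x = !₂[Real.cos α * x 0 - Real.sin α * x 1,
      Real.sin α * x 0 + Real.cos α * x 1, x 2] := rfl

theorem planar_rotation (α : ℝ) (x : E3) :
    planar (rotation α x) = Complex.exp (α * Complex.I) * planar x := by
  rw [Complex.exp_mul_I]
  simp only [planar, rotation_apply]
  simp
  linear_combination (-Complex.sin α * x 1 : ℂ) * Complex.I_sq

theorem signedPow_exp_mul (m : ℤ) (α : ℝ) (ζ : ℂ) :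
    signedPow m (Complex.exp (α * Complex.I) * ζ) =
      Complex.exp (m * α * Complex.I) * signedPow m ζ := by
  rw [signedPow, signedPow]
  split_ifs with h
  · obtain ⟨n, rfl⟩ := Int.eq_ofNat_of_zero_le h
    rw [mul_pow, ← Complex.exp_nat_mul]
    congr 2
    simp only [Int.natAbs_natCast, Int.cast_natCast]
    ring
  · obtain ⟨n, rfl⟩ : ∃ n : ℕ, m = -n := ⟨m.natAbs, by omega⟩
    rw [map_mul, mul_pow, ← Complex.exp_conj, ← Complex.exp_nat_mul]
    congr 2
    simp only [Int.natAbs_neg, Int.natAbs_natCast, Int.cast_neg, Int.cast_natCast, map_mul,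
      Complex.conj_I, Complex.conj_ofReal]
    ring

theorem harmonicPoly_rotation (l : ℕ) (m : ℤ) (α : ℝ) (x : E3) :
    harmonicPoly l m (rotation α x) = Complex.exp (m * α * Complex.I) * harmonicPoly l m x := by
  have h2 : rotation α x 2 = x 2 := by simp [rotation_apply]
  rw [harmonicPoly, harmonicPoly, planar_rotation, signedPow_exp_mul, h2, mul_assoc]

/-- Rotation by `π / (m - m')` changes the sign of the integrand but preserves the surface measure.
-/
theorem integral_harmonicPoly_of_order_ne {l l' : ℕ} {m m' : ℤ} (h : m ≠ m') :
    ∫ y : S2, harmonicPoly l m y * starRingEnd ℂ (harmonicPoly l' m' y) ∂sphMeasure = 0 := by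
  have hc : Continuous fun x : E3 => harmonicPoly l m x * starRingEnd ℂ (harmonicPoly l' m' x) :=
    (continuous_harmonicPoly l m).mul (Complex.continuous_conj.comp (continuous_harmonicPoly l' m'))
  set α : ℝ := Real.pi / (m - m')
  have hmm : (m : ℝ) - m' ≠ 0 := sub_ne_zero.2 (by exact_mod_cast h)
  have h1 := sphere_integral_comp_isometry
    (hc.comp continuous_subtype_val) hc.stronglyMeasurable (rotation α)
  have h2 : ∀ y : S2, harmonicPoly l m (rotation α y) *
      starRingEnd ℂ (harmonicPoly l' m' (rotation α y)) =
      -(harmonicPoly l m y * starRingEnd ℂ (harmonicPoly l' m' y)) := by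
    intro y
    rw [harmonicPoly_rotation, harmonicPoly_rotation, map_mul, ← Complex.exp_conj]
    have h3 : Complex.exp (m * α * Complex.I) *
        Complex.exp (starRingEnd ℂ (m' * α * Complex.I)) = -1 := by
      rw [← Complex.exp_add, ← Complex.exp_pi_mul_I]
      congr 1
      have h4 : ((m : ℝ) - m') * α = Real.pi := by
        simp only [α]; field_simp
      have h5 : ((m : ℂ) - m') * α = Real.pi := by exact_mod_cast congrArg (fun t : ℝ => (t : ℂ)) h4
      simp only [map_mul, Complex.conj_I, Complex.conj_ofReal, map_intCast]
      linear_combination Complex.I * h5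
    linear_combination (harmonicPoly l m y * starRingEnd ℂ (harmonicPoly l' m' y)) * h3
  simp only [h2, integral_neg] at h1
  linear_combination (-1 / 2 : ℂ) * h1

/-- The integral of a polynomial in the height over the sphere. -/
def heightIntegral (p : Polynomial ℝ) : ℝ := ∫ y : S2, p.eval ((y : E3) 2) ∂sphMeasure

theorem continuous_eval_height (p : Polynomial ℝ) : Continuous fun y : S2 => p.eval ((y : E3) 2) :=
  p.continuous.comp (by fun_prop)

theorem heightIntegral_add (p q : Polynomial ℝ) :
    heightIntegral (p + q) = heightIntegral p + heightIntegral q := by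
  simp only [heightIntegral, Polynomial.eval_add]
  exact integral_add (integrable_sphMeasure (continuous_eval_height p))
    (integrable_sphMeasure (continuous_eval_height q))

theorem heightIntegral_C_mul (c : ℝ) (p : Polynomial ℝ) :
    heightIntegral (Polynomial.C c * p) = c * heightIntegral p := by
  simp only [heightIntegral, Polynomial.eval_mul, Polynomial.eval_C]
  exact integral_const_mul _ _

theorem heightIntegral_X : heightIntegral Polynomial.X = 0 := by
  have hc : Continuous fun x : E3 => x 2 := by fun_prop
  have h := sphere_integral_comp_isometry (hc.comp continuous_subtype_val) hc.stronglyMeasurable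
    (LinearIsometryEquiv.neg ℝ)
  simp only [heightIntegral, Polynomial.eval_X]
  simp only [LinearIsometryEquiv.coe_neg, PiLp.neg_apply, integral_neg] at h
  linarith

theorem setIntegral_radial_mul_height {b : ℝ → ℝ} (hb : Continuous b) (j : ℕ) :
    ∫ x in B1, b ‖x‖ * x 2 ^ j =
      (∫ r in (0 : ℝ)..1, r ^ (j + 2) * b r) * heightIntegral (Polynomial.X ^ j) := by
  have hint : IntegrableOn (fun x : E3 => b ‖x‖ * x 2 ^ j) B1 :=
    (memLp_muB_of_continuous (by fun_prop)).integrable (by norm_num)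
  rw [setIntegral_ball_polar zero_le_one hint, ← intervalIntegral.integral_mul_const]
  refine intervalIntegral.integral_congr_ae (ae_of_all _ fun r hr => ?_)
  rw [Set.uIoc_of_le zero_le_one] at hr
  have h2 : ∀ y : S2, ‖r • (y : E3)‖ = r := fun y => by simp [norm_smul, abs_of_pos hr.1]
  simp only [h2, heightIntegral, Polynomial.eval_pow, Polynomial.eval_X, PiLp.smul_apply,
    smul_eq_mul, mul_pow]
  rw [← integral_const_mul, ← integral_const_mul]
  refine integral_congr_ae (ae_of_all _ fun y => ?_)
  simp only
  ring

/-- The moment recursion of the height function on the sphere. -/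
theorem heightIntegral_recursion (k : ℕ) :
    (k + 1) * heightIntegral (Polynomial.X ^ k) =
      (k + 3) * heightIntegral (Polynomial.X ^ (k + 2)) := by
  -- Integrate the third partial derivative of `x₃^(k+1)` against the radial cutoff `a(|x|)`. The
  -- cutoff has third partial derivative `c(|x|) x₃`, so both sides split into a radial integral
  -- times a moment of the height.
  let σ := Real.smoothTransition
  let a : ℝ → ℝ := fun r => σ (-2 * r ^ 2 + (2 - 1))
  let c : ℝ → ℝ := fun r => -4 * deriv σ (-2 * r ^ 2 + (2 - 1))
  have ha : ∀ r, HasDerivAt a (r * c r) r := by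
    intro r
    have h1 : HasDerivAt (fun s : ℝ => s ^ 2) (2 * r) r := by simpa using hasDerivAt_pow 2 r
    refine ((hasDerivAt_smoothTransition_affine (-2) (2 - 1) (r ^ 2)).comp r h1).congr_deriv ?_
    simp only [c, σ]
    ring
  have hac : Continuous a := Real.smoothTransition.continuous.comp (by fun_prop)
  have hcc : Continuous c := continuous_const.mul
    (continuous_deriv_smoothTransition.comp (by fun_prop))
  set I := ∫ r in (0 : ℝ)..1, r ^ (k + 2) * a r with hI
  have hIpos : 0 < I := by
    refine intervalIntegral.integral_pos zero_lt_one
      (Continuous.continuousOn (by fun_prop)) (fun r hr => ?_) ⟨1 / 2, by norm_num, ?_⟩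
    · exact mul_nonneg (pow_nonneg hr.1.le _) (Real.smoothTransition.nonneg _)
    · exact mul_pos (by positivity) (Real.smoothTransition.pos_of_pos (by norm_num))
  -- Integration by parts in `r` expresses the second radial integral through `I`, and the positive
  -- factor `I` cancels at the end.
  have hparts : ∫ r in (0 : ℝ)..1, r ^ (k + 2 + 2) * c r = -((k + 3) * I) := by
    have h := intervalIntegral.integral_mul_deriv_eq_deriv_mul (a := 0) (b := 1)
      (u := fun r : ℝ => r ^ (k + 3)) (u' := fun r => ((k + 3 : ℕ) : ℝ) * r ^ (k + 2))
      (v := a) (v' := fun r => r * c r)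
      (fun r _ => hasDerivAt_pow (k + 3) r) (fun r _ => ha r)
      (Continuous.intervalIntegrable (by fun_prop) _ _)
      (Continuous.intervalIntegrable (by fun_prop) _ _)
    have ha1 : a 1 = 0 := Real.smoothTransition.zero_of_nonpos (by norm_num)
    have e1 : ∀ r : ℝ, r ^ (k + 2 + 2) * c r = r ^ (k + 3) * (r * c r) := fun r => by ring
    simp only [e1]
    rw [h, ha1, hI, ← intervalIntegral.integral_const_mul]
    simp only [mul_zero, zero_pow (Nat.succ_ne_zero _), zero_mul, sub_zero, zero_sub]
    congr 1
    refine intervalIntegral.integral_congr fun r _ => ?_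
    push_cast
    ring
  let f : E3 → ℂ := fun x => (x 2 : ℂ) ^ (k + 1)
  have hf : ContDiff ℝ 1 f := ((contDiff_coord 2).of_le (by simp)).pow (k + 1)
  have hdf : ∀ x, partialDeriv 2 f x = ((k + 1 : ℕ) : ℂ) * (x 2 : ℂ) ^ k := by
    intro x
    have hc : HasFDerivAt (fun y : E3 => (y 2 : ℂ))
        (Complex.ofRealCLM.comp (EuclideanSpace.proj (𝕜 := ℝ) 2)) x :=
      (Complex.ofRealCLM.comp (EuclideanSpace.proj (𝕜 := ℝ) 2)).hasFDerivAt
    have h : HasFDerivAt f _ x := hc.pow (k + 1)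
    rw [partialDeriv, h.fderiv]
    simp
  have htest : IsTestFunction (ballCutoff 2) := by
    have h := isTestFunction_ballCutoff_mul (v := fun _ => 1) contDiff_const one_le_two
    simpa using h
  have hmain := setIntegral_mul_partialDeriv hf htest 2
  have e1 : ∫ x in B1, f x * partialDeriv 2 (ballCutoff 2) x =
      ((∫ x in B1, c ‖x‖ * x 2 ^ (k + 2) : ℝ) : ℂ) := by
    rw [← integral_complex_ofReal]
    refine integral_congr_ae (ae_of_all _ fun x => ?_)
    simp only [f, c, σ]
    rw [partialDeriv_ballCutoff]
    push_cast
    ring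
  have e2 : ∫ x in B1, partialDeriv 2 f x * ballCutoff 2 x =
      (((k + 1) * ∫ x in B1, a ‖x‖ * x 2 ^ k : ℝ) : ℂ) := by
    rw [← integral_const_mul, ← integral_complex_ofReal]
    refine integral_congr_ae (ae_of_all _ fun x => ?_)
    simp only [hdf, ballCutoff, a, σ]
    push_cast
    ring
  rw [e1, e2, ← Complex.ofReal_neg] at hmain
  have h2 := Complex.ofReal_injective hmain
  rw [setIntegral_radial_mul_height hcc, setIntegral_radial_mul_height hac, hparts, ← hI] at h2
  refine mul_left_cancel₀ hIpos.ne' ?_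
  linear_combination h2

/-- On monomials `X^k` with `k ≥ 1` this is the moment recursion; for `k = 0` the derivative is `2
X`, which is odd. -/
theorem heightIntegral_derivative_weight (q : Polynomial ℝ) :
    heightIntegral (Polynomial.derivative ((Polynomial.X ^ 2 - 1) * q)) = 0 := by
  induction q using Polynomial.induction_on' with
  | add p q hp hq => rw [mul_add, Polynomial.derivative_add, heightIntegral_add, hp, hq, add_zero]
  | monomial k c =>
    have hmono : (Polynomial.X ^ 2 - 1) * Polynomial.monomial k c =
        Polynomial.C c * (Polynomial.X ^ (k + 2) - Polynomial.X ^ k) := by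
      rw [← Polynomial.C_mul_X_pow_eq_monomial]; ring
    rw [hmono, Polynomial.derivative_C_mul, heightIntegral_C_mul, Polynomial.derivative_sub,
      Polynomial.derivative_X_pow, Polynomial.derivative_X_pow, sub_eq_add_neg,
      heightIntegral_add, heightIntegral_C_mul]
    have hneg : -(Polynomial.C (k : ℝ) * Polynomial.X ^ (k - 1) : Polynomial ℝ) =
        Polynomial.C (-(k : ℝ)) * Polynomial.X ^ (k - 1) := by simp
    rw [hneg, heightIntegral_C_mul]
    rcases k with _ | k
    · simp [heightIntegral_X]
    · have h := heightIntegral_recursion k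
      simp only [Nat.add_sub_cancel, show k + 1 + 2 - 1 = k + 2 by omega]
      push_cast
      linear_combination (-c) * h

/-- On the sphere the product depends only on the height and is, up to sign, the weighted Legendre
product. By the Wronskian identity a nonzero multiple of that is an exact derivative with integral
zero. -/
theorem integral_harmonicPoly_of_degree_ne {l l' : ℕ} (m : ℤ) (h : l ≠ l') :
    ∫ y : S2, harmonicPoly l m y * starRingEnd ℂ (harmonicPoly l' m y) ∂sphMeasure = 0 := by
  set n := m.natAbs with hn
  have hne : ((l : ℝ) - l') * (l + l' + 1) ≠ 0 :=
    mul_ne_zero (sub_ne_zero.2 (by exact_mod_cast h)) (by positivity)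
  have h1 := heightIntegral_derivative_weight ((Polynomial.X ^ 2 - 1) ^ n *
    (legD l (l + n + 1) * legD l' (l' + n) - legD l (l + n) * legD l' (l' + n + 1)))
  rw [legD_wronskian, heightIntegral_C_mul] at h1
  have h2 := (mul_eq_zero.1 h1).resolve_left hne
  have h3 : ∀ y : S2, harmonicPoly l m y * starRingEnd ℂ (harmonicPoly l' m y) =
      (((-1) ^ n * ((Polynomial.X ^ 2 - 1) ^ n * (legD l (l + n) * legD l' (l' + n))).eval
        ((y : E3) 2) : ℝ) : ℂ) := by
    intro y
    have hs : signedPow m (planar y) * starRingEnd ℂ (signedPow m (planar y)) =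
        ((((-1) ^ n * ((y : E3) 2 ^ 2 - 1) ^ n : ℝ)) : ℂ) := by
      have e : ‖signedPow m (planar y)‖ = ‖planar y‖ ^ n := by
        rw [signedPow]; split_ifs <;> simp [hn]
      rw [Complex.mul_conj', e, ← mul_pow, ← Complex.ofReal_pow, ← pow_mul,
        mul_comm n 2, pow_mul, sq_norm_planar_sphere]
      congr 2
      ring
    simp only [harmonicPoly, map_mul, Complex.conj_ofReal, Polynomial.eval_mul, Polynomial.eval_pow,
      Polynomial.eval_sub, Polynomial.eval_X, Polynomial.eval_one]
    rw [mul_mul_mul_comm, hs]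
    push_cast
    ring
  simp only [h3]
  rw [integral_complex_ofReal, integral_const_mul]
  rw [heightIntegral] at h2
  rw [h2]
  simp

/-- Orthogonality of the spherical harmonics. -/
theorem integral_harmonicPoly_mul_conj {i j : ℕ × ℤ} (h : i ≠ j) :
    ∫ y : S2, harmonicPoly i.1 i.2 y * starRingEnd ℂ (harmonicPoly j.1 j.2 y) ∂sphMeasure = 0 := by
  by_cases hm : i.2 = j.2
  · rw [hm]
    exact integral_harmonicPoly_of_degree_ne _ fun hl => h (Prod.ext hl hm)
  · exact integral_harmonicPoly_of_order_ne hm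

/-! ### Lower bound of the boundary norm on `𝓑` -/

/-- The entire function that agrees with `sphBessel l` on the positive half-line. -/
def sphBesselExt (l : ℕ) (r : ℝ) : ℝ :=
  √Real.pi / 2 * (r / 2) ^ l * besselSeries l (r ^ 2)

theorem continuous_sphBesselExt (l : ℕ) : Continuous (sphBesselExt l) := by
  have h := continuous_besselSeries l
  unfold sphBesselExt
  fun_prop

/-! ### Finite sums of spherical waves and their norms on spheres -/

/-- The finite linear combination of spherical waves with coefficients `c`. -/
def waveSum (κ : ℝ) (c : ℕ × ℤ →₀ ℂ) (x : E3) : ℂ :=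
  ∑ i ∈ c.support, c i * sphBesselExt i.1 (κ * ‖x‖) * harmonicPoly i.1 i.2 (‖x‖⁻¹ • x)

theorem waveSum_eq_sum (κ : ℝ) (c : ℕ × ℤ →₀ ℂ) (x : E3) :
    waveSum κ c x =
      c.sum fun i a => a * sphBesselExt i.1 (κ * ‖x‖) * harmonicPoly i.1 i.2 (‖x‖⁻¹ • x) := rfl

theorem waveSum_add (κ : ℝ) (c d : ℕ × ℤ →₀ ℂ) : waveSum κ (c + d) = waveSum κ c + waveSum κ d := by
  ext x
  simp only [Pi.add_apply, waveSum_eq_sum]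
  exact Finsupp.sum_add_index' (by simp) fun i a b => by ring

theorem waveSum_smul (κ : ℝ) (a : ℂ) (c : ℕ × ℤ →₀ ℂ) : waveSum κ (a • c) = a • waveSum κ c := by
  ext x
  simp only [Pi.smul_apply, waveSum_eq_sum]
  rw [Finsupp.sum_smul_index' (by simp), Finsupp.smul_sum]
  simp only [smul_eq_mul, mul_assoc]

theorem waveSum_smul_sphere (κ : ℝ) (c : ℕ × ℤ →₀ ℂ) {r : ℝ} (hr : 0 < r) (y : S2) :
    waveSum κ c (r • (y : E3)) =
      ∑ i ∈ c.support, c i * sphBesselExt i.1 (κ * r) * harmonicPoly i.1 i.2 y := by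
  have h1 : ‖r • (y : E3)‖ = r := by rw [norm_smul]; simp [hr.le]
  rw [waveSum, h1, inv_smul_smul₀ hr.ne']

theorem measurable_waveSum (κ : ℝ) (c : ℕ × ℤ →₀ ℂ) : Measurable (waveSum κ c) := by
  refine Finset.measurable_sum _ fun i _ => ?_
  refine Measurable.mul ?_ ?_
  · have h := continuous_sphBesselExt i.1
    exact Continuous.measurable (by fun_prop)
  · exact (continuous_harmonicPoly i.1 i.2).measurable.comp
      (measurable_norm.inv.smul measurable_id)

theorem exists_bound_waveSum (κ : ℝ) (c : ℕ × ℤ →₀ ℂ) :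
    ∃ C, ∀ x ∈ B1, ‖waveSum κ c x‖ ≤ C := by
  have h1 : ∀ l : ℕ, ∃ C, ∀ r ∈ Set.Icc (0 : ℝ) 1, ‖sphBesselExt l (κ * r)‖ ≤ C := fun l =>
    isCompact_Icc.exists_bound_of_continuousOn
      ((continuous_sphBesselExt l).comp (continuous_const.mul continuous_id)).continuousOn
  have h2 : ∀ i : ℕ × ℤ, ∃ C, ∀ x ∈ Metric.closedBall (0 : E3) 1, ‖harmonicPoly i.1 i.2 x‖ ≤ C :=
    fun i => (isCompact_closedBall 0 1).exists_bound_of_continuousOn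
      (continuous_harmonicPoly i.1 i.2).continuousOn
  choose M hM using h1
  choose K hK using h2
  refine ⟨∑ i ∈ c.support, ‖c i‖ * M i.1 * K i, fun x hx => ?_⟩
  refine (norm_sum_le _ _).trans (Finset.sum_le_sum fun i _ => ?_)
  have hx1 : ‖x‖ < 1 := by simpa using hx
  have e1 := hM i.1 ‖x‖ ⟨norm_nonneg x, hx1.le⟩
  have e2 : ‖harmonicPoly i.1 i.2 (‖x‖⁻¹ • x)‖ ≤ K i := by
    refine hK i _ ?_
    rw [mem_closedBall_zero_iff, norm_smul, norm_inv, norm_norm]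
    exact inv_mul_le_one
  rw [norm_mul, norm_mul, Complex.norm_real]
  have := (norm_nonneg _).trans e1
  gcongr

theorem memLp_waveSum (κ : ℝ) (c : ℕ × ℤ →₀ ℂ) : MemLp (waveSum κ c) 2 muB := by
  obtain ⟨C, hC⟩ := exists_bound_waveSum κ c
  have := isFiniteMeasure_muB
  exact MemLp.of_bound (measurable_waveSum κ c).aestronglyMeasurable C
    ((ae_restrict_iff' measurableSet_ball).2 (ae_of_all _ hC))

/-- The origin is excluded because there `‖x‖⁻¹ • x` is `0`, which is not a point of the sphere, and
the two angular formulas need not agree. -/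
theorem exists_waveSum_eq {κ : ℝ} (hκ : 0 < κ) {v : E3 → ℂ} (hv : v ∈ sphWaveSpan κ) :
    ∃ c, ∀ x ≠ 0, v x = waveSum κ c x := by
  refine Submodule.span_induction ?_ ⟨0, by simp [waveSum]⟩ ?_ ?_ hv
  · rintro _ ⟨l, m, hm, rfl⟩
    obtain ⟨K, hK⟩ := exists_sphHarmAt_eq l m hm
    refine ⟨Finsupp.single (l, m) (((bNorm κ (sphWaveTilde κ l m))⁻¹ : ℝ) * K), fun x hx => ?_⟩
    have hx' : 0 < ‖x‖ := norm_pos_iff.2 hx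
    rw [waveSum_eq_sum, Finsupp.sum_single_index (by simp), sphWave, sphWaveTilde,
      sphBessel_eq l (mul_pos hκ hx')]
    have h := hK ⟨‖x‖⁻¹ • x, by simp [norm_smul, hx'.ne']⟩
    simp only at h
    rw [h]
    simp only [sphBesselExt]
    ring
  · rintro u v _ _ ⟨c, hc⟩ ⟨d, hd⟩
    exact ⟨c + d, fun x hx => by rw [waveSum_add, Pi.add_apply, Pi.add_apply, hc x hx, hd x hx]⟩
  · rintro a u _ ⟨c, hc⟩
    exact ⟨a • c, fun x hx => by rw [waveSum_smul, Pi.smul_apply, Pi.smul_apply, hc x hx]⟩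

theorem exists_waveSum_ae_eq {κ : ℝ} (hκ : 0 < κ) {v : E3 → ℂ} (hv : v ∈ sphWaveSpan κ) :
    ∃ c, v =ᵐ[muB] waveSum κ c := by
  obtain ⟨c, hc⟩ := exists_waveSum_eq hκ hv
  refine ⟨c, ae_restrict_of_ae ?_⟩
  filter_upwards [Measure.ae_ne volume (0 : E3)] with x hx using hc x hx

/-- Parseval: in the expanded double sum only the diagonal survives orthogonality. -/
theorem integral_sq_norm_sum_harmonicPoly (s : Finset (ℕ × ℤ)) (a : ℕ × ℤ → ℂ) :
    ∫ y : S2, ‖∑ i ∈ s, a i * harmonicPoly i.1 i.2 y‖ ^ 2 ∂sphMeasure =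
      ∑ i ∈ s, ‖a i‖ ^ 2 * ∫ y : S2, ‖harmonicPoly i.1 i.2 y‖ ^ 2 ∂sphMeasure := by
  have hc : ∀ i : ℕ × ℤ, Continuous fun y : S2 => harmonicPoly i.1 i.2 (y : E3) := fun i =>
    (continuous_harmonicPoly i.1 i.2).comp continuous_subtype_val
  have hcc : ∀ i j : ℕ × ℤ, Continuous fun y : S2 => a i * starRingEnd ℂ (a j) *
      (harmonicPoly i.1 i.2 (y : E3) * starRingEnd ℂ (harmonicPoly j.1 j.2 (y : E3))) := by
    intro i j
    have h1 := hc i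
    have h2 := hc j
    exact continuous_const.mul (h1.mul (Complex.continuous_conj.comp h2))
  refine Complex.ofReal_injective ?_
  rw [← integral_complex_ofReal]
  have e : ∀ y : S2, ((‖∑ i ∈ s, a i * harmonicPoly i.1 i.2 y‖ ^ 2 : ℝ) : ℂ) =
      ∑ i ∈ s, ∑ j ∈ s, a i * starRingEnd ℂ (a j) *
        (harmonicPoly i.1 i.2 y * starRingEnd ℂ (harmonicPoly j.1 j.2 y)) := by
    intro y
    rw [Complex.ofReal_pow, ← Complex.mul_conj', map_sum, Finset.sum_mul_sum]
    refine Finset.sum_congr rfl fun i _ => Finset.sum_congr rfl fun j _ => ?_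
    rw [map_mul]
    ring
  simp only [e]
  rw [integral_finsetSum _ fun i _ => integrable_sphMeasure (continuous_finsetSum _ fun j _ => hcc i j)]
  rw [Complex.ofReal_sum]
  refine Finset.sum_congr rfl fun i hi => ?_
  rw [integral_finsetSum _ fun j _ => integrable_sphMeasure (hcc i j),
    Finset.sum_eq_single_of_mem i hi]
  · rw [integral_const_mul, Complex.ofReal_mul, ← integral_complex_ofReal, Complex.mul_conj',
      Complex.ofReal_pow]
    congr 1
    refine integral_congr_ae (ae_of_all _ fun y => ?_)
    simp only
    rw [Complex.mul_conj', Complex.ofReal_pow]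
  · intro j _ hj
    rw [integral_const_mul, integral_harmonicPoly_mul_conj (Ne.symm hj), mul_zero]

/-- The squared `L²`-norm of a linear combination of waves on the sphere of radius `r`. -/
def waveSphereNorm (κ : ℝ) (c : ℕ × ℤ →₀ ℂ) (r : ℝ) : ℝ :=
  ∑ i ∈ c.support, ‖c i * sphBesselExt i.1 (κ * r)‖ ^ 2 *
    ∫ y : S2, ‖harmonicPoly i.1 i.2 y‖ ^ 2 ∂sphMeasure

theorem continuous_waveSphereNorm (κ : ℝ) (c : ℕ × ℤ →₀ ℂ) : Continuous (waveSphereNorm κ c) := by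
  refine continuous_finsetSum _ fun i _ => ?_
  have h := continuous_sphBesselExt i.1
  fun_prop

theorem integral_sq_norm_waveSum (κ : ℝ) (c : ℕ × ℤ →₀ ℂ) {r : ℝ} (hr : 0 < r) :
    ∫ y : S2, ‖waveSum κ c (r • (y : E3))‖ ^ 2 ∂sphMeasure = waveSphereNorm κ c r := by
  simp only [waveSum_smul_sphere κ c hr]
  exact integral_sq_norm_sum_harmonicPoly _ _

theorem sq_smul_waveSphereNorm (κ : ℝ) (c : ℕ × ℤ →₀ ℂ) {r : ℝ} (hr : 0 ≤ r) :
    r ^ 2 • ∫ y : S2, ‖waveSum κ c (r • (y : E3))‖ ^ 2 ∂sphMeasure =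
      r ^ 2 * waveSphereNorm κ c r := by
  rcases hr.eq_or_lt with rfl | hr
  · simp
  · rw [integral_sq_norm_waveSum κ c hr, smul_eq_mul]

/-- Orthogonality has removed the cross terms, so the Bessel comparison applies term by term with a
constant independent of the sum. -/
theorem exists_waveSphereNorm_le {κ : ℝ} (hκ : 0 < κ) (h : ∀ l, besselSeries l (κ ^ 2) ≠ 0) :
    ∃ C ≥ 0, ∃ τ > 0, ∀ (c : ℕ × ℤ →₀ ℂ) (r s : ℝ), 0 < r → r ≤ s → 1 - τ ≤ s → s ≤ 1 →
      waveSphereNorm κ c r ≤ C * waveSphereNorm κ c s := by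
  obtain ⟨C, hC, τ, hτ, hb⟩ := exists_sphBessel_ratio hκ h
  refine ⟨C, hC, τ, hτ, fun c r s hr hrs hs hs1 => ?_⟩
  rw [waveSphereNorm, waveSphereNorm, Finset.mul_sum]
  refine Finset.sum_le_sum fun i _ => ?_
  rw [← mul_assoc]
  refine mul_le_mul_of_nonneg_right ?_ (integral_nonneg fun _ => by positivity)
  have h1 := hb i.1 r s hr hrs hs hs1
  rw [sphBessel_eq _ (mul_pos hκ hr), sphBessel_eq _ (mul_pos hκ (hr.trans_le hrs))] at h1
  rw [norm_mul, norm_mul, mul_pow, mul_pow, Complex.norm_real, Complex.norm_real,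
    Real.norm_eq_abs, Real.norm_eq_abs, sq_abs, sq_abs]
  have h2 := mul_le_mul_of_nonneg_left h1 (sq_nonneg ‖c i‖)
  simp only [sphBesselExt]
  linarith

theorem shell_subset (a : ℝ) : shell a ⊆ B1 := fun x hx => by
  simpa using hx.2

theorem memLp_restrict_of_subset {f : E3 → ℂ} {s : Set E3} (hs : s ⊆ B1) (hf : MemLp f 2 muB) :
    MemLp f 2 (volume.restrict s) :=
  hf.mono_measure (Measure.restrict_mono hs le_rfl)

theorem l2On_restrict_le {f : E3 → ℂ} {s : Set E3} (hs : s ⊆ B1) (hf : MemLp f 2 muB) :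
    l2On (volume.restrict s) f ≤ l2On muB f :=
  Real.sqrt_le_sqrt (integral_mono_measure (Measure.restrict_mono hs le_rfl)
    (ae_of_all _ fun _ => by positivity) (hf.integrable_norm_pow two_ne_zero))

/-- Integrate the comparison of spheres twice: over `r` in `[0, a]` with weight `r²`, whose total
mass is at most `1`, and over `s` in `[a, 1]` with weight `s²`. Unlike a bound by the sphere itself,
the result involves `L²` norms on sets of positive volume and so passes to limits. -/
theorem sq_l2On_waveSum_le {κ C τ : ℝ} {c : ℕ × ℤ →₀ ℂ}
    (hb : ∀ r s : ℝ, 0 < r → r ≤ s → 1 - τ ≤ s → s ≤ 1 →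
      waveSphereNorm κ c r ≤ C * waveSphereNorm κ c s)
    {a : ℝ} (ha : 0 ≤ a) (ha1 : a ≤ 1) (haτ : 1 - τ ≤ a) :
    l2On (volume.restrict (Metric.ball 0 a)) (waveSum κ c) ^ 2 * ∫ s in a..1, s ^ 2 ≤
      C * l2On (volume.restrict (shell a)) (waveSum κ c) ^ 2 := by
  have hint : ∀ s ⊆ B1, IntegrableOn (fun x => ‖waveSum κ c x‖ ^ 2) s := fun s hs =>
    (memLp_restrict_of_subset hs (memLp_waveSum κ c)).integrable_norm_pow two_ne_zero
  have hcont := continuous_waveSphereNorm κ c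
  rw [sq_l2On, sq_l2On, setIntegral_ball_polar ha (hint _ (Metric.ball_subset_ball ha1)),
    setIntegral_shell_polar ha ha1 (hint _ (shell_subset a))]
  have e1 : ∫ r in (0 : ℝ)..a, r ^ 2 • ∫ y : S2, ‖waveSum κ c (r • (y : E3))‖ ^ 2 ∂sphMeasure =
      ∫ r in (0 : ℝ)..a, r ^ 2 * waveSphereNorm κ c r := by
    refine intervalIntegral.integral_congr fun r hr => ?_
    rw [Set.uIcc_of_le ha] at hr
    exact sq_smul_waveSphereNorm κ c hr.1
  have e2 : ∫ r in a..1, r ^ 2 • ∫ y : S2, ‖waveSum κ c (r • (y : E3))‖ ^ 2 ∂sphMeasure =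
      ∫ r in a..1, r ^ 2 * waveSphereNorm κ c r := by
    refine intervalIntegral.integral_congr fun r hr => ?_
    rw [Set.uIcc_of_le ha1] at hr
    exact sq_smul_waveSphereNorm κ c (ha.trans hr.1)
  rw [e1, e2, ← intervalIntegral.integral_const_mul, ← intervalIntegral.integral_const_mul]
  refine intervalIntegral.integral_mono_on ha1 (Continuous.intervalIntegrable (by fun_prop) _ _)
    (Continuous.intervalIntegrable (by fun_prop) _ _) fun s hs => ?_
  have hnn : ∀ r, 0 ≤ waveSphereNorm κ c r := fun r => Finset.sum_nonneg fun i _ =>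
    mul_nonneg (by positivity) (integral_nonneg fun _ => by positivity)
  have h1 : ∀ r ∈ Set.Icc 0 a, r ^ 2 * waveSphereNorm κ c r ≤ r ^ 2 * (C * waveSphereNorm κ c s) := by
    intro r hr
    rcases hr.1.eq_or_lt with rfl | h0
    · simp
    · exact mul_le_mul_of_nonneg_left (hb r s h0 (hr.2.trans hs.1) (haτ.trans hs.1) hs.2)
        (sq_nonneg r)
  have h2 := intervalIntegral.integral_mono_on ha
    (f := fun r => r ^ 2 * waveSphereNorm κ c r)
    (g := fun r => r ^ 2 * (C * waveSphereNorm κ c s)) (μ := volume)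
    (Continuous.intervalIntegrable (by fun_prop) _ _)
    (Continuous.intervalIntegrable (by fun_prop) _ _) h1
  rw [intervalIntegral.integral_mul_const, integral_pow] at h2
  rcases ha.eq_or_lt with h0 | h0
  · simp only [← h0, intervalIntegral.integral_same, zero_mul]
    rcases hs.1.eq_or_lt with h3 | h3
    · rw [← h3, ← h0]; simp
    · have := hb s s (ha.trans_lt h3) le_rfl (haτ.trans hs.1) hs.2
      have h4 := (hnn s).trans this
      nlinarith [sq_nonneg s]
  · have h4 := (hnn s).trans (hb s s (h0.trans_le hs.1) le_rfl (haτ.trans hs.1) hs.2)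
    have h5 : a ^ 3 ≤ 1 := pow_le_one₀ ha ha1
    have h6 : (∫ r in (0 : ℝ)..a, r ^ 2 * waveSphereNorm κ c r) ≤ C * waveSphereNorm κ c s := by
      refine h2.trans (mul_le_of_le_one_left h4 ?_)
      push_cast
      rw [div_le_one (by norm_num)]
      norm_num
      linarith
    calc _ ≤ (C * waveSphereNorm κ c s) * s ^ 2 := mul_le_mul_of_nonneg_right h6 (sq_nonneg s)
      _ = _ := by ring

/-- The closure in `L²(B₁)` of the span of the spherical waves. -/
def waveClosure (κ : ℝ) (hκ : 0 < κ) : Submodule ℂ (E3 → ℂ) where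
  carrier := {u | MemLp u 2 muB ∧ ∀ ε > 0, ∃ v ∈ sphWaveSpan κ, l2On muB (u - v) < ε}
  add_mem' := by
    rintro u u' ⟨hu, h⟩ ⟨hu', h'⟩
    refine ⟨hu.add hu', fun ε hε => ?_⟩
    obtain ⟨v, hv, hv'⟩ := h (ε / 2) (half_pos hε)
    obtain ⟨w, hw, hw'⟩ := h' (ε / 2) (half_pos hε)
    obtain ⟨c, hc⟩ := exists_waveSum_ae_eq hκ hv
    obtain ⟨d, hd⟩ := exists_waveSum_ae_eq hκ hw
    refine ⟨v + w, add_mem hv hw, ?_⟩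
    rw [add_sub_add_comm]
    have := l2On_add_le (hu.sub ((memLp_waveSum κ c).ae_eq hc.symm))
      (hu'.sub ((memLp_waveSum κ d).ae_eq hd.symm))
    linarith
  zero_mem' := ⟨MemLp.zero, fun ε hε => ⟨0, zero_mem _, by simpa [l2On] using hε⟩⟩
  smul_mem' := by
    rintro a u ⟨hu, h⟩
    refine ⟨hu.const_smul a, fun ε hε => ?_⟩
    have ha : 0 < ‖a‖ + 1 := by positivity
    obtain ⟨v, hv, hv'⟩ := h (ε / (‖a‖ + 1)) (div_pos hε ha)
    refine ⟨a • v, Submodule.smul_mem _ _ hv, ?_⟩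
    rw [← smul_sub, l2On_smul]
    have := (lt_div_iff₀ ha).1 hv'
    nlinarith [l2On_nonneg (μ := muB) (u - v)]

/-- The lower bound uses values only, so the gradient part of the approximation may be dropped. -/
theorem MemB.mem_waveClosure {κ : ℝ} (hκ : 0 < κ) {u : E3 → ℂ} (hu : MemB κ u) :
    u ∈ waveClosure κ hκ := by
  refine ⟨hu.1.1, fun ε hε => ?_⟩
  obtain ⟨v, hv, h⟩ := hu.2 ε hε
  exact ⟨v, hv, (l2On_le_bNorm κ _).trans_lt h⟩

theorem l2On_congr {μ : Measure E3} {f g : E3 → ℂ} (h : f =ᵐ[μ] g) : l2On μ f = l2On μ g := by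
  rw [l2On, l2On]
  congr 1
  refine integral_congr_ae ?_
  filter_upwards [h] with x hx
  rw [hx]

theorem exists_sq_l2On_ball_le {κ : ℝ} (hκ : 0 < κ) (h : ∀ l, besselSeries l (κ ^ 2) ≠ 0) :
    ∃ C ≥ 0, ∃ a₀ ≥ 0, a₀ < 1 ∧ ∀ u ∈ waveClosure κ hκ, ∀ a : ℝ, a₀ ≤ a → a < 1 →
      l2On (volume.restrict (Metric.ball 0 a)) u ^ 2 * ∫ s in a..1, s ^ 2 ≤
        C * l2On (volume.restrict (shell a)) u ^ 2 := by
  obtain ⟨C, hC, τ, hτ, hb⟩ := exists_waveSphereNorm_le hκ h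
  refine ⟨C, hC, max 0 (1 - τ), le_max_left _ _, max_lt zero_lt_one (by linarith), ?_⟩
  intro u hu a haa ha1
  have ha : 0 ≤ a := (le_max_left _ _).trans haa
  have haτ : 1 - τ ≤ a := (le_max_right _ _).trans haa
  have hsub : Metric.ball (0 : E3) a ⊆ B1 := Metric.ball_subset_ball ha1.le
  set K := ∫ s in a..1, s ^ 2 with hK
  have hK0 : 0 ≤ K := intervalIntegral.integral_nonneg ha1.le fun s _ => sq_nonneg s
  set ν := volume.restrict (Metric.ball (0 : E3) a)
  set ρ := volume.restrict (shell a)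
  -- After taking square roots the inequality is between seminorms, so the triangle inequality
  -- carries it from the wave sums to their `L²` limit.
  have key : l2On ν u * √K ≤ √C * l2On ρ u := by
    refine le_of_forall_pos_le_add fun δ hδ => ?_
    have hD : 0 < √C + √K + 1 := by positivity
    obtain ⟨v, hv, hv'⟩ := hu.2 (δ / (√C + √K + 1)) (div_pos hδ hD)
    obtain ⟨c, hc⟩ := exists_waveSum_ae_eq hκ hv
    have hvL : MemLp v 2 muB := (memLp_waveSum κ c).ae_eq hc.symm
    have h1 : l2On ν v * √K ≤ √C * l2On ρ v := by
      have h := sq_l2On_waveSum_le (hb c) ha ha1.le haτ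
      rw [← l2On_congr (ae_restrict_of_ae_restrict_of_subset hsub hc),
        ← l2On_congr (ae_restrict_of_ae_restrict_of_subset (shell_subset a) hc)] at h
      refine (le_abs_self _).trans (abs_le_of_sq_le_sq ?_ (mul_nonneg (Real.sqrt_nonneg _) (l2On_nonneg _)))
      rwa [mul_pow, mul_pow, Real.sq_sqrt hK0, Real.sq_sqrt hC]
    have h2 : l2On ν u ≤ l2On ν (u - v) + l2On ν v := by
      have := l2On_add_le (memLp_restrict_of_subset hsub (hu.1.sub hvL))
        (memLp_restrict_of_subset hsub hvL)
      rwa [sub_add_cancel] at this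
    have h3 : l2On ρ v ≤ l2On ρ (u - v) + l2On ρ u := by
      have := l2On_add_le (memLp_restrict_of_subset (shell_subset a) (hvL.sub hu.1))
        (memLp_restrict_of_subset (shell_subset a) hu.1)
      rwa [sub_add_cancel, ← neg_sub, l2On_neg] at this
    have h4 : l2On ν (u - v) ≤ l2On muB (u - v) := l2On_restrict_le hsub (hu.1.sub hvL)
    have h5 : l2On ρ (u - v) ≤ l2On muB (u - v) := l2On_restrict_le (shell_subset a) (hu.1.sub hvL)
    have h6 := (lt_div_iff₀ hD).1 hv'
    have h7 := mul_le_mul_of_nonneg_right (h2.trans (add_le_add_left h4 _)) (Real.sqrt_nonneg K)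
    have h8 := mul_le_mul_of_nonneg_left (h3.trans (add_le_add_left h5 _)) (Real.sqrt_nonneg C)
    have h9 := l2On_nonneg (μ := muB) (u - v)
    nlinarith
  have h1 := pow_le_pow_left₀ (mul_nonneg (l2On_nonneg _) (Real.sqrt_nonneg _)) key 2
  rwa [mul_pow, mul_pow, Real.sq_sqrt hK0, Real.sq_sqrt hC] at h1

/-- The `L²`-norm on the ball of a continuous function in the closure of the spherical waves is
controlled by the `L²`-norm of its boundary values. -/
theorem exists_l2On_ball_le_l2On_sphere {κ : ℝ} (hκ : 0 < κ)
    (h : ∀ l, besselSeries l (κ ^ 2) ≠ 0) :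
    ∃ C > 0, ∀ u ∈ waveClosure κ hκ, ContinuousOn u (Metric.closedBall 0 1) →
      l2On muB u ≤ C * l2On sphMeasure (fun y : S2 => u y) := by
  obtain ⟨C, hC, a₀, ha₀, ha₀1, hb⟩ := exists_sq_l2On_ball_le hκ h
  -- The added `1` only makes the constant strictly positive.
  refine ⟨√C + 1, by positivity, fun u hu hcu => ?_⟩
  have hcont := continuous_comp_retract hcu
  set g : ℝ → ℝ := fun r => ∫ y : S2, ‖(u ∘ retract) (r • (y : E3))‖ ^ 2 ∂sphMeasure with hg
  have hgc : Continuous g := continuous_sphere_integral (f := fun x => ‖(u ∘ retract) x‖ ^ 2)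
    (hcont.norm.pow 2)
  have hug : ∀ r ∈ Set.Icc (0 : ℝ) 1, ∀ y : S2, (u ∘ retract) (r • (y : E3)) = u (r • (y : E3)) := by
    intro r hr y
    rw [Function.comp_apply, retract_of_mem]
    rw [mem_closedBall_zero_iff, norm_smul]
    simp [abs_of_nonneg hr.1, hr.2]
  have hint : ∀ s ⊆ B1, IntegrableOn (fun x => ‖u x‖ ^ 2) s := fun s hs =>
    (memLp_restrict_of_subset hs hu.1).integrable_norm_pow two_ne_zero
  have hball : ∀ a, 0 ≤ a → a ≤ 1 →
      l2On (volume.restrict (Metric.ball 0 a)) u ^ 2 = ∫ r in (0 : ℝ)..a, r ^ 2 * g r := by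
    intro a ha ha1
    rw [sq_l2On, setIntegral_ball_polar ha (hint _ (Metric.ball_subset_ball ha1))]
    refine intervalIntegral.integral_congr fun r hr => ?_
    rw [Set.uIcc_of_le ha] at hr
    simp only [hg, hug r ⟨hr.1, hr.2.trans ha1⟩, smul_eq_mul]
  have hshell : ∀ a, 0 ≤ a → a ≤ 1 →
      l2On (volume.restrict (shell a)) u ^ 2 = ∫ r in a..1, r ^ 2 * g r := by
    intro a ha ha1
    rw [sq_l2On, setIntegral_shell_polar ha ha1 (hint _ (shell_subset a))]
    refine intervalIntegral.integral_congr fun r hr => ?_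
    rw [Set.uIcc_of_le ha1] at hr
    simp only [hg, hug r ⟨ha.trans hr.1, hr.2⟩, smul_eq_mul]
  have hg1 : g 1 = l2On sphMeasure (fun y : S2 => u y) ^ 2 := by
    rw [sq_l2On]
    simp only [hg, hug 1 (Set.right_mem_Icc.2 zero_le_one)]
    simp only [one_smul]
  have hlim : ∀ ε > 0, l2On muB u ^ 2 ≤ C * (g 1 + ε) := by
    intro ε hε
    -- Let `a` increase to `1`. The shell integral is at most its weight `∫_a^1 s²` times `g 1 + ε`
    -- by continuity of `g`; this weight cancels and the smaller balls exhaust the unit ball.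
    have hF : Tendsto (fun a => ∫ r in (0 : ℝ)..a, r ^ 2 * g r) (𝓝[<] 1)
        (𝓝 (∫ r in (0 : ℝ)..1, r ^ 2 * g r)) := by
      have : Continuous fun a => ∫ r in (0 : ℝ)..a, r ^ 2 * g r :=
        intervalIntegral.continuous_primitive
          (fun a b => Continuous.intervalIntegrable (by fun_prop) a b) 0
      exact (this.tendsto 1).mono_left nhdsWithin_le_nhds
    rw [show l2On muB u ^ 2 = ∫ r in (0 : ℝ)..1, r ^ 2 * g r from hball 1 zero_le_one le_rfl]
    obtain ⟨d, hd, hdb⟩ := Metric.continuous_iff.1 hgc 1 ε hε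
    refine le_of_tendsto hF ?_
    filter_upwards [Ioo_mem_nhdsLT (show max a₀ (1 - d) < 1 from max_lt ha₀1 (by linarith))]
      with a ha
    have ha' : a₀ ≤ a := (le_max_left _ _).trans ha.1.le
    have had : 1 - d < a := (le_max_right _ _).trans_lt ha.1
    have h0 : 0 ≤ a := ha₀.trans ha'
    have h1 := hb u hu a ha' ha.2
    rw [hball a h0 ha.2.le, hshell a h0 ha.2.le] at h1
    have h2 : ∫ r in a..1, r ^ 2 * g r ≤ (∫ s in a..1, s ^ 2) * (g 1 + ε) := by
      rw [← intervalIntegral.integral_mul_const]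
      refine intervalIntegral.integral_mono_on ha.2.le
        (Continuous.intervalIntegrable (by fun_prop) _ _)
        (Continuous.intervalIntegrable (by fun_prop) _ _) fun s hs => ?_
      refine mul_le_mul_of_nonneg_left ?_ (sq_nonneg s)
      have h3 := hdb s (by rw [Real.dist_eq, abs_lt]; constructor <;> linarith [hs.1, hs.2])
      rw [Real.dist_eq, abs_lt] at h3
      linarith [h3.2]
    have hK : 0 < ∫ s in a..1, s ^ 2 := by
      refine intervalIntegral.integral_pos ha.2 (by fun_prop) (fun s _ => sq_nonneg s)
        ⟨1, ⟨ha.2.le, le_rfl⟩, by norm_num⟩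
    have h4 := h1.trans (mul_le_mul_of_nonneg_left h2 hC)
    refine le_of_mul_le_mul_right (h4.trans_eq ?_) hK
    ring
  have hle : l2On muB u ^ 2 ≤ C * g 1 := by
    refine ge_of_tendsto (f := fun ε => C * (g 1 + ε)) (x := 𝓝[>] (0 : ℝ)) ?_
      (eventually_nhdsWithin_of_forall fun ε hε => hlim ε hε)
    have : Continuous fun ε => C * (g 1 + ε) := by fun_prop
    simpa using (this.tendsto 0).mono_left nhdsWithin_le_nhds
  have hS := l2On_nonneg (μ := sphMeasure) (fun y : S2 => u y)
  refine le_trans ?_ (mul_le_mul_of_nonneg_right (le_add_of_nonneg_right zero_le_one) hS)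
  refine (le_abs_self _).trans (abs_le_of_sq_le_sq ?_ (mul_nonneg (Real.sqrt_nonneg _) hS))
  rw [mul_pow, Real.sq_sqrt hC, ← hg1]
  exact hle

/-! ### Cubature on finite-dimensional spaces -/

theorem integral_sq_norm_eq_sum {k : ℕ} (a : Fin k → ℂ) (e : Fin k → C(S2, ℂ)) :
    ((∫ y, ‖(∑ i, a i • e i) y‖ ^ 2 ∂sphMeasure : ℝ) : ℂ) =
      ∑ i, ∑ j, a i * starRingEnd ℂ (a j) *
        ∫ y, e i y * starRingEnd ℂ (e j y) ∂sphMeasure := by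
  have hc : ∀ i j, Continuous fun y => a i * starRingEnd ℂ (a j) *
      (e i y * starRingEnd ℂ (e j y)) := fun i j =>
    continuous_const.mul ((e i).continuous.mul (Complex.continuous_conj.comp (e j).continuous))
  rw [← integral_complex_ofReal]
  have h : ∀ y, ((‖(∑ i, a i • e i) y‖ ^ 2 : ℝ) : ℂ) =
      ∑ i, ∑ j, a i * starRingEnd ℂ (a j) * (e i y * starRingEnd ℂ (e j y)) := by
    intro y
    rw [Complex.ofReal_pow, ← Complex.mul_conj', ContinuousMap.sum_apply, map_sum,
      Finset.sum_mul_sum]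
    refine Finset.sum_congr rfl fun i _ => Finset.sum_congr rfl fun j _ => ?_
    simp only [ContinuousMap.smul_apply, smul_eq_mul, map_mul]
    ring
  simp only [h]
  rw [integral_finsetSum _ fun i _ => integrable_sphMeasure (continuous_finsetSum _ fun j _ => hc i j)]
  refine Finset.sum_congr rfl fun i _ => ?_
  rw [integral_finsetSum _ fun j _ => integrable_sphMeasure (hc i j)]
  exact Finset.sum_congr rfl fun j _ => integral_const_mul _ _

theorem cubature_sq_norm_eq_sum {k S : ℕ} (a : Fin k → ℂ) (e : Fin k → C(S2, ℂ))
    (x : Fin S → S2) (w : Fin S → ℝ) :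
    ((∑ s, w s * ‖(∑ i, a i • e i) (x s)‖ ^ 2 : ℝ) : ℂ) =
      ∑ i, ∑ j, a i * starRingEnd ℂ (a j) *
        ∑ s, (w s : ℂ) * (e i (x s) * starRingEnd ℂ (e j (x s))) := by
  have h : ∀ s, ((w s * ‖(∑ i, a i • e i) (x s)‖ ^ 2 : ℝ) : ℂ) =
      ∑ i, ∑ j, a i * starRingEnd ℂ (a j) *
        ((w s : ℂ) * (e i (x s) * starRingEnd ℂ (e j (x s)))) := by
    intro s
    rw [Complex.ofReal_mul, Complex.ofReal_pow, ← Complex.mul_conj', ContinuousMap.sum_apply,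
      map_sum, Finset.sum_mul_sum, Finset.mul_sum]
    refine Finset.sum_congr rfl fun i _ => ?_
    rw [Finset.mul_sum]
    refine Finset.sum_congr rfl fun j _ => ?_
    simp only [ContinuousMap.smul_apply, smul_eq_mul, map_mul]
    ring
  rw [Complex.ofReal_sum]
  simp only [h]
  rw [Finset.sum_comm]
  refine Finset.sum_congr rfl fun i _ => ?_
  rw [Finset.sum_comm]
  exact Finset.sum_congr rfl fun j _ => (Finset.mul_sum _ _ _).symm

theorem norm_double_sum_le {k : ℕ} (a : Fin k → ℂ) (M : Fin k → Fin k → ℂ) {ε : ℝ} (hε : 0 ≤ ε)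
    (hM : ∀ i j, ‖M i j‖ ≤ ε) :
    ‖∑ i, ∑ j, a i * starRingEnd ℂ (a j) * M i j‖ ≤ ε * k * ∑ i, ‖a i‖ ^ 2 := by
  have h1 : ‖∑ i, ∑ j, a i * starRingEnd ℂ (a j) * M i j‖ ≤
      ∑ i, ∑ j, ‖a i‖ * ‖a j‖ * ε := by
    refine (norm_sum_le _ _).trans (Finset.sum_le_sum fun i _ => ?_)
    refine (norm_sum_le _ _).trans (Finset.sum_le_sum fun j _ => ?_)
    rw [norm_mul, norm_mul, RCLike.norm_conj]
    exact mul_le_mul_of_nonneg_left (hM i j) (by positivity)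
  refine h1.trans ?_
  have h2 : ∑ i, ∑ j, ‖a i‖ * ‖a j‖ * ε = ε * (∑ i, ‖a i‖) ^ 2 := by
    rw [sq, Finset.sum_mul_sum, Finset.mul_sum]
    refine Finset.sum_congr rfl fun i _ => ?_
    rw [Finset.mul_sum]
    exact Finset.sum_congr rfl fun j _ => mul_comm _ _
  have h3 := sq_sum_le_card_mul_sum_sq (s := Finset.univ) (f := fun i => ‖a i‖)
  rw [Finset.card_univ, Fintype.card_fin] at h3
  rw [h2, mul_assoc]
  exact mul_le_mul_of_nonneg_left h3 hε

theorem sq_norm_toLp (v : C(S2, ℂ)) :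
    ‖ContinuousMap.toLp (E := ℂ) 2 sphMeasure ℂ v‖ ^ 2 = ∫ y, ‖v y‖ ^ 2 ∂sphMeasure := by
  have h := ContinuousMap.inner_toLp (𝕜 := ℂ) sphMeasure v v
  rw [inner_self_eq_norm_sq_to_K] at h
  refine Complex.ofReal_injective ?_
  rw [← integral_complex_ofReal]
  simp only [Complex.ofReal_pow]
  refine h.trans (integral_congr_ae (ae_of_all _ fun y => ?_))
  simp only
  rw [Complex.mul_conj']

/-- On a finite-dimensional space of continuous functions, the discrete `L²`-norms of a convergent
sequence of cubature rules are eventually equivalent to the `L²`-norm. -/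
theorem eventually_abs_cubature_sub_le {x : (S : ℕ) → Fin S → S2} {w : (S : ℕ) → Fin S → ℝ}
    (hconv : CubatureConvergence x w) (W : Submodule ℂ C(S2, ℂ)) [FiniteDimensional ℂ W] :
    ∀ᶠ S in atTop, ∀ v ∈ W, |∑ s, w S s * ‖v (x S s)‖ ^ 2 - ∫ y, ‖v y‖ ^ 2 ∂sphMeasure| ≤
      1 / 2 * ∫ y, ‖v y‖ ^ 2 ∂sphMeasure := by
  let T : C(S2, ℂ) →ₗ[ℂ] Lp ℂ 2 sphMeasure := (ContinuousMap.toLp (E := ℂ) 2 sphMeasure ℂ).toLinearMap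
  have hT : Function.Injective T := ContinuousMap.toLp_injective sphMeasure
  let E := W.equivMapOfInjective T hT
  have hfin : FiniteDimensional ℂ (W.map T) := inferInstance
  -- An `L²`-orthonormal basis pulled back to continuous functions reduces the uniform claim on `W`
  -- to convergence of finitely many Gram entries.
  let b := stdOrthonormalBasis ℂ (W.map T)
  set k := Module.finrank ℂ (W.map T)
  let e : Fin k → C(S2, ℂ) := fun i => (E.symm (b i) : C(S2, ℂ))
  -- The double sum costs a factor `k`, and `k / (2 (k + 1)) ≤ 1/2`; the added `1` also covers `k =
  -- 0`.
  have hlim : ∀ᶠ S in atTop, ∀ i j,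
      ‖∑ s, (w S s : ℂ) * (e i (x S s) * starRingEnd ℂ (e j (x S s))) -
        ∫ y, e i y * starRingEnd ℂ (e j y) ∂sphMeasure‖ ≤ 1 / (2 * (k + 1)) := by
    refine eventually_all.2 fun i => eventually_all.2 fun j => ?_
    have h := hconv (fun y => e i y * starRingEnd ℂ (e j y))
      ((e i).continuous.mul (Complex.continuous_conj.comp (e j).continuous))
    filter_upwards [Metric.tendsto_nhds.1 h (1 / (2 * (k + 1))) (by positivity)] with S hS
    rw [dist_eq_norm] at hS
    exact hS.le
  filter_upwards [hlim] with S hS v hv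
  let a : Fin k → ℂ := fun i => b.repr (E ⟨v, hv⟩) i
  have hva : v = ∑ i, a i • e i := by
    have h := congrArg E.symm (b.sum_repr (E ⟨v, hv⟩))
    rw [map_sum, LinearEquiv.symm_apply_apply] at h
    have h2 := congrArg (Submodule.subtype W) h
    rw [map_sum] at h2
    simpa [a, e] using h2.symm
  have hQ : ∫ y, ‖v y‖ ^ 2 ∂sphMeasure = ∑ i, ‖a i‖ ^ 2 := by
    rw [← sq_norm_toLp]
    have h1 : ‖ContinuousMap.toLp (E := ℂ) 2 sphMeasure ℂ v‖ = ‖E ⟨v, hv⟩‖ := rfl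
    rw [h1, ← b.repr.norm_map, EuclideanSpace.norm_sq_eq]
  have hdiff : ((∑ s, w S s * ‖v (x S s)‖ ^ 2 - ∫ y, ‖v y‖ ^ 2 ∂sphMeasure : ℝ) : ℂ) =
      ∑ i, ∑ j, a i * starRingEnd ℂ (a j) *
        (∑ s, (w S s : ℂ) * (e i (x S s) * starRingEnd ℂ (e j (x S s))) -
          ∫ y, e i y * starRingEnd ℂ (e j y) ∂sphMeasure) := by
    rw [Complex.ofReal_sub, hva, cubature_sq_norm_eq_sum, integral_sq_norm_eq_sum,
      ← Finset.sum_sub_distrib]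
    refine Finset.sum_congr rfl fun i _ => ?_
    rw [← Finset.sum_sub_distrib]
    exact Finset.sum_congr rfl fun j _ => (mul_sub _ _ _).symm
  rw [← Real.norm_eq_abs, ← Complex.norm_real, hdiff]
  refine (norm_double_sum_le a _ (by positivity) hS).trans ?_
  rw [hQ]
  refine mul_le_mul_of_nonneg_right ?_ (Finset.sum_nonneg fun i _ => sq_nonneg _)
  rw [one_div_mul_eq_div, div_le_div_iff₀ (by positivity) two_pos]
  linarith

/-! ### The regularized boundary sampling method -/

theorem continuous_sphere_restrict {u : E3 → ℂ} (hu : ContinuousOn u (Metric.closedBall 0 1)) :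
    Continuous fun y : S2 => u y :=
  hu.comp_continuous continuous_subtype_val fun y => Metric.sphere_subset_closedBall y.2

theorem loadVector_sub_samplingMatrix_mulVec {S N : ℕ} (x : Fin S → S2) (w : Fin S → ℝ)
    (Φ : Fin N → E3 → ℂ) (u : E3 → ℂ) (c : Fin N → ℂ) :
    loadVector x w u - samplingMatrix x w Φ *ᵥ c = loadVector x w (u - synthesis Φ c) := by
  ext s
  simp only [loadVector, samplingMatrix, synthesis, Matrix.mulVec, dotProduct, Pi.sub_apply,
    mul_sub, Finset.mul_sum]
  congr 1
  exact Finset.sum_congr rfl fun p _ => by ring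

theorem sq_norm_loadVector {S : ℕ} (x : Fin S → S2) {w : Fin S → ℝ} (hw : ∀ s, 0 < w s)
    (u : E3 → ℂ) :
    ‖WithLp.toLp 2 (loadVector x w u)‖ ^ 2 = ∑ s, w s * ‖u (x s)‖ ^ 2 := by
  rw [EuclideanSpace.norm_sq_eq]
  refine Finset.sum_congr rfl fun s _ => ?_
  simp only [loadVector, norm_mul, Complex.norm_real, mul_pow, Real.norm_eq_abs, sq_abs,
    Real.sq_sqrt (hw s).le]

/-- The squared Frobenius norm is a sum of cubature values of `|φ_p|²`, each converging as `S`
grows. This bound keeps the threshold for `ε` away from zero. -/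
theorem exists_eventually_sigmaMax_le {κ : ℝ} {N : ℕ} {Φ : Fin N → E3 → ℂ}
    (hΦ : ∀ p, MemBC0 κ (Φ p)) {x : (S : ℕ) → Fin S → S2} {w : (S : ℕ) → Fin S → ℝ}
    (hw : ∀ S s, 0 < w S s) (hconv : CubatureConvergence x w) :
    ∃ M ≥ 0, ∀ᶠ S in atTop, sigmaMax (samplingMatrix (x S) (w S) Φ) ≤ M := by
  have h1 : ∀ p, ∃ L : ℝ, ∀ᶠ S in atTop, ∑ s, w S s * ‖Φ p (x S s)‖ ^ 2 ≤ L := by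
    intro p
    have hc := continuous_sphere_restrict (hΦ p).2
    have h := hconv (fun y => ((‖Φ p y‖ ^ 2 : ℝ) : ℂ))
      (Complex.continuous_ofReal.comp (hc.norm.pow 2))
    have h2 := ((Complex.continuous_re.tendsto _).comp h).eventually_le_const (lt_add_one _)
    refine ⟨_, h2.mono fun S hS => le_trans (le_of_eq ?_) hS⟩
    simp only [Function.comp_apply, Complex.re_sum, ← Complex.ofReal_mul, Complex.ofReal_re]
  choose L hL using h1
  refine ⟨√(∑ p, L p), Real.sqrt_nonneg _, ?_⟩
  filter_upwards [eventually_all.2 hL] with S hS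
  refine Real.le_sqrt_of_sq_le ((sq_sigmaMax_le _).trans (Finset.sum_le_sum fun p _ => ?_))
  refine le_trans (le_of_eq (Finset.sum_congr rfl fun s _ => ?_)) (hS p)
  simp only [samplingMatrix, norm_mul, Complex.norm_real, mul_pow, Real.norm_eq_abs, sq_abs,
    Real.sq_sqrt (hw S s).le]

/-- Quasi-optimality of the regularized boundary sampling method. -/
theorem exists_l2Norm_sub_synthesis_le {κ : ℝ} (hκ : 0 < κ)
    (hD : ¬ IsDirichletEigenvalue (κ ^ 2)) :
    ∃ C > 0, ∀ {N : ℕ} (Φ : Fin N → E3 → ℂ) (x : (S : ℕ) → Fin S → S2)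
      (w : (S : ℕ) → Fin S → ℝ), (∀ p, MemBC0 κ (Φ p)) → (∀ S s, 0 < w S s) →
      CubatureConvergence x w → ∀ u, MemBC0 κ u → ∀ᶠ S in atTop, ∀ ε : ℝ, 0 < ε → ∀ U V,
        IsSVD (samplingMatrix (x S) (w S) Φ) U V → ∀ μ : EuclideanSpace ℂ (Fin N),
        l2Norm (u - synthesis Φ (regularizedSolution (samplingMatrix (x S) (w S) Φ) U V ε
          (loadVector (x S) (w S) u))) ≤
        C * (bNorm κ (u - synthesis Φ μ) + ε * sigmaMax (samplingMatrix (x S) (w S) Φ) * ‖μ‖) := by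
  obtain ⟨C, hC, hlow⟩ := exists_l2On_ball_le_l2On_sphere hκ
    fun l h => hD (isDirichletEigenvalue_of_besselSeries_eq_zero h)
  obtain ⟨D, hD0, htr⟩ := trace_inequality hκ
  refine ⟨2 * C * (D + 1), by positivity, ?_⟩
  intro N Φ x w hΦ hw hconv u hu
  let cu : C(S2, ℂ) := ⟨fun y => u y, continuous_sphere_restrict hu.2⟩
  let cΦ : Fin N → C(S2, ℂ) := fun p => ⟨fun y => Φ p y, continuous_sphere_restrict (hΦ p).2⟩
  -- Including `u` in the space makes the norm equivalence available for every residual `u - T c`,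
  -- in particular for the computed solution, whose coefficients vary with `S` and `ε`.
  let W := Submodule.span ℂ (insert cu (Set.range cΦ))
  have hfin : FiniteDimensional ℂ W :=
    FiniteDimensional.span_of_finite ℂ ((Set.finite_range cΦ).insert cu)
  filter_upwards [eventually_abs_cubature_sub_le hconv W] with S hS ε hε U V hUV μ
  have hdisc : ∀ c : Fin N → ℂ,
      |‖WithLp.toLp 2 (loadVector (x S) (w S) (u - synthesis Φ c))‖ ^ 2 -
        l2On sphMeasure (fun y : S2 => (u - synthesis Φ c) y) ^ 2| ≤
      1 / 2 * l2On sphMeasure (fun y : S2 => (u - synthesis Φ c) y) ^ 2 := by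
    intro c
    have hv : cu - ∑ p, c p • cΦ p ∈ W :=
      sub_mem (Submodule.subset_span (Set.mem_insert _ _)) (sum_mem fun p _ =>
        Submodule.smul_mem _ _ (Submodule.subset_span (Set.mem_insert_of_mem _ ⟨p, rfl⟩)))
    have h := hS _ hv
    have e : ∀ y : S2, (cu - ∑ p, c p • cΦ p) y = (u - synthesis Φ c) y := fun y => by
      simp [cu, cΦ, synthesis, ContinuousMap.sum_apply]
    simp only [e] at h
    rwa [sq_norm_loadVector _ (hw S), sq_l2On]
  have hcont : ∀ c : Fin N → ℂ, ContinuousOn (u - synthesis Φ c) (Metric.closedBall 0 1) :=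
    fun c => hu.2.sub (continuousOn_finsetSum _ fun p _ => continuousOn_const.mul (hΦ p).2)
  set A := samplingMatrix (x S) (w S) Φ
  set ξ := regularizedSolution A U V ε (loadVector (x S) (w S) u)
  have h1 : l2Norm (u - synthesis Φ ξ) ≤
      C * l2On sphMeasure (fun y : S2 => (u - synthesis Φ ξ) y) := by
    refine hlow _ (sub_mem (hu.1.mem_waveClosure hκ) ?_) (hcont ξ)
    rw [synthesis_eq_sum]
    exact sum_mem fun p _ => Submodule.smul_mem _ _ ((hΦ p).1.mem_waveClosure hκ)
  have h2 : l2On sphMeasure (fun y : S2 => (u - synthesis Φ μ) y) ≤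
      D * bNorm κ (u - synthesis Φ μ) := by
    refine htr _ (h1Space.sub_mem hu.1.1 ?_) (hcont μ)
    rw [synthesis_eq_sum]
    exact sum_mem fun p _ => Submodule.smul_mem _ _ (show Φ p ∈ h1Space from (hΦ p).1.1)
  have h3 := norm_sub_regularizedSolution_le hUV hε.le (loadVector (x S) (w S) u) μ
  rw [loadVector_sub_samplingMatrix_mulVec, loadVector_sub_samplingMatrix_mulVec] at h3
  have h4 := abs_le.1 (hdisc ξ)
  have h5 := abs_le.1 (hdisc μ)
  have hs2 : (√2 : ℝ) ^ 2 = 2 := Real.sq_sqrt zero_le_two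
  -- The relative cubature error is at most `1/2`, so squared discrete and continuous norms differ
  -- by a factor between `1/2` and `3/2`; a factor `2` in each direction suffices.
  have h6 : l2On sphMeasure (fun y : S2 => (u - synthesis Φ ξ) y) ≤
      √2 * ‖WithLp.toLp 2 (loadVector (x S) (w S) (u - synthesis Φ ξ))‖ := by
    refine (le_abs_self _).trans (abs_le_of_sq_le_sq ?_ (by positivity))
    rw [mul_pow, hs2]
    linarith [h4.1]
  have h7 : ‖WithLp.toLp 2 (loadVector (x S) (w S) (u - synthesis Φ μ))‖ ≤
      √2 * l2On sphMeasure (fun y : S2 => (u - synthesis Φ μ) y) := by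
    refine (le_abs_self _).trans (abs_le_of_sq_le_sq ?_
      (mul_nonneg (Real.sqrt_nonneg _) (l2On_nonneg _)))
    rw [mul_pow, hs2]
    nlinarith [h5.2, sq_nonneg (l2On sphMeasure (fun y : S2 => (u - synthesis Φ μ) y))]
  have hσ : 0 ≤ ε * sigmaMax A * ‖μ‖ := by
    have := singVal_nonneg A 0
    exact mul_nonneg (mul_nonneg hε.le this) (norm_nonneg _)
  have hb := bNorm_nonneg κ (u - synthesis Φ μ)
  have hs3 : √2 ≤ 2 := Real.sqrt_le_iff.2 ⟨zero_le_two, by norm_num⟩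
  calc l2Norm (u - synthesis Φ ξ)
      ≤ C * (√2 * (√2 * (D * bNorm κ (u - synthesis Φ μ)) + ε * sigmaMax A * ‖μ‖)) := by
        refine h1.trans (mul_le_mul_of_nonneg_left (h6.trans ?_) hC.le)
        refine mul_le_mul_of_nonneg_left (h3.trans (add_le_add_left (h7.trans ?_) _))
          (Real.sqrt_nonneg _)
        exact mul_le_mul_of_nonneg_left h2 (Real.sqrt_nonneg _)
    _ = C * (2 * D * bNorm κ (u - synthesis Φ μ) + √2 * (ε * sigmaMax A * ‖μ‖)) := by
        linear_combination (C * D * bNorm κ (u - synthesis Φ μ)) * hs2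
    _ ≤ C * (2 * (D + 1) * bNorm κ (u - synthesis Φ μ) +
          2 * (D + 1) * (ε * sigmaMax A * ‖μ‖)) := by
        gcongr
        · linarith
        · linarith
    _ = _ := by ring

end HelmholtzBall

end

/-! ### Balancing approximation and regularization errors -/

theorem corollary4p3 (κ : ℝ) (hκ : 0 < κ)
    (hD : ¬ HelmholtzBall.IsDirichletEigenvalue (κ ^ 2)) :
    ∃ Cerr : ℝ, 0 < Cerr ∧
      ∀ (N : ℕ → ℕ) (Φ : (P : ℕ) → Fin (N P) → HelmholtzBall.E3 → ℂ)
        (x : (S : ℕ) → Fin S → HelmholtzBall.S2) (w : (S : ℕ) → Fin S → ℝ),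
        (∀ P p, HelmholtzBall.MemBC0 κ (Φ P p)) →
        HelmholtzBall.IsStableDiscreteApprox κ Φ →
        (∀ S s, 0 < w S s) →
        HelmholtzBall.CubatureConvergence x w →
        ∀ δ : ℝ, 0 < δ →
          -- the error bound for all sufficiently large `S` and all sufficiently small `ε`
          (∀ u, HelmholtzBall.MemBC0 κ u → ∃ (P S₀ : ℕ) (ε₀ : ℝ), 0 < ε₀ ∧ ε₀ ≤ 1 ∧
            ∀ S, S₀ ≤ S → ∀ ε : ℝ, 0 < ε → ε ≤ ε₀ →
              ∀ U V, HelmholtzBall.IsSVD (HelmholtzBall.samplingMatrix (x S) (w S) (Φ P)) U V →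
                HelmholtzBall.l2Norm (u - HelmholtzBall.synthesis (Φ P)
                  (HelmholtzBall.regularizedSolution
                    (HelmholtzBall.samplingMatrix (x S) (w S) (Φ P)) U V ε
                    (HelmholtzBall.loadVector (x S) (w S) u)))
                  ≤ δ * HelmholtzBall.bNorm κ u) ∧
          -- the explicit threshold `ε ≤ δ / (2 Cerr Cds σ_max |Φ_P| ^ sds)`, written without
          -- division; it stays above some `ε₀ > 0` for all `S ≥ S₀`
          (∀ sds Cds : ℝ, HelmholtzBall.StableAtTolerance κ Φ (δ / (2 * Cerr)) sds Cds →
            ∀ u, HelmholtzBall.MemBC0 κ u → ∃ (P S₀ : ℕ) (ε₀ : ℝ), 0 < ε₀ ∧ ε₀ ≤ 1 ∧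
              ∀ S, S₀ ≤ S →
                ε₀ * (2 * Cerr * Cds *
                  HelmholtzBall.sigmaMax (HelmholtzBall.samplingMatrix (x S) (w S) (Φ P)) *
                  (N P : ℝ) ^ sds) ≤ δ ∧
                ∀ ε : ℝ, 0 < ε → ε ≤ 1 →
                  ε * (2 * Cerr * Cds *
                    HelmholtzBall.sigmaMax (HelmholtzBall.samplingMatrix (x S) (w S) (Φ P)) *
                    (N P : ℝ) ^ sds) ≤ δ →
                  ∀ U V,
                    HelmholtzBall.IsSVD (HelmholtzBall.samplingMatrix (x S) (w S) (Φ P)) U V →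
                    HelmholtzBall.l2Norm (u - HelmholtzBall.synthesis (Φ P)
                      (HelmholtzBall.regularizedSolution
                        (HelmholtzBall.samplingMatrix (x S) (w S) (Φ P)) U V ε
                        (HelmholtzBall.loadVector (x S) (w S) u)))
                      ≤ δ * HelmholtzBall.bNorm κ u) := by
  
  obtain ⟨C, hC, hmain⟩ := HelmholtzBall.exists_l2Norm_sub_synthesis_le hκ hD
  refine ⟨C, hC, fun N Φ x w hΦ hstab hw hconv δ hδ => ?_⟩
  have hη : 0 < δ / (2 * C) := by positivity
  have hσ : ∀ {S M : ℕ} (A : Matrix (Fin S) (Fin M) ℂ), 0 ≤ HelmholtzBall.sigmaMax A :=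
    fun A => HelmholtzBall.singVal_nonneg A 0
  have hb : ∀ sds Cds : ℝ, HelmholtzBall.StableAtTolerance κ Φ (δ / (2 * C)) sds Cds →
      ∀ u, HelmholtzBall.MemBC0 κ u → ∃ (P S₀ : ℕ) (ε₀ : ℝ), 0 < ε₀ ∧ ε₀ ≤ 1 ∧
        ∀ S, S₀ ≤ S →
          ε₀ * (2 * C * Cds *
            HelmholtzBall.sigmaMax (HelmholtzBall.samplingMatrix (x S) (w S) (Φ P)) *
            (N P : ℝ) ^ sds) ≤ δ ∧
          ∀ ε : ℝ, 0 < ε → ε ≤ 1 →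
            ε * (2 * C * Cds *
              HelmholtzBall.sigmaMax (HelmholtzBall.samplingMatrix (x S) (w S) (Φ P)) *
              (N P : ℝ) ^ sds) ≤ δ →
            ∀ U V,
              HelmholtzBall.IsSVD (HelmholtzBall.samplingMatrix (x S) (w S) (Φ P)) U V →
              HelmholtzBall.l2Norm (u - HelmholtzBall.synthesis (Φ P)
                (HelmholtzBall.regularizedSolution
                  (HelmholtzBall.samplingMatrix (x S) (w S) (Φ P)) U V ε
                  (HelmholtzBall.loadVector (x S) (w S) u)))
                ≤ δ * HelmholtzBall.bNorm κ u := by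
    rintro sds Cds ⟨-, hCds, happ⟩ u hu
    obtain ⟨P, μ, hμ, hμ'⟩ := happ u hu.1
    obtain ⟨M, hM, hσM⟩ := HelmholtzBall.exists_eventually_sigmaMax_le (hΦ P) hw hconv
    -- `P` and `μ` are fixed before `S`, so one `S₀` serves both the bound on `σ_max` and the
    -- quasi-optimality.
    obtain ⟨S₀, hS₀⟩ := eventually_atTop.1 (hσM.and (hmain (Φ P) x w (hΦ P) hw hconv u hu))
    have hK : 0 ≤ 2 * C * Cds * M * (N P : ℝ) ^ sds := by positivity
    have hpos : 0 < 2 * C * Cds * M * (N P : ℝ) ^ sds + 1 := by positivity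
    -- The threshold with `σ_max` replaced by its uniform bound `M`; the added `1` avoids division
    -- by zero.
    refine ⟨P, S₀, min 1 (δ / (2 * C * Cds * M * (N P : ℝ) ^ sds + 1)),
      lt_min one_pos (div_pos hδ hpos), min_le_left _ _, fun S hS => ⟨?_, ?_⟩⟩
    · have h1 : 2 * C * Cds *
          HelmholtzBall.sigmaMax (HelmholtzBall.samplingMatrix (x S) (w S) (Φ P)) *
          (N P : ℝ) ^ sds ≤ 2 * C * Cds * M * (N P : ℝ) ^ sds := by
        have := (hS₀ S hS).1
        gcongr
      calc _ ≤ δ / (2 * C * Cds * M * (N P : ℝ) ^ sds + 1) *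
            (2 * C * Cds * M * (N P : ℝ) ^ sds + 1) :=
            mul_le_mul (min_le_right _ _) (by linarith)
              (mul_nonneg (mul_nonneg (by positivity) (hσ _)) (by positivity))
              (div_pos hδ hpos).le
        _ = δ := div_mul_cancel₀ _ hpos.ne'
    · intro ε hε _ hεδ U V hUV
      have hu0 := HelmholtzBall.bNorm_nonneg κ u
      refine ((hS₀ S hS).2 ε hε U V hUV μ).trans ?_
      set σ := HelmholtzBall.sigmaMax (HelmholtzBall.samplingMatrix (x S) (w S) (Φ P)) with hσ_def
      have h1 : C * HelmholtzBall.bNorm κ (u - HelmholtzBall.synthesis (Φ P) μ) ≤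
          δ / 2 * HelmholtzBall.bNorm κ u := by
        refine (mul_le_mul_of_nonneg_left hμ hC.le).trans_eq ?_
        field_simp
      have h2 : C * (ε * σ * ‖μ‖) ≤ δ / 2 * HelmholtzBall.bNorm κ u := by
        have h3 : C * (ε * σ * ‖μ‖) ≤
            C * (ε * σ * (Cds * (N P : ℝ) ^ sds * HelmholtzBall.bNorm κ u)) := by
          have : 0 ≤ σ := hσ _
          gcongr
        have h4 := mul_le_mul_of_nonneg_right hεδ hu0
        linarith
      linarith
  -- The first claim follows from the second with any stability constants: below the uniform `ε₀`
  -- the explicit threshold condition holds by monotonicity.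
  refine ⟨fun u hu => ?_, hb⟩
  obtain ⟨sds, Cds, hs⟩ := hstab _ hη
  obtain ⟨P, S₀, ε₀, hε₀, hε₁, h⟩ := hb sds Cds hs u hu
  refine ⟨P, S₀, ε₀, hε₀, hε₁, fun S hS ε hε hεε U V hUV => ?_⟩
  obtain ⟨h1, h2⟩ := h S hS
  refine h2 ε hε (hεε.trans hε₁) (le_trans (mul_le_mul_of_nonneg_right hεε ?_) h1) U V hUV
  have hCds := hs.2.1
  exact mul_nonneg (mul_nonneg (by positivity) (hσ _)) (by positivity)
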